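/- **Setting.** Let $q\in\mathbb C$, $q\ne 0$, not a root of unity, let $\mathbf i=\sqrt{-1}$ and let $t$ satisfy $t^2=-q$. Let $\mathcal A=\mathbb C_q[osp(1,2)]$ be the $\mathbb Z_2$-graded algebra over $\mathbb C$ with generators $a,b,c,d,\sigma$ ($b,c$ odd, $a,d,\sigma$ even) and relations $ab=tba$, $ac=tca$, $bc=-cb$, $bd=-tdb$, $cd=-tdc$, $ad-da=(t^{-1}-t)bc$, $ad+tbc=\sigma$, $\sigma^2=1$. Its coproduct $\Delta:\mathcal A\to\mathcal A\otimes\mathcal A$ (an algebra map into the $\mathbb Z_2$-graded tensor product) is $\Delta a=a\otimes a+b\otimes c$, $\Delta b=a\otimes b+b\otimes d$, $\Delta c=c\otimes a+d\otimes c$, $\Delta d=c\otimes b+d\otimes d$, $\Delta\sigma=\sigma\otimes\sigma$, and its counit $\varepsilon$ sends $a,d,\sigma$ to $1$ and $b,c$ to $0$. The generators $k^{\pm1},e,f$ of $U_q(osp(1,2))$ are viewed as linear functions on $\mathcal A$: $k^{\pm1}$ are the algebra maps with $k^{\pm1}(a)=t^{\pm1}$, $k^{\pm1}(d)=-t^{\mp1}$,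 $k^{\pm1}(\sigma)=-1$, $k^{\pm1}(b)=k^{\pm1}(c)=0$; $e$ and $f$ vanish on $1$ and on all generators except $e(b)=\frac{t-t^{-1}}{q-q^{-1}}$, $f(c)=1$, and satisfy $e(xy)=e(x)\varepsilon(y)+(-1)^{p(x)}k(x)e(y)$, $f(xy)=f(x)k^{-1}(y)+(-1)^{p(x)}\varepsilon(x)f(y)$. A function $x$ on $\mathcal A$ acts by $L_x(u)=\sum(-1)^{p(x)p(u_1)}x(u_2)\,u_1$, where $\Delta(u)=\sum u_1\otimes u_2$ (extended linearly to $x$ that are not homogeneous), and $(xy)(u)=x(L_y(u))$. For $\alpha,\beta,\gamma\in\mathbb C\setminus\{0\}$ put $$x_{\alpha\beta}=\alpha e+\beta fk,\qquad x_{\alpha\gamma}=\alpha e+\gamma(k-1),\qquad x_{\beta\gamma}=\beta fk+\gamma(k-1),$$ where $1$ is the function $\varepsilon$. The left invariants of $x$ are the $u\in\mathcal A$ with $L_x(u)=\varepsilon(x)u$, where $\varepsilon(x)=x(1)$ (so $\varepsilon(x)=0$ for these three elements). Put $(u;v)_n=\prod_{i=0}^{n-1}(1-uv^i)$ and let $r_{n,i}$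 ($0\le i\le n$) be any choice of square roots of the Gauss binomial coefficients $\frac{(v;v)_n}{(v;v)_i(v;v)_{n-i}}$ with $v=t^{-2}$. For $\ell\in\mathbb Z_+$ let $I_\ell=\{-\ell,\dots,\ell\}$ and $\xi_i^{(\ell)}=\mathbf i^{[(\ell+i)/2]}\,r_{2\ell,\ell+i}\,a^{\ell-i}c^{\ell+i}$; the matrix elements $m^{(\ell)}_{ij}\in\mathcal A$ are defined by $\Delta(\xi^{(\ell)}_i)=\sum_{j\in I_\ell}m^{(\ell)}_{ij}\otimes\xi^{(\ell)}_j$. For $j\in I_\ell$ and $s\in\{0,1\}$ let $$a'_j=(-1)^{\ell+j+s}t^{-2j}-1,$$ $$b'_j=(-1)^{\ell-j+1}\,\mathbf i^{[\frac{\ell+j-1}2]-[\frac{\ell+j}2]}\,t^{\ell-j+1}\,\frac{1-t^{-2(\ell+j)}}{q-q^{-1}}\cdot\frac{r_{2\ell,\ell+j}}{r_{2\ell,\ell+j-1}}\quad(j>-\ell),$$ $$c'_j=(-1)^{\ell+j+1}\,\mathbf i^{[\frac{\ell+j+1}2]-[\frac{\ell+j}2]}\,t^{\ell-j}\,\frac{1-t^{-2(\ell-j)}}{1-t^{-2}}\cdot\frac{r_{2\ell,\ell+j}}{r_{2\ell,\ell+j+1}}\quad(j<\ell).$$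 **Theorem.** Let $\alpha,\beta,\gamma$ be nonzero complex numbers. (1) The left invariants of $x_{\alpha\beta}$ form a subalgebra of $\mathcal A$, which is spanned by $$\sum_{j\in I_\ell}y_j\,m^{(\ell)}_{ij}\sigma^s,\qquad \ell\in\mathbb Z_+,\ i\in I_\ell,\ s=0,1,$$ where $y_{-\ell+2k+1}=0$ for $0\le k\le\ell-1$ and $y_{-\ell+2k}=(-\alpha^{-1}\beta)^k\,\dfrac{\prod_{i=0}^{k-1}c'_{-\ell+2i}}{\prod_{i=1}^{k}b'_{-\ell+2i}}$ for $0\le k\le\ell$. (2) The space of left invariants of $x_{\beta\gamma}$ (resp. $x_{\alpha\gamma}$) is spanned by $$\sum_{j\in I_\ell}(-1)^{(\ell+i)j}\,y_j\,m^{(\ell)}_{ij}\sigma^s,\qquad \ell\in\mathbb Z_+,\ i\in I_\ell,\ s\in\{0,1\},\ \ell+s\in2\mathbb Z_+,$$ where, for $x_{\beta\gamma}$, $y_j=0$ for $j<0$ and $y_j=(-\beta\gamma^{-1})^j\,\dfrac{\prod_{i=0}^{j-1}c'_i}{\prod_{i=1}^{j}a'_i}$ for $0\le j\le\ell$; and,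 for $x_{\alpha\gamma}$, $y_j=0$ for $j>0$ and $y_j=(-\alpha\gamma^{-1})^{-j}\,\dfrac{\prod_{i=0}^{-j-1}b'_{-i}}{\prod_{i=1}^{-j}a'_{-i}}$ for $-\ell\le j\le0$. Moreover, with a suitable choice of the square roots on the right-hand sides, $$\frac{\prod_{i=0}^{k-1}c'_{-\ell+2i}}{\prod_{i=1}^{k}b'_{-\ell+2i}}=\mathbf i^kq^k(1-q)^k\left(\frac{(q^{-2\ell};q^2)_k(-q;q^2)_k}{(-q^{-2\ell+1};q^2)_k(q^2;q^2)_k}\right)^{1/2}\qquad(0\le k\le\ell),$$ and, when $\ell+s$ is even, for $0\le j\le\ell$ and $0\le n\le\ell$, $$\frac{\prod_{i=0}^{j-1}c'_i}{\prod_{i=1}^{j}a'_i}=(-1)^{(\ell+1)j}\,\mathbf i^{[\frac{\ell+j}2]-[\frac\ell2]+j}\,q^j\,\frac{\big(((-q)^{-\ell};-q)_j\,((-q)^{\ell+1};-q)_j\big)^{1/2}}{(t-t^{-1})^j(q;q)_j},$$ $$\frac{\prod_{i=0}^{n-1}b'_{-i}}{\prod_{i=1}^{n}a'_{-i}}=(-1)^{n\ell}\,\mathbf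 i^{[\frac{\ell-n}2]-[\frac\ell2]+n^2}\,\frac{\big(((-q)^{-\ell};-q)_n\,((-q)^{\ell+1};-q)_n\big)^{1/2}}{(q-q^{-1})^n(q;q)_n}.$$ -/

import Mathlib

open scoped TensorProduct

noncomputable section

namespace OSpQ

/-- The five generators of the quantum supergroup. -/
inductive Gen
  | a | b | c | d | s

open Gen

/-- The generators in the free algebra. -/
abbrev fr (g : Gen) : FreeAlgebra ℂ Gen := FreeAlgebra.ι ℂ g

/-- The defining relations of `ℂ_q[osp(1,2)]`; here `t ^ 2 = -q` and `s` stands for `σ`. -/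
inductive Rel (t : ℂ) : FreeAlgebra ℂ Gen → FreeAlgebra ℂ Gen → Prop
  | ab : Rel t (fr a * fr b) (t • (fr b * fr a))
  | ac : Rel t (fr a * fr c) (t • (fr c * fr a))
  | bc : Rel t (fr b * fr c) (-(fr c * fr b))
  | bd : Rel t (fr b * fr d) (-(t • (fr d * fr b)))
  | cd : Rel t (fr c * fr d) (-(t • (fr d * fr c)))
  | ad : Rel t (fr a * fr d - fr d * fr a) ((t⁻¹ - t) • (fr b * fr c))
  | det : Rel t (fr a * fr d + t • (fr b * fr c)) (fr s)
  | sq : Rel t (fr s * fr s) 1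

/-- The algebra `𝒜 = ℂ_q[osp(1,2)]` by generators and relations. -/
def A (t : ℂ) : Type := RingQuot (Rel t)

instance (t : ℂ) : Ring (A t) := inferInstanceAs (Ring (RingQuot (Rel t)))
instance (t : ℂ) : Algebra ℂ (A t) := inferInstanceAs (Algebra ℂ (RingQuot (Rel t)))

/-- The projection from the free algebra. -/
def mk (t : ℂ) : FreeAlgebra ℂ Gen →ₐ[ℂ] A t := RingQuot.mkAlgHom ℂ (Rel t)

/-- The generators of `𝒜`. -/
def gen (t : ℂ) (g : Gen) : A t := mk t (fr g)

/-- The universal property of `𝒜`: an algebra map is given by images of the generators that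
satisfy the defining relations. -/
def liftA {B : Type} [Ring B] [Algebra ℂ B] (t : ℂ) (F : Gen → B)
    (hab : F a * F b = t • (F b * F a)) (hac : F a * F c = t • (F c * F a))
    (hbc : F b * F c = -(F c * F b)) (hbd : F b * F d = -(t • (F d * F b)))
    (hcd : F c * F d = -(t • (F d * F c)))
    (had : F a * F d - F d * F a = (t⁻¹ - t) • (F b * F c))
    (hdet : F a * F d + t • (F b * F c) = F s) (hsq : F s * F s = 1) : A t →ₐ[ℂ] B :=
  RingQuot.liftAlgHom ℂ ⟨FreeAlgebra.lift ℂ F, by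
    intro x y h
    cases h <;> simp only [map_mul, map_add, map_sub, map_neg, map_smul, map_one, fr,
      FreeAlgebra.lift_ι_apply] <;> assumption⟩

theorem liftA_gen {B : Type} [Ring B] [Algebra ℂ B] (t : ℂ) (F : Gen → B)
    (hab hac hbc hbd hcd had hdet hsq) (g : Gen) :
    liftA t F hab hac hbc hbd hcd had hdet hsq (gen t g) = F g := by
  unfold liftA gen mk
  erw [RingQuot.liftAlgHom_mkAlgHom_apply]
  exact FreeAlgebra.lift_ι_apply F g

theorem algHom_ext {B : Type} [Ring B] [Algebra ℂ B] {t : ℂ} {f g : A t →ₐ[ℂ] B}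
    (h : ∀ x, f (gen t x) = g (gen t x)) : f = g := by
  apply RingQuot.ringQuot_ext'
  apply FreeAlgebra.hom_ext
  funext x
  exact h x

section relations
variable (t : ℂ)

theorem mk_rel {x y : FreeAlgebra ℂ Gen} (h : Rel t x y) :
    mk t x = mk t y :=
  RingQuot.mkAlgHom_rel ℂ h

theorem rel_ab : gen t a * gen t b = t • (gen t b * gen t a) := by
  simpa only [gen, map_mul, map_smul] using mk_rel t Rel.ab
theorem rel_ac : gen t a * gen t c = t • (gen t c * gen t a) := by
  simpa only [gen, map_mul, map_smul] using mk_rel t Rel.ac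
theorem rel_bc : gen t b * gen t c = -(gen t c * gen t b) := by
  simpa only [gen, map_mul, map_smul, map_neg] using mk_rel t Rel.bc
theorem rel_bd : gen t b * gen t d = -(t • (gen t d * gen t b)) := by
  simpa only [gen, map_mul, map_smul, map_neg] using mk_rel t Rel.bd
theorem rel_cd : gen t c * gen t d = -(t • (gen t d * gen t c)) := by
  simpa only [gen, map_mul, map_smul, map_neg] using mk_rel t Rel.cd
theorem rel_ad : gen t a * gen t d - gen t d * gen t a = (t⁻¹ - t) • (gen t b * gen t c) := by
  simpa only [gen, map_mul, map_smul, map_sub] using mk_rel t Rel.ad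
theorem rel_det : gen t a * gen t d + t • (gen t b * gen t c) = gen t s := by
  simpa only [gen, map_mul, map_smul, map_add] using mk_rel t Rel.det
theorem rel_sq : gen t s * gen t s = 1 := by
  simpa only [gen, map_mul, map_one] using mk_rel t Rel.sq

end relations

/-- The parity sign `(-1)^{p(g)}` of a generator: `b` and `c` are odd, `a`, `d`, `σ` are even. -/
def genSign : Gen → ℂ
  | a => 1 | b => -1 | c => -1 | d => 1 | s => 1

/-- The parity automorphism `x ↦ (-1)^{p(x)} x` of `𝒜`. -/
def theta (t : ℂ) : A t →ₐ[ℂ] A t :=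
  liftA t (fun g => genSign g • gen t g)
    (by simp [genSign, rel_ab]) (by simp [genSign, rel_ac]) (by simp [genSign, rel_bc])
    (by simp [genSign, rel_bd]) (by simp [genSign, rel_cd]) (by simp [genSign, rel_ad])
    (by simp [genSign, rel_det]) (by simp [genSign, rel_sq])

@[simp] theorem theta_gen (t : ℂ) (g : Gen) : theta t (gen t g) = genSign g • gen t g :=
  liftA_gen ..

@[simp] theorem theta_theta (t : ℂ) (x : A t) : theta t (theta t x) = x := by
  have : (theta t).comp (theta t) = AlgHom.id ℂ (A t) := by
    apply algHom_ext
    intro g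
    cases g <;> simp [genSign]
  exact DFunLike.congr_fun this x

/-- The homogeneous components of the `ℤ/2`-grading of `𝒜`. -/
def grading (t : ℂ) (i : ZMod 2) : Submodule ℂ (A t) where
  carrier := {x | theta t x = (-1 : ℂ) ^ i.val • x}
  add_mem' := by
    intro x y hx hy
    simp only [Set.mem_ofPred_eq] at *
    rw [map_add, hx, hy, smul_add]
  zero_mem' := by simp
  smul_mem' := by
    intro z x hx
    simp only [Set.mem_ofPred_eq] at *
    rw [map_smul, hx, smul_comm]

theorem mem_grading {t : ℂ} {i : ZMod 2} {x : A t} :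
    x ∈ grading t i ↔ theta t x = (-1 : ℂ) ^ i.val • x := Iff.rfl

theorem mem_grading_zero {t : ℂ} {x : A t} : x ∈ grading t 0 ↔ theta t x = x := by
  simp [mem_grading]

theorem mem_grading_one {t : ℂ} {x : A t} : x ∈ grading t 1 ↔ theta t x = -x := by
  simp [mem_grading, ZMod.val_one]

instance (t : ℂ) : SetLike.GradedMonoid (grading t) where
  one_mem := by simp [mem_grading]
  mul_mem := by
    intro i j x y hx hy
    rw [mem_grading] at *
    rw [map_mul, hx, hy, smul_mul_smul_comm, ← pow_add, ZMod.val_add, ← neg_one_pow_eq_pow_mod_two]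

/-- The even and the odd component of an element of `𝒜`. -/
def comp (t : ℂ) : (i : ZMod 2) → A t →ₗ[ℂ] grading t i := fun i =>
  { toFun := fun x => ⟨(2⁻¹ : ℂ) • (x + (-1 : ℂ) ^ i.val • theta t x), by
      obtain rfl | rfl : i = 0 ∨ i = 1 := by revert i; decide
      · simp [mem_grading_zero, add_comm]
      · simp [mem_grading_one, ZMod.val_one, add_comm]⟩
    map_add' := by
      intro x y
      ext
      simp only [map_add, smul_add, Submodule.coe_add]
      abel
    map_smul' := by
      intro z x
      ext
      simp only [map_smul, RingHom.id_apply, Submodule.coe_smul, smul_add, smul_comm z] }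

theorem comp_add (t : ℂ) (x : A t) : (comp t 0 x : A t) + comp t 1 x = x := by
  simp [comp, ZMod.val_one]
  module

theorem comp_self {t : ℂ} {i : ZMod 2} (x : grading t i) : comp t i x = x := by
  obtain ⟨x, hx⟩ := x
  ext
  rw [mem_grading] at hx
  simp only [comp, LinearMap.coe_mk, AddHom.coe_mk, hx, smul_smul, ← pow_add]
  rw [Even.neg_one_pow ⟨_, rfl⟩]
  module

theorem comp_ne {t : ℂ} {i j : ZMod 2} (h : j ≠ i) (x : grading t i) : comp t j x = 0 := by
  obtain ⟨x, hx⟩ := x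
  ext
  obtain ⟨rfl, rfl⟩ | ⟨rfl, rfl⟩ : (i = 0 ∧ j = 1) ∨ (i = 1 ∧ j = 0) := by
    clear hx; revert i j; decide
  · rw [mem_grading_zero] at hx
    simp [comp, hx, ZMod.val_one]
  · rw [mem_grading_one] at hx
    simp [comp, hx]

instance (t : ℂ) : DirectSum.Decomposition (grading t) :=
  DirectSum.Decomposition.ofLinearMap (grading t)
    (DirectSum.lof ℂ (ZMod 2) (fun i => grading t i) 0 ∘ₗ comp t 0 +
      DirectSum.lof ℂ (ZMod 2) (fun i => grading t i) 1 ∘ₗ comp t 1)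
    (by
      ext1 x
      simp [comp_add])
    (by
      apply DirectSum.linearMap_ext
      intro i
      apply LinearMap.ext
      obtain rfl | rfl : i = 0 ∨ i = 1 := by revert i; decide
      · intro x; simp [comp_self, comp_ne (t := t) (i := 0) (j := 1) (by decide)]
      · intro x; simp [comp_self, comp_ne (t := t) (i := 1) (j := 0) (by decide)])

instance (t : ℂ) : GradedAlgebra (grading t) where

/-- The graded tensor product `𝒜 ⊗ 𝒜`, with
`(x ⊗ y) (z ⊗ w) = (-1)^{p(y) p(z)} x z ⊗ y w`. -/
abbrev AA (t : ℂ) : Type := GradedTensorProduct ℂ (grading t) (grading t)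

/-- A pure tensor in `𝒜 ⊗ 𝒜`. -/
abbrev tm {t : ℂ} (x y : A t) : AA t := GradedTensorProduct.tmul ℂ x y

theorem tm_mul_even {t : ℂ} (x y z w : A t) (hy : theta t y = y) :
    tm x y * tm z w = tm (x * z) (y * w) :=  by
  have h := fun i (z' : grading t i) => GradedTensorProduct.tmul_zero_coe_mul_coe_tmul
    (grading t) (grading t) x ⟨y, mem_grading_zero.2 hy⟩ z' w
  have e : ∀ z₁ z₂ u : A t, tm (z₁ + z₂) u = tm z₁ u + tm z₂ u := fun z₁ z₂ u => by
    simp [tm, GradedTensorProduct.tmul, TensorProduct.add_tmul]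
  conv_lhs => rw [← comp_add t z, e, mul_add]
  conv_rhs => rw [← comp_add t z, mul_add, e]
  exact congrArg₂ (· + ·) (h _ _) (h _ _)

theorem tm_mul_odd {t : ℂ} (x y z w : A t) (hy : theta t y = -y) :
    tm x y * tm z w = tm (x * theta t z) (y * w) :=  by
  have h := fun i (z' : grading t i) => GradedTensorProduct.tmul_coe_mul_coe_tmul
    (grading t) (grading t) x ⟨y, mem_grading_one.2 hy⟩ z' w
  have e : ∀ z₁ z₂ u : A t, tm (z₁ + z₂) u = tm z₁ u + tm z₂ u := fun z₁ z₂ u => by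
    simp [tm, GradedTensorProduct.tmul, TensorProduct.add_tmul]
  conv_lhs => rw [← comp_add t z, e, mul_add]
  conv_rhs => rw [← comp_add t z, map_add, mul_add, e]
  refine congrArg₂ (· + ·) ((h _ _).trans ?_) ((h _ _).trans ?_)
  · rw [mem_grading_zero.1 (comp t 0 z).2]
    simp
  · rw [mem_grading_one.1 (comp t 1 z).2]
    rw [mul_neg]
    simp [tm, GradedTensorProduct.tmul, TensorProduct.neg_tmul]

/-- The coproduct on the generators. -/
def coGen (t : ℂ) : Gen → AA t
  | a => tm (gen t a) (gen t a) + tm (gen t b) (gen t c)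
  | b => tm (gen t a) (gen t b) + tm (gen t b) (gen t d)
  | c => tm (gen t c) (gen t a) + tm (gen t d) (gen t c)
  | d => tm (gen t c) (gen t b) + tm (gen t d) (gen t d)
  | s => tm (gen t s) (gen t s)

theorem genE (t : ℂ) : theta t (gen t a) = gen t a ∧ theta t (gen t b) = -gen t b ∧
    theta t (gen t c) = -gen t c ∧ theta t (gen t d) = gen t d ∧ theta t (gen t s) = gen t s := by
  simp [genSign]

section order
variable (t : ℂ) [NeZero t]

theorem rel_ba : gen t b * gen t a = t⁻¹ • (gen t a * gen t b) := by
  rw [rel_ab, inv_smul_smul₀ (NeZero.ne t)]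
theorem rel_ca : gen t c * gen t a = t⁻¹ • (gen t a * gen t c) := by
  rw [rel_ac, inv_smul_smul₀ (NeZero.ne t)]
theorem rel_cb : gen t c * gen t b = -(gen t b * gen t c) := by
  rw [rel_bc, neg_neg]
theorem rel_db : gen t d * gen t b = -(t⁻¹ • (gen t b * gen t d)) := by
  rw [rel_bd, smul_neg, inv_smul_smul₀ (NeZero.ne t), neg_neg]
theorem rel_dc : gen t d * gen t c = -(t⁻¹ • (gen t c * gen t d)) := by
  rw [rel_cd, smul_neg, inv_smul_smul₀ (NeZero.ne t), neg_neg]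
theorem rel_da : gen t d * gen t a =
    gen t a * gen t d - (t⁻¹ - t) • (gen t b * gen t c) := by
  rw [← rel_ad]; abel

end order

theorem tm_add {t : ℂ} (x y z : A t) : tm x (y + z) = tm x y + tm x z :=
  congrArg _ (TensorProduct.tmul_add x y z)
theorem add_tm {t : ℂ} (x y z : A t) : tm (x + y) z = tm x z + tm y z :=
  congrArg _ (TensorProduct.add_tmul x y z)
theorem tm_sub {t : ℂ} (x y z : A t) : tm x (y - z) = tm x y - tm x z :=
  congrArg _ (TensorProduct.tmul_sub x y z)
theorem sub_tm {t : ℂ} (x y z : A t) : tm (x - y) z = tm x z - tm y z :=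
  congrArg _ (TensorProduct.sub_tmul x y z)
theorem tm_neg {t : ℂ} (x y : A t) : tm x (-y) = -tm x y :=
  congrArg _ (TensorProduct.tmul_neg x y)
theorem neg_tm {t : ℂ} (x y : A t) : tm (-x) y = -tm x y :=
  congrArg (GradedTensorProduct.of ℂ (grading t) (grading t)) (TensorProduct.neg_tmul x y)
theorem tm_smul {t : ℂ} (k : ℂ) (x y : A t) : tm x (k • y) = k • tm x y :=
  congrArg _ (TensorProduct.tmul_smul k x y)
theorem smul_tm {t : ℂ} (k : ℂ) (x y : A t) : tm (k • x) y = k • tm x y :=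
  congrArg (GradedTensorProduct.of ℂ (grading t) (grading t))
    (TensorProduct.smul_tmul' k x y).symm

theorem coGen_rel (t : ℂ) [NeZero t] :
    coGen t a * coGen t b = t • (coGen t b * coGen t a) ∧
    coGen t a * coGen t c = t • (coGen t c * coGen t a) ∧
    coGen t b * coGen t c = -(coGen t c * coGen t b) ∧
    coGen t b * coGen t d = -(t • (coGen t d * coGen t b)) ∧
    coGen t c * coGen t d = -(t • (coGen t d * coGen t c)) ∧
    coGen t a * coGen t d - coGen t d * coGen t a = (t⁻¹ - t) • (coGen t b * coGen t c) ∧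
    coGen t a * coGen t d + t • (coGen t b * coGen t c) = coGen t s ∧
    coGen t s * coGen t s = 1 := by
  have ht : t ≠ 0 := NeZero.ne t
  obtain ⟨ea, eb, ec, ed, es⟩ := genE t
  refine ⟨?_, ?_, ?_, ?_, ?_, ?_, ?_, ?_⟩
  on_goal 8 =>
    simp only [coGen, tm_mul_even _ _ _ _ es, rel_sq]
    rfl
  all_goals
    simp only [coGen, mul_add, add_mul, tm_mul_even _ _ _ _ ea, tm_mul_even _ _ _ _ ed,
      tm_mul_odd _ _ _ _ eb, tm_mul_odd _ _ _ _ ec, ea, eb, ec, ed,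
      rel_ba, rel_ca, rel_cb, rel_db, rel_dc, rel_da, ← rel_det, mul_neg, tm_neg, neg_tm,
      tm_smul, smul_tm, tm_add, add_tm, tm_sub, sub_tm]
    match_scalars <;> field_simp <;> ring

/-- The coproduct `Δ : 𝒜 → 𝒜 ⊗ 𝒜`. -/
def coproduct (t : ℂ) [NeZero t] : A t →ₐ[ℂ] AA t :=
  liftA t (coGen t) (coGen_rel t).1 (coGen_rel t).2.1 (coGen_rel t).2.2.1 (coGen_rel t).2.2.2.1
    (coGen_rel t).2.2.2.2.1 (coGen_rel t).2.2.2.2.2.1 (coGen_rel t).2.2.2.2.2.2.1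
    (coGen_rel t).2.2.2.2.2.2.2

theorem coproduct_gen (t : ℂ) [NeZero t] (g : Gen) : coproduct t (gen t g) = coGen t g :=
  liftA_gen ..

/-- The counit `ε`. -/
def counit (t : ℂ) : A t →ₐ[ℂ] ℂ :=
  liftA t (fun | a => 1 | b => 0 | c => 0 | d => 1 | s => 1)
    (by simp) (by simp) (by simp) (by simp) (by simp) (by simp) (by simp) (by simp)

/-- The element `k` of the quantized enveloping algebra as a function on `𝒜`. -/
def kFun (t : ℂ) [NeZero t] : A t →ₐ[ℂ] ℂ :=
  liftA t (fun | a => t | b => 0 | c => 0 | d => -t⁻¹ | s => -1)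
    (by simp) (by simp) (by simp) (by simp) (by simp) (by simp [mul_comm])
    (by simp [NeZero.ne t]) (by simp)

/-- The element `k⁻¹` as a function on `𝒜`. -/
def kInvFun (t : ℂ) [NeZero t] : A t →ₐ[ℂ] ℂ :=
  liftA t (fun | a => t⁻¹ | b => 0 | c => 0 | d => -t | s => -1)
    (by simp) (by simp) (by simp) (by simp) (by simp) (by simp [mul_comm])
    (by simp [NeZero.ne t]) (by simp)

/-- The matrix representation `x ↦ ((k(x), e(x)), (0, ε(x)))` of `𝒜`, which encodes the rule
`e(x y) = e(x) ε(y) + (-1)^{p(x)} k(x) e(y)` (`k` vanishes on odd elements). -/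
def eMat (q t : ℂ) [NeZero t] : A t →ₐ[ℂ] Matrix (Fin 2) (Fin 2) ℂ := by
  refine liftA t (fun
    | a => !![t, 0; 0, 1]
    | b => !![0, (t - t⁻¹) / (q - q⁻¹); 0, 0]
    | c => 0
    | d => !![-t⁻¹, 0; 0, 1]
    | s => !![-1, 0; 0, 1]) ?_ ?_ ?_ ?_ ?_ ?_ ?_ ?_
  all_goals
    have ht : t ≠ 0 := NeZero.ne t
    ext i j
    fin_cases i <;> fin_cases j <;> simp [ht]

/-- The matrix representation `x ↦ ((ε(x), f(x)), (0, k⁻¹(x)))` of `𝒜`, which encodes the rule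
`f(x y) = f(x) k⁻¹(y) + (-1)^{p(x)} ε(x) f(y)` (`ε` vanishes on odd elements). -/
def fMat (t : ℂ) [NeZero t] : A t →ₐ[ℂ] Matrix (Fin 2) (Fin 2) ℂ := by
  refine liftA t (fun
    | a => !![1, 0; 0, t⁻¹]
    | b => 0
    | c => !![0, 1; 0, 0]
    | d => !![1, 0; 0, -t]
    | s => !![1, 0; 0, -1]) ?_ ?_ ?_ ?_ ?_ ?_ ?_ ?_
  all_goals
    have ht : t ≠ 0 := NeZero.ne t
    ext i j
    fin_cases i <;> fin_cases j <;> simp [ht]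

/-- The element `e` of the quantized enveloping algebra as a function on `𝒜`. -/
def eFun (q t : ℂ) [NeZero t] : A t →ₗ[ℂ] ℂ :=
  Matrix.entryLinearMap ℂ ℂ 0 1 ∘ₗ (eMat q t).toLinearMap

/-- The element `f` of the quantized enveloping algebra as a function on `𝒜`. -/
def fFun (t : ℂ) [NeZero t] : A t →ₗ[ℂ] ℂ :=
  Matrix.entryLinearMap ℂ ℂ 0 1 ∘ₗ (fMat t).toLinearMap

theorem induct {t : ℂ} {P : A t → Prop} (h0 : ∀ z : ℂ, P (algebraMap ℂ (A t) z))
    (h1 : ∀ g, P (gen t g)) (h2 : ∀ x y, P x → P y → P (x + y))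
    (h3 : ∀ x y, P x → P y → P (x * y)) (x : A t) : P x := by
  obtain ⟨x, rfl⟩ : ∃ y, mk t y = x := RingQuot.mkAlgHom_surjective ℂ (Rel t) x
  induction x with
  | grade0 z => simpa using h0 z
  | grade1 g => exact h1 g
  | mul x y hx hy => simpa using h3 _ _ hx hy
  | add x y hx hy => simpa using h2 _ _ hx hy

section pairing
variable (q t : ℂ) [NeZero t]

theorem eFun_gen : eFun q t (gen t a) = 0 ∧ eFun q t (gen t b) = (t - t⁻¹) / (q - q⁻¹) ∧
    eFun q t (gen t c) = 0 ∧ eFun q t (gen t d) = 0 ∧ eFun q t (gen t s) = 0 := by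
  simp [eFun, eMat, liftA_gen]

theorem fFun_gen : fFun t (gen t a) = 0 ∧ fFun t (gen t b) = 0 ∧
    fFun t (gen t c) = 1 ∧ fFun t (gen t d) = 0 ∧ fFun t (gen t s) = 0 := by
  simp [fFun, fMat, liftA_gen]

theorem kFun_theta (x : A t) : kFun t (theta t x) = kFun t x := by
  have : (kFun t).comp (theta t) = kFun t := by
    apply algHom_ext
    intro g
    cases g <;> simp [genSign, kFun, liftA_gen]
  exact DFunLike.congr_fun this x

theorem counit_theta (x : A t) : counit t (theta t x) = counit t x := by
  have : (counit t).comp (theta t) = counit t := by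
    apply algHom_ext
    intro g
    cases g <;> simp [genSign, counit, liftA_gen]
  exact DFunLike.congr_fun this x

theorem eMat_apply (x : A t) :
    eMat q t x 0 0 = kFun t x ∧ eMat q t x 1 0 = 0 ∧ eMat q t x 1 1 = counit t x := by
  induction x using induct with
  | h0 z => simp [Matrix.algebraMap_matrix_apply]
  | h1 g => cases g <;> simp [eMat, kFun, counit, liftA_gen]
  | h2 x y hx hy => simp [hx, hy]
  | h3 x y hx hy => simp [hx, hy, Matrix.mul_apply]

theorem fMat_apply (x : A t) :
    fMat t x 0 0 = counit t x ∧ fMat t x 1 0 = 0 ∧ fMat t x 1 1 = kInvFun t x := by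
  induction x using induct with
  | h0 z => simp [Matrix.algebraMap_matrix_apply]
  | h1 g => cases g <;> simp [fMat, kInvFun, counit, liftA_gen]
  | h2 x y hx hy => simp [hx, hy]
  | h3 x y hx hy => simp [hx, hy, Matrix.mul_apply]

theorem eFun_mul (x y : A t) :
    eFun q t (x * y) = eFun q t x * counit t y + kFun t (theta t x) * eFun q t y := by
  simp [eFun, Matrix.mul_apply, eMat_apply, kFun_theta, add_comm]

theorem fFun_mul (x y : A t) :
    fFun t (x * y) = fFun t x * kInvFun t y + counit t (theta t x) * fFun t y := by
  simp [fFun, Matrix.mul_apply, fMat_apply, counit_theta, add_comm]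

end pairing

section action
variable {t : ℂ} [NeZero t]

/-- The even part of a linear functional on `𝒜`. -/
def evenPart (φ : A t →ₗ[ℂ] ℂ) : A t →ₗ[ℂ] ℂ := (2⁻¹ : ℂ) • (φ + φ ∘ₗ (theta t).toLinearMap)

/-- The odd part of a linear functional on `𝒜`. -/
def oddPart (φ : A t →ₗ[ℂ] ℂ) : A t →ₗ[ℂ] ℂ := (2⁻¹ : ℂ) • (φ - φ ∘ₗ (theta t).toLinearMap)

/-- The linear map `u₁ ⊗ u₂ ↦ (-1)^{p(x) p(u₁)} x(u₂) u₁` for a functional `x`, extended linearly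
to functionals that are not homogeneous. -/
def contract (φ : A t →ₗ[ℂ] ℂ) : A t ⊗[ℂ] A t →ₗ[ℂ] A t :=
  TensorProduct.lift (LinearMap.mk₂ ℂ (fun x y => evenPart φ y • x + oddPart φ y • theta t x)
    (by intro x x' y; simp only [map_add, smul_add]; abel)
    (by intro z x y; simp only [map_smul, smul_add, smul_comm z])
    (by intro x y y'; simp only [map_add, add_smul]; abel)
    (by intro z x y; simp only [map_smul, smul_add, smul_eq_mul, mul_smul]))

/-- The left action `L_x(u) = ∑ (-1)^{p(x) p(u₁)} x(u₂) u₁`, where `Δ(u) = ∑ u₁ ⊗ u₂`. -/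
def leftAct (φ : A t →ₗ[ℂ] ℂ) : A t →ₗ[ℂ] A t :=
  contract φ ∘ₗ (GradedTensorProduct.of ℂ (grading t) (grading t)).symm.toLinearMap ∘ₗ
    (coproduct t).toLinearMap

/-- The product of two elements of the enveloping algebra as functions on `𝒜`:
`(x y)(u) = x(L_y(u))`. -/
def funMul (φ ψ : A t →ₗ[ℂ] ℂ) : A t →ₗ[ℂ] ℂ := φ ∘ₗ leftAct ψ

/-- The left invariants `{u | L_x(u) = ε(x) u}` of `x`, where `ε(x) = x(1)`. -/
def leftInvariants (φ : A t →ₗ[ℂ] ℂ) : Submodule ℂ (A t) :=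
  LinearMap.ker (leftAct φ - φ 1 • LinearMap.id)

theorem mem_leftInvariants (φ : A t →ₗ[ℂ] ℂ) (u : A t) :
    u ∈ leftInvariants φ ↔ leftAct φ u = φ 1 • u := by
  simp [leftInvariants, sub_eq_zero]

end action

/-- The element `x_{αβγ} = α e + β f k + γ (k - 1)` as a function on `𝒜`
(the unit `1` is the function `ε`). -/
def xFun (q t : ℂ) [NeZero t] (α β γ : ℂ) : A t →ₗ[ℂ] ℂ :=
  α • eFun q t + β • funMul (fFun t) (kFun t).toLinearMap +
    γ • ((kFun t).toLinearMap - (counit t).toLinearMap)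

/-- The `q`-shifted factorial `(u; v)_m`. -/
def qPoch (u v : ℂ) (m : ℕ) : ℂ := ∏ k ∈ Finset.range m, (1 - u * v ^ k)

/-- The Gauss binomial coefficient. -/
def qBinom (v : ℂ) (m n : ℕ) : ℂ := qPoch v v m / (qPoch v v n * qPoch v v (m - n))

/-- The coefficient `𝐢^{[i/2]} (n choose i)^{1/2}`; `r n i` is the chosen square root of the
Gauss binomial coefficient `(n choose i)` to the base `t⁻²`. -/
def coef (r : ℕ → ℕ → ℂ) (n i : ℕ) : ℂ := Complex.I ^ (i / 2) * r n i

/-- The basis vector `ξ` of `V^L_{n/2}` with label `i - n/2`, `0 ≤ i ≤ n`. -/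
def xi (t : ℂ) (r : ℕ → ℕ → ℂ) (n i : ℕ) : A t :=
  coef r n i • (gen t a ^ (n - i) * gen t c ^ i)

/-- The coefficients in `Δ(a^p c^m) = ∑_j rawM p m j ⊗ a^(p+m-j) c^j`. -/
def rawM (t : ℂ) : ℕ → ℕ → ℕ → A t
  | 0, 0, 0 => 1
  | 0, 0, _ + 1 => 0
  | 0, m + 1, 0 => gen t c * rawM t 0 m 0
  | 0, m + 1, j + 1 =>
      gen t c * rawM t 0 m (j + 1) + t⁻¹ ^ (m - j) • (gen t d * theta t (rawM t 0 m j))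
  | p + 1, m, 0 => gen t a * rawM t p m 0
  | p + 1, m, j + 1 =>
      gen t a * rawM t p m (j + 1) + t⁻¹ ^ (p + m - j) • (gen t b * theta t (rawM t p m j))

/-- The matrix element `m_{i - n/2, j - n/2}` of the left comodule `V^L_{n/2}` with respect to the
basis `ξ`, that is, `Δ(ξ_i) = ∑_j m_{ij} ⊗ ξ_j`. -/
def matElem (t : ℂ) (r : ℕ → ℕ → ℂ) (n i j : ℕ) : A t :=
  (coef r n i / coef r n j) • rawM t (n - i) i j

theorem rawM_eq_zero (t : ℂ) (p m j : ℕ) (h : p + m < j) : rawM t p m j = 0 := by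
  induction p generalizing j with
  | zero =>
    induction m generalizing j with
    | zero =>
      obtain _ | j := j
      · omega
      · simp [rawM]
    | succ m ih =>
      obtain _ | j := j
      · omega
      · simp [rawM, ih (j + 1) (by omega), ih j (by omega)]
  | succ p ih =>
    obtain _ | j := j
    · omega
    · rw [rawM, ih (j + 1) (by omega), ih j (by omega)]
      simp

theorem c_mul_a_pow (t : ℂ) [NeZero t] (m : ℕ) :
    gen t c * gen t a ^ m = t⁻¹ ^ m • (gen t a ^ m * gen t c) := by
  induction m with
  | zero => simp
  | succ m ih =>
    rw [pow_succ, ← mul_assoc, ih, smul_mul_assoc, mul_assoc, rel_ca, mul_smul_comm, smul_smul,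
      pow_succ, mul_assoc]

theorem coproduct_monomial (t : ℂ) [NeZero t] (p m : ℕ) :
    coproduct t (gen t a ^ p * gen t c ^ m) =
      ∑ j ∈ Finset.range (p + m + 1), tm (rawM t p m j) (gen t a ^ (p + m - j) * gen t c ^ j) := by
  obtain ⟨ea, eb, ec, ed, es⟩ := genE t
  have key : ∀ (n : ℕ) (g h : A t) (M N : ℕ → A t), M (n + 1) = 0 →
      N 0 = g * M 0 →
      (∀ j, N (j + 1) = g * M (j + 1) + t⁻¹ ^ (n - j) • (h * theta t (M j))) →
      (tm g (gen t a) + tm h (gen t c)) *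
          ∑ j ∈ Finset.range (n + 1), tm (M j) (gen t a ^ (n - j) * gen t c ^ j) =
        ∑ j ∈ Finset.range (n + 1 + 1), tm (N j) (gen t a ^ (n + 1 - j) * gen t c ^ j) := by
    intro n g h M N hM h0 h1
    have e1 : tm g (gen t a) * ∑ j ∈ Finset.range (n + 1),
        tm (M j) (gen t a ^ (n - j) * gen t c ^ j) =
        ∑ j ∈ Finset.range (n + 1 + 1),
          tm (g * M j) (gen t a ^ (n + 1 - j) * gen t c ^ j) := by
      rw [Finset.sum_range_succ _ (n + 1), hM, mul_zero, Finset.mul_sum]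
      have : tm (0 : A t) (gen t a ^ (n + 1 - (n + 1)) * gen t c ^ (n + 1)) = 0 := by
        have := smul_tm (0 : ℂ) (0 : A t) (gen t a ^ (n + 1 - (n + 1)) * gen t c ^ (n + 1))
        simpa using this
      rw [this, add_zero]
      refine Finset.sum_congr rfl fun j hj => ?_
      rw [tm_mul_even _ _ _ _ ea, ← mul_assoc, ← pow_succ']
      have := Finset.mem_range.1 hj
      rw [show n - j + 1 = n + 1 - j by omega]
    have e2 : tm h (gen t c) * ∑ j ∈ Finset.range (n + 1),
        tm (M j) (gen t a ^ (n - j) * gen t c ^ j) =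
        ∑ j ∈ Finset.range (n + 1),
          tm (t⁻¹ ^ (n - j) • (h * theta t (M j)))
            (gen t a ^ (n + 1 - (j + 1)) * gen t c ^ (j + 1)) := by
      rw [Finset.mul_sum]
      refine Finset.sum_congr rfl fun j hj => ?_
      rw [tm_mul_odd _ _ _ _ ec, ← mul_assoc, c_mul_a_pow, smul_mul_assoc, tm_smul, smul_tm,
        mul_assoc, ← pow_succ', Nat.add_sub_add_right]
    rw [add_mul, e1, e2, Finset.sum_range_succ' _ (n + 1), Finset.sum_range_succ' _ (n + 1), h0,
      add_right_comm, ← Finset.sum_add_distrib]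
    congr 1
    refine Finset.sum_congr rfl fun j _ => ?_
    rw [h1, add_tm]
  induction p with
  | zero =>
    induction m with
    | zero =>
      simp [rawM]
      rfl
    | succ m ih =>
      have e : gen t a ^ 0 * gen t c ^ (m + 1) = gen t c * (gen t a ^ 0 * gen t c ^ m) := by
        simp [pow_succ']
      rw [e, map_mul, coproduct_gen, ih]
      simp only [zero_add]
      exact key m _ _ (rawM t 0 m) (rawM t 0 (m + 1)) (rawM_eq_zero _ _ _ _ (by omega))
        (by rw [rawM]) (fun j => by rw [rawM])
  | succ p ih =>
    rw [pow_succ', mul_assoc, map_mul, coproduct_gen, ih,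
      show p + 1 + m = p + m + 1 by omega]
    exact key (p + m) _ _ (rawM t p m) (rawM t (p + 1) m) (rawM_eq_zero _ _ _ _ (by omega))
      (by rw [rawM]) (fun j => by rw [rawM])

/-- The defining property of the matrix elements. -/
theorem coproduct_xi (t : ℂ) [NeZero t] (r : ℕ → ℕ → ℂ) (n i : ℕ) (hi : i ≤ n)
    (hr : ∀ j ≤ n, r n j ≠ 0) :
    coproduct t (xi t r n i) =
      ∑ j ∈ Finset.range (n + 1), tm (matElem t r n i j) (xi t r n j) := by
  rw [xi, map_smul, coproduct_monomial, show n - i + i = n by omega, Finset.smul_sum]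
  refine Finset.sum_congr rfl fun j hj => ?_
  have hc : coef r n j ≠ 0 :=
    mul_ne_zero (pow_ne_zero _ Complex.I_ne_zero) (hr j (by simpa [Nat.lt_succ_iff] using hj))
  rw [matElem, xi, tm_smul, smul_tm, smul_smul, mul_div_cancel₀ _ hc]

/-- The index set `I_ℓ = {-ℓ, …, ℓ}` for an integer `ℓ`. -/
def idx (ℓ : ℕ) : Finset ℤ := Finset.Icc (-(ℓ : ℤ)) ℓ

/-- The matrix element `m^{(ℓ)}_{ij}` for an integer `ℓ` and `i, j ∈ I_ℓ`. -/
def matEl (t : ℂ) (r : ℕ → ℕ → ℂ) (ℓ : ℕ) (i j : ℤ) : A t :=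
  matElem t r (2 * ℓ) (ℓ + i).toNat (ℓ + j).toNat

/-- The coefficient `a'_j` in `L_{k-1}(η_j σ^s) = a'_j η_j σ^s`. -/
def aL (t : ℂ) (ℓ s : ℕ) (j : ℤ) : ℂ := (-1) ^ (ℓ + j + s) * t ^ (-2 * j) - 1

/-- The coefficient `b'_j` in `L_e(η_j σ^s) = b'_j η_{j-1} σ^s`. The square root
`(1 - t^{-2(ℓ+j)})^{1/2} (1 - t^{-2(ℓ-j+1)})^{1/2}` is the one that belongs to the roots `r` in the
normalization of the basis. -/
def bL (q t : ℂ) (r : ℕ → ℕ → ℂ) (ℓ : ℕ) (j : ℤ) : ℂ :=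
  (-1) ^ (ℓ - j + 1) * Complex.I ^ ((ℓ + j - 1) / 2 - (ℓ + j) / 2) * t ^ (ℓ - j + 1) *
    ((1 - t ^ (-2 * (ℓ + j))) * (r (2 * ℓ) (ℓ + j).toNat / r (2 * ℓ) (ℓ + j - 1).toNat)) /
      (q - q⁻¹)

/-- The coefficient `c'_j` in `L_{fk}(η_j σ^s) = c'_j η_{j+1} σ^s`. The square root
`(1 - t^{-2(ℓ-j)})^{1/2} (1 - t^{-2(ℓ+j+1)})^{1/2}` is the one that belongs to the roots `r` in the
normalization of the basis. -/
def cL (t : ℂ) (r : ℕ → ℕ → ℂ) (ℓ : ℕ) (j : ℤ) : ℂ :=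
  (-1) ^ (ℓ + j + 1) * Complex.I ^ ((ℓ + j + 1) / 2 - (ℓ + j) / 2) * t ^ (ℓ - j) *
    ((1 - t ^ (-2 * (ℓ - j))) * (r (2 * ℓ) (ℓ + j).toNat / r (2 * ℓ) (ℓ + j + 1).toNat)) /
      (1 - t ^ (-2 : ℤ))

/-- `∏_{i=0}^{k-1} c'_{-ℓ+2i} / ∏_{i=1}^{k} b'_{-ℓ+2i}`. -/
def ratioAB (q t : ℂ) (r : ℕ → ℕ → ℂ) (ℓ k : ℕ) : ℂ :=
  (∏ i ∈ Finset.range k, cL t r ℓ (-ℓ + 2 * i)) / ∏ i ∈ Finset.Icc 1 k, bL q t r ℓ (-ℓ + 2 * i)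

/-- `∏_{i=0}^{j-1} c'_i / ∏_{i=1}^{j} a'_i`. -/
def ratioBG (t : ℂ) (r : ℕ → ℕ → ℂ) (ℓ s j : ℕ) : ℂ :=
  (∏ i ∈ Finset.range j, cL t r ℓ i) / ∏ i ∈ Finset.Icc 1 j, aL t ℓ s i

/-- `∏_{i=0}^{n-1} b'_{-i} / ∏_{i=1}^{n} a'_{-i}`. -/
def ratioAG (q t : ℂ) (r : ℕ → ℕ → ℂ) (ℓ s n : ℕ) : ℂ :=
  (∏ i ∈ Finset.range n, bL q t r ℓ (-i)) / ∏ i ∈ Finset.Icc 1 n, aL t ℓ s (-i)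

/-- The coefficients `y_j` for `x_{αβ}`. -/
def yAB (q t : ℂ) (r : ℕ → ℕ → ℂ) (α β : ℂ) (ℓ : ℕ) (j : ℤ) : ℂ :=
  if Odd (ℓ + j) then 0
  else (-α⁻¹ * β) ^ ((ℓ + j) / 2).toNat * ratioAB q t r ℓ ((ℓ + j) / 2).toNat

/-- The coefficients `y_j` for `x_{βγ}`. -/
def yBG (t : ℂ) (r : ℕ → ℕ → ℂ) (β γ : ℂ) (ℓ s : ℕ) (j : ℤ) : ℂ :=
  if j < 0 then 0 else (-β * γ⁻¹) ^ j.toNat * ratioBG t r ℓ s j.toNat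

/-- The coefficients `y_j` for `x_{αγ}`. -/
def yAG (q t : ℂ) (r : ℕ → ℕ → ℂ) (α γ : ℂ) (ℓ s : ℕ) (j : ℤ) : ℂ :=
  if 0 < j then 0 else (-α * γ⁻¹) ^ (-j).toNat * ratioAG q t r ℓ s (-j).toNat

end OSpQ
end

/-!
The functional `k` is a character of `𝒜`, so `L_k` is an algebra endomorphism; the odd functionals
`φ = e` and `φ = fk` satisfy `φ(x y) = φ(x) ε(y) + k(x) φ(y)`, so they act by twisted derivations
(`leftAct_mul_of_algHom`, `leftAct_mul_of_odd`, `fkFun_mul`). In particular the left invariants of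
`x_{αβ}` are closed under multiplication. The recursion for the matrix elements then shows that
each row `(m_{ij} σ^s)_j` is a weight module, on which `L_k` is diagonal, `L_e` lowers `j`, and
`L_{fk}` raises `j`, with explicit coefficients (`isRow_rawM`).

The elements `m_{ij} σ^s` of all spins, half-integral ones included, form a basis of `𝒜`.
They are linearly independent because powers of `L_e` move them to the lowest vectors
`a^p c^i σ^s`, which are eigenvectors of an automorphism with distinct eigenvalues
(`linearIndependent_rawEl`); such a vector is nonzero since powers of `L_{fk}` move it to a
diagonal matrix element, which has counit `1`. They span because `𝒜` is filtered by the spans of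
the ordered monomials `a^i b^j c^k d^l σ^s` with `i = 0` or `l = 0`, and in each degree there are
exactly as many such monomials as matrix elements (`span_rawEl`).

In this basis left invariance decouples into one tridiagonal system of linear equations for every
row (`mem_leftInvariants_iff_sys`). For `x_{αβ}` the diagonal vanishes: the coordinates of one
parity are zero, those of the other parity satisfy a two-term recursion, and there is a nonzero
solution only if the row has odd length. For `x_{βγ}` and `x_{αγ}` the system is triangular with
diagonal entries `± t^{-2j} - 1`; as `q` is not a root of unity, such an entry vanishes only for
`j = 0` and `ℓ + s` even. In all cases the space of solutions has dimension at most one, and the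
sequences `y_j` solve the recursions. The closed forms follow by comparing the squares of
consecutive quotients.
-/

noncomputable section

namespace OSpQ

open Gen

/-! ### The action of the enveloping algebra by twisted derivations -/

section Leibniz
variable {t : ℂ}

theorem tm_induct {P : AA t → Prop} (h0 : P 0)
    (hP : ∀ x y : A t, theta t y = y ∨ theta t y = -y → P (tm x y))
    (hadd : ∀ X Y, P X → P Y → P (X + Y)) (X : AA t) : P X := by
  change P (GradedTensorProduct.of ℂ (grading t) (grading t)
    ((GradedTensorProduct.of ℂ (grading t) (grading t)).symm X))
  induction (GradedTensorProduct.of ℂ (grading t) (grading t)).symm X using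
    TensorProduct.induction_on with
  | zero => simpa using h0
  | tmul x y =>
    change P (tm x y)
    rw [← comp_add t y, tm_add]
    exact hadd _ _ (hP _ _ (.inl (mem_grading_zero.1 (comp t 0 y).2)))
      (hP _ _ (.inr (mem_grading_one.1 (comp t 1 y).2)))
  | add x y hx hy => simpa using hadd _ _ hx hy

/-- The contraction of the second factor of the graded tensor product with a functional. -/
def slice (φ : A t →ₗ[ℂ] ℂ) [NeZero t] : AA t →ₗ[ℂ] A t :=
  contract φ ∘ₗ (GradedTensorProduct.of ℂ (grading t) (grading t)).symm.toLinearMap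

variable [NeZero t]

theorem slice_tm (φ : A t →ₗ[ℂ] ℂ) (x y : A t) :
    slice φ (tm x y) = evenPart φ y • x + oddPart φ y • theta t x := by
  change TensorProduct.lift _ (x ⊗ₜ[ℂ] y) = _
  rw [TensorProduct.lift.tmul]
  rfl

theorem slice_tm_of_even {φ : A t →ₗ[ℂ] ℂ} (hφ : ∀ x, φ (theta t x) = φ x) (x y : A t) :
    slice φ (tm x y) = φ y • x := by
  rw [slice_tm]
  simp only [evenPart, oddPart, LinearMap.smul_apply, LinearMap.add_apply, LinearMap.sub_apply,
    LinearMap.comp_apply, AlgHom.toLinearMap_apply, hφ, sub_self, mul_zero, zero_smul, add_zero,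
    smul_eq_mul]
  congr 1
  ring

theorem slice_tm_of_odd {φ : A t →ₗ[ℂ] ℂ} (hφ : ∀ x, φ (theta t x) = -φ x) (x y : A t) :
    slice φ (tm x y) = φ y • theta t x := by
  rw [slice_tm]
  simp only [evenPart, oddPart, LinearMap.smul_apply, LinearMap.add_apply, LinearMap.sub_apply,
    LinearMap.comp_apply, AlgHom.toLinearMap_apply, hφ, smul_eq_mul, add_neg_cancel, mul_zero,
    zero_smul, zero_add]
  congr 1
  ring

theorem leftAct_eq_slice (φ : A t →ₗ[ℂ] ℂ) (u : A t) :
    leftAct φ u = slice φ (coproduct t u) := rfl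

theorem leftAct_add (φ ψ : A t →ₗ[ℂ] ℂ) : leftAct (φ + ψ) = leftAct φ + leftAct ψ := by
  ext u
  simp only [leftAct_eq_slice, LinearMap.add_apply]
  induction coproduct t u using tm_induct with
  | h0 => simp
  | hP x y _ =>
    simp only [slice_tm, evenPart, oddPart, LinearMap.smul_apply, LinearMap.add_apply,
      LinearMap.sub_apply, LinearMap.comp_apply, smul_eq_mul]
    module
  | hadd X Y hX hY => simp only [map_add, hX, hY]; abel

theorem leftAct_smul (z : ℂ) (φ : A t →ₗ[ℂ] ℂ) : leftAct (z • φ) = z • leftAct φ := by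
  ext u
  simp only [leftAct_eq_slice, LinearMap.smul_apply]
  induction coproduct t u using tm_induct with
  | h0 => simp
  | hP x y _ =>
    simp only [slice_tm, evenPart, oddPart, LinearMap.smul_apply, LinearMap.add_apply,
      LinearMap.sub_apply, LinearMap.comp_apply, smul_eq_mul]
    module
  | hadd X Y hX hY => simp only [map_add, hX, hY, smul_add]

/-- An even character of `𝒜` acts by an algebra endomorphism. -/
theorem leftAct_mul_of_algHom {χ : A t →ₐ[ℂ] ℂ} (hχ : ∀ x, χ (theta t x) = χ x) (u v : A t) :
    leftAct χ.toLinearMap (u * v) = leftAct χ.toLinearMap u * leftAct χ.toLinearMap v := by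
  have hs := slice_tm_of_even (φ := χ.toLinearMap) hχ
  simp only [leftAct_eq_slice, map_mul]
  induction coproduct t u using tm_induct with
  | h0 => simp
  | hadd X Y hX hY => simp only [add_mul, map_add, hX, hY]
  | hP x y hy =>
    induction coproduct t v using tm_induct with
    | h0 => simp
    | hadd X Y hX hY => simp only [mul_add, map_add, hX, hY]
    | hP z w _ =>
      rcases hy with hy | hy
      · rw [tm_mul_even _ _ _ _ hy]
        simp only [hs, AlgHom.toLinearMap_apply, map_mul, smul_mul_smul_comm]
      · have h0 : χ y = 0 := by
          have := hχ y
          rw [hy, map_neg] at this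
          linear_combination (-(1 / 2 : ℂ)) * this
        rw [tm_mul_odd _ _ _ _ hy]
        simp [hs, h0]

/-- An odd functional that is a twisted derivation with respect to the character `χ` acts by a
twisted derivation. -/
theorem leftAct_mul_of_odd {χ : A t →ₐ[ℂ] ℂ} (hχ : ∀ x, χ (theta t x) = χ x)
    {φ : A t →ₗ[ℂ] ℂ} (hφ : ∀ x, φ (theta t x) = -φ x)
    (hmul : ∀ x y, φ (x * y) = φ x * counit t y + χ x * φ y) (u v : A t) :
    leftAct φ (u * v) = leftAct φ u * leftAct (counit t).toLinearMap v +
      theta t (leftAct χ.toLinearMap u) * leftAct φ v := by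
  have hs := slice_tm_of_even (φ := χ.toLinearMap) hχ
  have hc := slice_tm_of_even (φ := (counit t).toLinearMap) (counit_theta t)
  have ho := slice_tm_of_odd hφ
  simp only [leftAct_eq_slice, map_mul]
  induction coproduct t u using tm_induct with
  | h0 => simp
  | hadd X Y hX hY => simp only [add_mul, map_add, hX, hY]; abel
  | hP x y hy =>
    induction coproduct t v using tm_induct with
    | h0 => simp
    | hadd X Y hX hY => simp only [mul_add, map_add, hX, hY]; abel
    | hP z w _ =>
      rcases hy with hy | hy
      · have h0 : φ y = 0 := by
          have := hφ y
          rw [hy] at this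
          linear_combination (1 / 2 : ℂ) * this
        rw [tm_mul_even _ _ _ _ hy]
        simp only [hs, hc, ho, AlgHom.toLinearMap_apply, map_mul, map_smul, smul_mul_smul_comm,
          hmul, h0, zero_mul, zero_smul, zero_add]
      · have h0 : χ y = 0 := by
          have := hχ y
          rw [hy, map_neg] at this
          linear_combination (-(1 / 2 : ℂ)) * this
        rw [tm_mul_odd _ _ _ _ hy]
        simp only [hs, hc, ho, AlgHom.toLinearMap_apply, map_mul, smul_mul_smul_comm,
          hmul, h0, zero_mul, zero_smul, map_zero, add_zero, theta_theta]

theorem leftAct_counit : leftAct (counit t).toLinearMap = LinearMap.id := by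
  have hc := slice_tm_of_even (φ := (counit t).toLinearMap) (counit_theta t)
  have h1 : ∀ z, leftAct (counit t).toLinearMap (algebraMap ℂ (A t) z) = algebraMap ℂ (A t) z := by
    intro z
    rw [leftAct_eq_slice, AlgHom.commutes, Algebra.algebraMap_eq_smul_one, map_smul]
    change z • slice _ (tm 1 1) = _
    rw [hc]
    simp [Algebra.algebraMap_eq_smul_one]
  ext u
  induction u using induct with
  | h0 z => exact h1 z
  | h1 g =>
    rw [leftAct_eq_slice, coproduct_gen]
    cases g <;> simp only [coGen, map_add, hc] <;> simp [counit, liftA_gen]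
  | h2 x y hx hy => simp only [map_add, hx, hy]
  | h3 x y hx hy => rw [leftAct_mul_of_algHom (counit_theta t), hx, hy]; rfl

end Leibniz

/-! ### The operators of `k`, `e` and `fk` -/

section operators
variable (q t : ℂ) [NeZero t]

/-- The left action of `k`, as an algebra endomorphism of `𝒜`. -/
def K : A t →ₐ[ℂ] A t :=
  AlgHom.ofLinearMap (leftAct (kFun t).toLinearMap)
    (by
      have h : coproduct t (1 : A t) = tm 1 1 := map_one _
      rw [leftAct_eq_slice, h, slice_tm_of_even (kFun_theta t)]
      simp)
    (leftAct_mul_of_algHom (kFun_theta t))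

theorem K_apply (u : A t) : K t u = leftAct (kFun t).toLinearMap u := rfl

/-- The left action of `e`. -/
def E : A t →ₗ[ℂ] A t := leftAct (eFun q t)

/-- The element `fk` as a function on `𝒜`. -/
def fkFun : A t →ₗ[ℂ] ℂ := funMul (fFun t) (kFun t).toLinearMap

theorem fkFun_apply (u : A t) : fkFun t u = fFun t (K t u) := rfl

/-- The left action of `fk`. -/
def F : A t →ₗ[ℂ] A t := leftAct (fkFun t)

theorem leftAct_xFun (α β γ : ℂ) (u : A t) :
    leftAct (xFun q t α β γ) u = α • E q t u + β • F t u + γ • (K t u - u) := by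
  have h : xFun q t α β γ = α • eFun q t + β • fkFun t +
      γ • ((kFun t).toLinearMap + (-1 : ℂ) • (counit t).toLinearMap) := by
    rw [neg_one_smul, ← sub_eq_add_neg]; rfl
  rw [h]
  simp only [leftAct_add, leftAct_smul, leftAct_counit, LinearMap.add_apply,
    LinearMap.smul_apply, LinearMap.id_apply, K_apply, E, F]
  module

theorem K_gen : K t (gen t a) = t • gen t a ∧ K t (gen t b) = -(t⁻¹ • gen t b) ∧
    K t (gen t c) = t • gen t c ∧ K t (gen t d) = -(t⁻¹ • gen t d) ∧
    K t (gen t s) = -gen t s := by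
  have hc := slice_tm_of_even (φ := (kFun t).toLinearMap) (kFun_theta t)
  refine ⟨?_, ?_, ?_, ?_, ?_⟩ <;> rw [K_apply, leftAct_eq_slice, coproduct_gen] <;>
    simp only [coGen, map_add, hc] <;> simp [kFun, liftA_gen]

theorem K_theta (u : A t) : K t (theta t u) = theta t (K t u) := by
  obtain ⟨ka, kb, kc, kd, ks⟩ := K_gen t
  have : (K t).comp (theta t) = (theta t).comp (K t) := by
    apply algHom_ext
    intro g
    cases g <;> simp [genSign, ka, kb, kc, kd, ks]
  exact DFunLike.congr_fun this u

theorem eFun_theta (x : A t) : eFun q t (theta t x) = -eFun q t x := by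
  obtain ⟨h1, h2, h3, h4, h5⟩ := eFun_gen q t
  induction x using induct with
  | h0 z => simp [eFun, Matrix.algebraMap_matrix_apply]
  | h1 g => cases g <;> simp [genSign, h1, h2, h3, h4, h5]
  | h2 x y hx hy => simp only [map_add, hx, hy]; ring
  | h3 x y hx hy =>
    rw [map_mul, eFun_mul, eFun_mul, hx, hy, counit_theta, theta_theta, kFun_theta]
    ring

theorem fFun_theta (x : A t) : fFun t (theta t x) = -fFun t x := by
  obtain ⟨h1, h2, h3, h4, h5⟩ := fFun_gen t
  have hk : ∀ y, kInvFun t (theta t y) = kInvFun t y := by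
    have : (kInvFun t).comp (theta t) = kInvFun t := by
      apply algHom_ext
      intro g
      cases g <;> simp [genSign, kInvFun, liftA_gen]
    exact DFunLike.congr_fun this
  induction x using induct with
  | h0 z => simp [fFun, Matrix.algebraMap_matrix_apply]
  | h1 g => cases g <;> simp [genSign, h1, h2, h3, h4, h5]
  | h2 x y hx hy => simp only [map_add, hx, hy]; ring
  | h3 x y hx hy =>
    rw [map_mul, fFun_mul, fFun_mul, hx, hy, counit_theta, counit_theta, hk]
    ring

theorem fkFun_theta (x : A t) : fkFun t (theta t x) = -fkFun t x := by
  rw [fkFun_apply, K_theta, fFun_theta, fkFun_apply]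

/-- Multiplying by `k` turns the twisted derivation `f` into one of the same type as `e`. -/
theorem fkFun_mul (x y : A t) :
    fkFun t (x * y) = fkFun t x * counit t y + kFun t x * fkFun t y := by
  obtain ⟨ka, kb, kc, kd, ks⟩ := K_gen t
  have h1 : (kInvFun t).comp (K t) = counit t := by
    apply algHom_ext
    intro g
    cases g <;> simp [ka, kb, kc, kd, ks, kInvFun, counit, liftA_gen, NeZero.ne t]
  have h2 : (counit t).comp (K t) = kFun t := by
    apply algHom_ext
    intro g
    cases g <;> simp [ka, kb, kc, kd, ks, kFun, counit, liftA_gen]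
  have h1y : kInvFun t (K t y) = counit t y := DFunLike.congr_fun h1 y
  have h2x : counit t (K t x) = kFun t x := DFunLike.congr_fun h2 x
  simp only [fkFun_apply, map_mul, fFun_mul, counit_theta, h1y, h2x]

theorem E_mul (u v : A t) : E q t (u * v) = E q t u * v + theta t (K t u) * E q t v := by
  have := leftAct_mul_of_odd (kFun_theta t) (eFun_theta q t)
    (fun x y => by rw [eFun_mul, kFun_theta]) u v
  rwa [leftAct_counit] at this

theorem F_mul (u v : A t) : F t (u * v) = F t u * v + theta t (K t u) * F t v := by
  have := leftAct_mul_of_odd (kFun_theta t) (fkFun_theta t) (fkFun_mul t) u v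
  rwa [leftAct_counit] at this

theorem E_gen : E q t (gen t a) = 0 ∧ E q t (gen t b) = ((t - t⁻¹) / (q - q⁻¹)) • gen t a ∧
    E q t (gen t c) = 0 ∧ E q t (gen t d) = -(((t - t⁻¹) / (q - q⁻¹)) • gen t c) ∧
    E q t (gen t s) = 0 := by
  obtain ⟨h1, h2, h3, h4, h5⟩ := eFun_gen q t
  have hc := slice_tm_of_odd (eFun_theta q t)
  refine ⟨?_, ?_, ?_, ?_, ?_⟩ <;> rw [E, leftAct_eq_slice, coproduct_gen] <;>
    simp only [coGen, map_add, hc, h1, h2, h3, h4, h5] <;> simp [genSign]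

theorem F_gen : F t (gen t a) = -(t • gen t b) ∧ F t (gen t b) = 0 ∧
    F t (gen t c) = t • gen t d ∧ F t (gen t d) = 0 ∧ F t (gen t s) = 0 := by
  obtain ⟨ka, kb, kc, kd, ks⟩ := K_gen t
  obtain ⟨h1, h2, h3, h4, h5⟩ := fFun_gen t
  have hc := slice_tm_of_odd (fkFun_theta t)
  refine ⟨?_, ?_, ?_, ?_, ?_⟩ <;> rw [F, leftAct_eq_slice, coproduct_gen] <;>
    simp only [coGen, map_add, hc, fkFun_apply, ka, kb, kc, kd, ks, map_smul, map_neg,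
      h1, h2, h3, h4, h5] <;> simp [genSign]

theorem E_one : E q t 1 = 0 := by
  have := E_mul q t 1 1
  simpa using this

theorem F_one : F t 1 = 0 := by
  have := F_mul t 1 1
  simpa using this

theorem xFun_one (α β γ : ℂ) : xFun q t α β γ 1 = 0 := by
  have he : eFun q t 1 = 0 := by simp [eFun]
  have hf : fkFun t 1 = 0 := by rw [fkFun_apply, map_one]; simp [fFun]
  change α * eFun q t 1 + β * fkFun t 1 + γ * (kFun t 1 - counit t 1) = 0
  simp [he, hf]

theorem mem_leftInvariants_xFun (α β γ : ℂ) (u : A t) :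
    u ∈ leftInvariants (xFun q t α β γ) ↔
      α • E q t u + β • F t u + γ • (K t u - u) = 0 := by
  rw [mem_leftInvariants, xFun_one, zero_smul, leftAct_xFun]

end operators

/-! ### The rows of matrix elements as weight modules -/

/-- The coefficient in `L_e(u_{j+1}) = ± eC n j u_j` for a row `u` of `n + 1` matrix elements. -/
def eC (q t : ℂ) (n j : ℕ) : ℂ :=
  (-1) ^ j * (t ^ (n - j : ℤ) - t ^ (j - n : ℤ)) / (q - q⁻¹)

/-- The coefficient in `L_{fk}(u_j) = ± fC n j u_{j+1}` for a row `u` of `n + 1` matrix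
elements. -/
def fC (t : ℂ) (n j : ℕ) : ℂ :=
  (-1) ^ (j + 1) * t ^ (n - j : ℤ) * ((1 - t⁻¹ ^ (2 * (j + 1))) / (1 - t⁻¹ ^ 2))

/-- A sequence in `𝒜` that behaves like a row of unnormalized matrix elements: it vanishes beyond
`n`, its terms are weight vectors, and `e` and `fk` act as lowering and raising operators.
The sign `S = ±1` is the parity of the initial term. -/
structure IsRow (q t : ℂ) [NeZero t] (n : ℕ) (S : ℂ) (R : ℕ → A t) : Prop where
  eq_zero : ∀ j, n < j → R j = 0
  theta_apply : ∀ j, theta t (R j) = (S * (-1) ^ j) • R j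
  K_apply : ∀ j, K t (R j) = ((-1) ^ j * t ^ (n - 2 * j : ℤ)) • R j
  E_zero : E q t (R 0) = 0
  E_succ : ∀ j, E q t (R (j + 1)) = (S * eC q t n j) • R j
  F_apply : ∀ j, F t (R j) = (S * fC t n j) • R (j + 1)

section rows
variable {q t : ℂ} [NeZero t]

theorem eC_succ_zero (n : ℕ) :
    eC q t (n + 1) 0 = t * eC q t n 0 + t ^ (-n : ℤ) * ((t - t⁻¹) / (q - q⁻¹)) := by
  have ht := NeZero.ne t
  have h1 : t ^ ((n : ℤ) + 1) = t ^ (n : ℤ) * t := zpow_add_one₀ ht _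
  have h2 : t ^ (-1 - (n : ℤ)) = t ^ (-(n : ℤ)) * t⁻¹ := by
    rw [← zpow_sub_one₀ ht]; congr 1; ring
  simp only [eC, pow_zero, one_mul, Nat.cast_zero, sub_zero, zero_sub, Nat.cast_add, Nat.cast_one,
    neg_add_rev, h1, ← sub_eq_add_neg, h2]
  ring

omit [NeZero t] in
theorem eC_succ_succ (n j : ℕ) : eC q t (n + 1) (j + 1) = -eC q t n j := by
  simp only [eC, pow_succ, Nat.cast_add, Nat.cast_one, add_sub_add_right_eq_sub]
  ring

theorem eC_succ (n j : ℕ) : eC q t (n + 1) (j + 1) =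
    t * eC q t n (j + 1) + (-1) ^ (j + 1) * t ^ (j + 1 - n : ℤ) * ((t - t⁻¹) / (q - q⁻¹)) := by
  have ht := NeZero.ne t
  have h1 : t ^ ((n : ℤ) - j) = t ^ ((n : ℤ) - (j + 1)) * t := by
    rw [← zpow_add_one₀ ht]; congr 1; ring
  have h2 : t ^ ((j : ℤ) - n) = t ^ ((j : ℤ) + 1 - n) * t⁻¹ := by
    rw [← zpow_sub_one₀ ht]; congr 1; ring
  simp only [eC, pow_succ, Nat.cast_add, Nat.cast_one, add_sub_add_right_eq_sub, h1, h2]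
  ring

theorem fC_succ_left (n j : ℕ) : fC t (n + 1) j = t * fC t n j := by
  have ht := NeZero.ne t
  have h1 : t ^ ((n : ℤ) + 1 - j) = t ^ ((n : ℤ) - j) * t := by
    rw [← zpow_add_one₀ ht]; congr 1; ring
  simp only [fC, Nat.cast_add, Nat.cast_one, h1]
  ring

theorem fC_succ_zero (h : t⁻¹ ^ 2 ≠ 1) (n : ℕ) : fC t (n + 1) 0 * t ^ (-n : ℤ) = -t := by
  have ht := NeZero.ne t
  have h' : 1 - t⁻¹ ^ 2 ≠ 0 := sub_ne_zero.2 h.symm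
  have h1 : t ^ ((n : ℤ) + 1) * t ^ (-n : ℤ) = t := by
    rw [← zpow_add₀ ht]; simp
  simp only [fC, Nat.cast_add, Nat.cast_one, Nat.cast_zero, sub_zero, zero_add, mul_one,
    div_self h', pow_one]
  linear_combination -h1

theorem fC_succ_succ (h : t⁻¹ ^ 2 ≠ 1) (n j : ℕ) :
    fC t (n + 1) (j + 1) * ((-1) ^ (j + 1) * t ^ (j + 1 - n : ℤ)) =
      -t + (-1) ^ j * t ^ (j - n : ℤ) * t⁻¹ * fC t n j := by
  have ht := NeZero.ne t
  have h' : 1 - t⁻¹ ^ 2 ≠ 0 := sub_ne_zero.2 h.symm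
  have h1 : t ^ ((n : ℤ) - j) * t ^ ((j : ℤ) + 1 - n) = t := by
    rw [← zpow_add₀ ht]; simp
  have h2 : t ^ ((j : ℤ) - n) * t ^ ((n : ℤ) - j) = 1 := by
    rw [← zpow_add₀ ht]; simp
  have h3 : ((-1 : ℂ) ^ j) ^ 2 = 1 := by rw [← pow_mul, mul_comm, pow_mul]; simp
  have h4 : (1 - t⁻¹ ^ (2 * (j + 1 + 1))) / (1 - t⁻¹ ^ 2) =
      1 + t⁻¹ ^ 2 * ((1 - t⁻¹ ^ (2 * (j + 1))) / (1 - t⁻¹ ^ 2)) := by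
    rw [div_eq_iff h', add_mul, mul_assoc, div_mul_cancel₀ _ h']
    ring
  have h5 : t * t⁻¹ = 1 := mul_inv_cancel₀ ht
  simp only [fC, Nat.cast_add, Nat.cast_one, add_sub_add_right_eq_sub, h4]
  generalize (1 - t⁻¹ ^ (2 * (j + 1))) / (1 - t⁻¹ ^ 2) = H
  simp only [pow_succ (-1 : ℂ)]
  linear_combination (-((-1) ^ j) ^ 2 * (1 + t⁻¹ ^ 2 * H)) * h1 +
    (((-1) ^ j) ^ 2 * t⁻¹ * H) * h2 - t * h3 - ((-1) ^ j) ^ 2 * t⁻¹ * H * h5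

/-- The coproduct of `g x`, where `Δ(g) = g ⊗ a + h ⊗ c`, turns a row for `x` into a row
for `g x`. -/
theorem IsRow.step (ht : t⁻¹ ^ 2 ≠ 1) {n : ℕ} {S ε : ℂ} {R R' : ℕ → A t} {g h : A t}
    (hR : IsRow q t n S R) (hS : S * S = 1)
    (θg : theta t g = ε • g) (θh : theta t h = -(ε • h))
    (Kg : K t g = t • g) (Kh : K t h = -(t⁻¹ • h))
    (Eg : E q t g = 0) (Eh : E q t h = (ε * ((t - t⁻¹) / (q - q⁻¹))) • g)
    (Fg : F t g = -((ε * t) • h)) (Fh : F t h = 0)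
    (h0 : R' 0 = g * R 0)
    (h1 : ∀ j, R' (j + 1) = g * R (j + 1) + (S * (-1) ^ j * t ^ (j - n : ℤ)) • (h * R j)) :
    IsRow q t (n + 1) (ε * S) R' := by
  have ht0 := NeZero.ne t
  have θKg : theta t (K t g) = (ε * t) • g := by rw [Kg, map_smul, θg]; module
  have θKh : theta t (K t h) = (ε * t⁻¹) • h := by rw [Kh, map_neg, map_smul, θh]; module
  refine ⟨?_, ?_, ?_, ?_, ?_, ?_⟩
  · intro j hj
    obtain _ | j := j
    · omega
    · rw [h1, hR.eq_zero _ (by omega), hR.eq_zero _ (by omega)]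
      simp
  · intro j
    obtain _ | j := j
    · rw [h0, map_mul, θg, hR.theta_apply]
      simp only [smul_mul_smul_comm]
      module
    · rw [h1, map_add, map_smul, map_mul, map_mul, θg, θh, hR.theta_apply, hR.theta_apply]
      simp only [neg_mul, mul_smul_comm, smul_mul_assoc]
      match_scalars <;> ring
  · intro j
    obtain _ | j := j
    · rw [h0, map_mul, Kg, hR.K_apply]
      simp only [smul_mul_smul_comm, Nat.cast_add, Nat.cast_one, Nat.cast_zero, mul_zero, sub_zero,
        zpow_add_one₀ ht0]
      module
    · have e1 : t ^ ((n : ℤ) + 1 - 2 * (j + 1)) = t ^ ((n : ℤ) - 2 * (j + 1)) * t := by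
        rw [← zpow_add_one₀ ht0]; congr 1; ring
      have e2 : t ^ ((n : ℤ) - 2 * j) = t ^ ((n : ℤ) - 2 * (j + 1)) * t * t := by
        rw [← zpow_add_one₀ ht0, ← zpow_add_one₀ ht0]; congr 1; ring
      rw [h1, map_add, map_smul, map_mul, map_mul, Kg, Kh, hR.K_apply, hR.K_apply]
      simp only [neg_mul, mul_smul_comm, smul_mul_assoc, Nat.cast_add, Nat.cast_one, e1, e2]
      match_scalars
      · ring
      · field_simp
        ring
  · rw [h0, E_mul, Eg, hR.E_zero]
    simp
  · intro j
    obtain _ | j := j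
    · rw [h1, h0, map_add, map_smul, E_mul, E_mul, Eg, Eh, hR.E_zero, hR.E_succ, θKg]
      simp only [zero_mul, mul_zero, mul_smul_comm, smul_mul_assoc, zero_add, add_zero,
        eC_succ_zero, Nat.cast_zero, zero_sub]
      module
    · rw [h1, h1, map_add, map_smul, E_mul, E_mul, Eg, Eh, hR.E_succ, hR.E_succ, θKg, θKh]
      have e1 : t ^ ((j : ℤ) + 1 - n) = t ^ ((j : ℤ) - n) * t := by
        rw [← zpow_add_one₀ ht0]; congr 1; ring
      have e2 := eC_succ (q := q) (t := t) n j
      have e3 := eC_succ_succ (q := q) (t := t) n j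
      simp only [mul_smul_comm, smul_mul_assoc, Nat.cast_add, Nat.cast_one, zero_mul, zero_add]
      simp only [smul_add, smul_smul]
      rw [← add_assoc, ← add_smul]
      congr 2
      · rw [e2]; ring
      · rw [e3, e1]
        field_simp
        ring
  · intro j
    obtain _ | j := j
    · rw [h0, h1, F_mul, Fg, hR.F_apply, θKg]
      have e1 := fC_succ_left (t := t) n 0
      have e2 := fC_succ_zero ht n
      simp only [mul_smul_comm, smul_mul_assoc, neg_mul, smul_add, smul_smul, pow_zero, mul_one,
        Nat.cast_zero, zero_sub]
      rw [add_comm, ← neg_smul]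
      congr 2
      · rw [e1]; ring
      · linear_combination (-ε * S * S) * e2 + ε * t * hS
    · rw [h1, h1, map_add, map_smul, F_mul, F_mul, Fg, Fh, hR.F_apply, hR.F_apply, θKg, θKh]
      have e1 := fC_succ_left (t := t) n (j + 1)
      have e2 := fC_succ_succ ht n j
      simp only [mul_smul_comm, smul_mul_assoc, neg_mul, smul_add, smul_smul, zero_mul, zero_add,
        Nat.cast_add, Nat.cast_one]
      rw [← neg_smul, add_right_comm, ← add_smul, add_comm]
      congr 2
      · rw [e1]; ring
      · linear_combination (-ε * S * S) * e2 + ε * t * hS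

end rows

section rawM
variable (q t : ℂ) [NeZero t]

theorem isRow_rawM (ht : t⁻¹ ^ 2 ≠ 1) (p m : ℕ) :
    IsRow q t (p + m) ((-1) ^ m) (rawM t p m) := by
  have ht0 := NeZero.ne t
  obtain ⟨θa, θb, θc, θd, -⟩ := genE t
  obtain ⟨Ka, Kb, Kc, Kd, -⟩ := K_gen t
  obtain ⟨Ea, Eb, Ec, Ed, -⟩ := E_gen q t
  obtain ⟨Fa, Fb, Fc, Fd, -⟩ := F_gen t
  have sgn : ∀ m : ℕ, (-1 : ℂ) ^ m * (-1) ^ m = 1 := fun m => by rw [← mul_pow]; simp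
  -- in the recursion for `rawM` the exponent is a truncated difference
  have key : ∀ (n m : ℕ) (R : ℕ → A t) (h : A t) (j : ℕ), IsRow q t n ((-1) ^ m) R →
      t⁻¹ ^ (n - j) • (h * theta t (R j)) =
        ((-1) ^ m * (-1) ^ j * t ^ (j - n : ℤ)) • (h * R j) := by
    intro n m R h j hR
    by_cases hj : n < j
    · simp [hR.eq_zero j hj]
    · rw [hR.theta_apply, mul_smul_comm, smul_smul]
      have : t⁻¹ ^ (n - j) = t ^ (j - n : ℤ) := by
        rw [inv_pow, ← zpow_natCast, ← zpow_neg, Nat.cast_sub (not_lt.1 hj), neg_sub]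
      rw [this, mul_comm]
  induction p with
  | zero =>
    induction m with
    | zero =>
      have h0 : rawM t 0 0 0 = 1 := by simp [rawM]
      have h1 : ∀ j, rawM t 0 0 (j + 1) = 0 := fun j => by simp [rawM]
      refine ⟨fun j hj => rawM_eq_zero _ _ _ _ hj, ?_, ?_, ?_, ?_, ?_⟩
      · rintro (_ | j) <;> simp [h0, h1]
      · rintro (_ | j) <;> simp [h0, h1]
      · rw [h0, E_one]
      · rintro (_ | j) <;> simp [h0, h1, eC]
      · rintro (_ | j) <;> simp [h0, h1, F_one]
    | succ m ih =>
      have := ih.step ht (R' := rawM t 0 (m + 1)) (ε := -1) (g := gen t c) (h := gen t d) (sgn m)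
        (by rw [θc]; simp) (by rw [θd]; simp) Kc Kd Ec (by rw [Ed]; simp)
        (by rw [Fc]; simp) Fd (by rw [rawM]) (fun j => by
          rw [rawM, ← key (0 + m) m _ _ _ ih, zero_add])
      rw [pow_succ', ← add_assoc]
      exact this
  | succ p ih =>
    have := ih.step ht (R' := rawM t (p + 1) m) (ε := 1) (g := gen t a) (h := gen t b) (sgn m)
      (by rw [θa]; simp) (by rw [θb]; simp) Ka Kb Ea (by rw [Eb]; simp)
      (by rw [Fa]; simp) Fb (by rw [rawM]) (fun j => by rw [rawM, ← key (p + m) m _ _ _ ih])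
    rwa [one_mul, add_right_comm] at this

omit [NeZero t] in
theorem rawM_zero (p m : ℕ) : rawM t p m 0 = gen t a ^ p * gen t c ^ m := by
  induction p with
  | zero =>
    induction m with
    | zero => simp [rawM]
    | succ m ih => rw [rawM, ih, pow_zero, one_mul, one_mul, pow_succ']
  | succ p ih => rw [rawM, ih, pow_succ', mul_assoc]

/-- The counit of the matrix elements is the identity matrix. -/
theorem counit_rawM_self (p m : ℕ) : counit t (rawM t p m m) = 1 := by
  have ca : counit t (gen t a) = 1 := by simp [counit, liftA_gen]
  have cb : counit t (gen t b) = 0 := by simp [counit, liftA_gen]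
  have cc : counit t (gen t c) = 0 := by simp [counit, liftA_gen]
  have cd : counit t (gen t d) = 1 := by simp [counit, liftA_gen]
  induction p with
  | zero =>
    induction m with
    | zero => simp [rawM]
    | succ m ih => simp [rawM, cc, cd, counit_theta, ih]
  | succ p ih => cases m <;> simp_all [rawM]

end rawM

/-! ### Linear independence of the matrix elements -/

section lowering

variable {V : Type*} [AddCommGroup V] [Module ℂ V]

theorem pow_lowering (T : Module.End ℂ V) (v : ℕ → V) (c : ℕ → ℂ) (h0 : T (v 0) = 0)
    (h1 : ∀ j, T (v (j + 1)) = c j • v j) (j : ℕ) :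
    (T ^ j) (v j) = (∏ i ∈ Finset.range j, c i) • v 0 ∧ ∀ k, j < k → (T ^ k) (v j) = 0 := by
  induction j with
  | zero =>
    refine ⟨by simp, fun k hk => ?_⟩
    obtain ⟨k, rfl⟩ := Nat.exists_eq_succ_of_ne_zero hk.ne'
    rw [Nat.succ_eq_add_one, pow_succ, Module.End.mul_apply, h0, map_zero]
  | succ j ih =>
    refine ⟨?_, fun k hk => ?_⟩
    · rw [pow_succ, Module.End.mul_apply, h1, map_smul, ih.1, smul_smul, Finset.prod_range_succ,
        mul_comm]
    · obtain ⟨k, rfl⟩ := Nat.exists_eq_succ_of_ne_zero (Nat.ne_of_gt (Nat.zero_lt_of_lt hk))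
      rw [Nat.succ_eq_add_one, pow_succ, Module.End.mul_apply, h1, map_smul, ih.2 k (by omega),
        smul_zero]

/-- A family that a lowering operator moves to nonzero multiples of linearly independent lowest
vectors is linearly independent. -/
theorem linearIndependent_of_lowering {κ : Type*} (N : κ → ℕ) (T : Module.End ℂ V)
    (v : (Σ β : κ, Fin (N β)) → V) (u : κ → V) (hu : LinearIndependent ℂ u)
    (c : (Σ β : κ, Fin (N β)) → ℂ) (hc : ∀ x, c x ≠ 0)
    (h1 : ∀ x, (T ^ (x.2 : ℕ)) (v x) = c x • u x.1)
    (h2 : ∀ x, ∀ k, (x.2 : ℕ) < k → (T ^ k) (v x) = 0) : LinearIndependent ℂ v := by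
  classical
  obtain ⟨φ, hφ⟩ := LinearMap.exists_leftInverse_of_injective _ (LinearMap.ker_eq_bot.2 hu)
  have hφu : ∀ β, φ (u β) = Finsupp.single β 1 := fun β => by
    have := LinearMap.congr_fun hφ (Finsupp.single β 1)
    simpa using this
  rw [linearIndependent_iff']
  intro s g hg
  by_contra! hne
  obtain ⟨x₁, hx₁, hgx₁⟩ := hne
  obtain ⟨x₀, hx₀, hmax⟩ := Finset.exists_max_image (s.filter fun x => g x ≠ 0)
    (fun x => (x.2 : ℕ)) ⟨x₁, Finset.mem_filter.2 ⟨hx₁, hgx₁⟩⟩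
  rw [Finset.mem_filter] at hx₀
  have h := congrArg (fun y => φ ((T ^ (x₀.2 : ℕ)) y) x₀.1) hg
  simp only [map_sum, map_smul, map_zero, Finsupp.finsetSum_apply, Finsupp.smul_apply,
    Finsupp.coe_zero, Pi.zero_apply, smul_eq_mul] at h
  rw [Finset.sum_eq_single_of_mem x₀ hx₀.1, h1, map_smul, hφu, Finsupp.smul_apply,
    Finsupp.single_eq_same, smul_eq_mul, mul_one] at h
  · exact mul_ne_zero hx₀.2 (hc _) h
  · intro x hx hxx₀
    by_cases hgx : g x = 0
    · rw [hgx, zero_mul]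
    have hle := hmax x (Finset.mem_filter.2 ⟨hx, hgx⟩)
    rcases hle.lt_or_eq with hlt | heq
    · rw [h2 x _ hlt, map_zero, Finsupp.coe_zero, Pi.zero_apply, mul_zero]
    · have hβ : x.1 ≠ x₀.1 := by
        intro hβ
        apply hxx₀
        obtain ⟨β, j⟩ := x
        obtain ⟨β₀, j₀⟩ := x₀
        obtain rfl : β = β₀ := hβ
        exact congrArg (Sigma.mk β) (Fin.ext heq)
      rw [← heq, h1, map_smul, hφu, Finsupp.smul_apply, Finsupp.single_eq_of_ne' hβ, smul_zero,
        mul_zero]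

end lowering

/-- The labels `(n, s, i)` of the rows `(m_{i0} σ^s, …, m_{in} σ^s)`, where `n / 2` is the spin
and `0 ≤ i ≤ n`. -/
abbrev Block : Type := Σ n : ℕ, Fin 2 × Fin (n + 1)

/-- The labels of the matrix elements: a row together with a column. -/
abbrev Idx : Type := Σ β : Block, Fin (β.1 + 1)

section independence
variable (q t : ℂ) [NeZero t]

/-- The unnormalized matrix elements `m_{ij} σ^s` of all comodules. -/
def rawEl (x : Idx) : A t :=
  rawM t (x.1.1 - x.1.2.2) x.1.2.2 x.2 * gen t s ^ (x.1.2.1 : ℕ)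

omit [NeZero t] in
theorem s_mul_s_pow (n : ℕ) : gen t s ^ n * gen t s ^ n = 1 := by
  rw [← pow_add, ← two_mul, pow_mul, pow_two, rel_sq, one_pow]

theorem E_s_pow (n : ℕ) : E q t (gen t s ^ n) = 0 := by
  induction n with
  | zero => rw [pow_zero, E_one]
  | succ n ih => rw [pow_succ, E_mul, ih, (E_gen q t).2.2.2.2, zero_mul, mul_zero, add_zero]

theorem F_s_pow (n : ℕ) : F t (gen t s ^ n) = 0 := by
  induction n with
  | zero => rw [pow_zero, F_one]
  | succ n ih => rw [pow_succ, F_mul, ih, (F_gen t).2.2.2.2, zero_mul, mul_zero, add_zero]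

theorem E_mul_s_pow (u : A t) (n : ℕ) : E q t (u * gen t s ^ n) = E q t u * gen t s ^ n := by
  rw [E_mul, E_s_pow, mul_zero, add_zero]

theorem F_mul_s_pow (u : A t) (n : ℕ) : F t (u * gen t s ^ n) = F t u * gen t s ^ n := by
  rw [F_mul, F_s_pow, mul_zero, add_zero]

theorem K_mul_s_pow (u : A t) (n : ℕ) :
    K t (u * gen t s ^ n) = (-1 : ℂ) ^ n • (K t u * gen t s ^ n) := by
  rw [map_mul, map_pow, (K_gen t).2.2.2.2, neg_pow, ← mul_smul_comm]
  congr 1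
  rw [Algebra.smul_def]
  simp

/-- The automorphism that multiplies `a`, `b`, `c`, `d`, `σ` by `2`, `-1/3`, `3`, `-1/2`, `-1`.
Its eigenvalues separate the monomials `a ^ p * c ^ m * σ ^ e`. -/
def dilation : A t →ₐ[ℂ] A t :=
  liftA t (fun
    | a => (2 : ℂ) • gen t a
    | b => (-3⁻¹ : ℂ) • gen t b
    | c => (3 : ℂ) • gen t c
    | d => (-2⁻¹ : ℂ) • gen t d
    | s => (-1 : ℂ) • gen t s)
    (by simp only [smul_mul_smul_comm, rel_ab]; module)
    (by simp only [smul_mul_smul_comm, rel_ac]; module)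
    (by simp only [smul_mul_smul_comm, rel_bc]; module)
    (by simp only [smul_mul_smul_comm, rel_bd]; module)
    (by simp only [smul_mul_smul_comm, rel_cd]; module)
    (by
      have := rel_ad t
      simp only [smul_mul_smul_comm]
      rw [sub_eq_iff_eq_add] at this
      rw [this]
      module)
    (by
      simp only [smul_mul_smul_comm, ← rel_det]
      module)
    (by simp [rel_sq])

omit [NeZero t] in
theorem dilation_monomial (p m e : ℕ) :
    dilation t (gen t a ^ p * gen t c ^ m * gen t s ^ e) =
      (2 ^ p * 3 ^ m * (-1) ^ e : ℂ) • (gen t a ^ p * gen t c ^ m * gen t s ^ e) := by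
  have ha : dilation t (gen t a) = (2 : ℂ) • gen t a := liftA_gen ..
  have hc : dilation t (gen t c) = (3 : ℂ) • gen t c := liftA_gen ..
  have hs : dilation t (gen t s) = (-1 : ℂ) • gen t s := liftA_gen ..
  simp only [map_mul, map_pow, ha, hc, hs, smul_pow, smul_mul_smul_comm]

theorem eigenvalue_injective {p p' m m' e e' : ℕ} (he : e < 2) (he' : e' < 2)
    (h : (2 ^ p * 3 ^ m * (-1) ^ e : ℂ) = 2 ^ p' * 3 ^ m' * (-1) ^ e') :
    p = p' ∧ m = m' ∧ e = e' := by
  have h1 : 2 ^ p * 3 ^ m = 2 ^ p' * 3 ^ m' := by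
    have := congrArg norm h
    simp only [norm_mul, norm_pow, norm_neg, norm_one, one_pow, mul_one, Complex.norm_ofNat] at this
    exact_mod_cast this
  have h2 : p = p' := by
    have := congrArg (padicValNat 2) h1
    rwa [padicValNat.mul (by positivity) (by positivity),
      padicValNat.mul (by positivity) (by positivity), padicValNat.prime_pow, padicValNat.prime_pow,
      padicValNat.pow, padicValNat.pow, padicValNat.eq_zero_of_not_dvd (by norm_num), mul_zero,
      mul_zero] at this
  subst h2
  have h3 : m = m' := Nat.pow_right_injective (by norm_num : 2 ≤ 3)
    (Nat.eq_of_mul_eq_mul_left (by positivity) h1)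
  subst h3
  refine ⟨rfl, rfl, ?_⟩
  have h4 := mul_left_cancel₀ (by simp : (2 ^ p * 3 ^ m : ℂ) ≠ 0) h
  interval_cases e <;> interval_cases e' <;> first | rfl | norm_num at h4

section generic
variable {q t} (hq : q - q⁻¹ ≠ 0) (ht : ∀ n : ℕ, 0 < n → t ^ n ≠ 1)
include ht

omit [NeZero t] in
theorem inv_pow_ne_one {n : ℕ} (hn : 0 < n) : t⁻¹ ^ n ≠ 1 := by
  rw [inv_pow, Ne, inv_eq_one]
  exact ht n hn

include hq in
theorem eC_ne_zero {n j : ℕ} (h : j < n) : eC q t n j ≠ 0 := by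
  have ht0 := NeZero.ne t
  refine div_ne_zero (mul_ne_zero (by simp) ?_) hq
  intro h0
  refine ht (2 * (n - j)) (by omega) ?_
  rw [sub_eq_zero] at h0
  have : t ^ ((n : ℤ) - j) * t ^ ((n : ℤ) - j) = 1 := by
    nth_rw 2 [h0]
    rw [← zpow_add₀ ht0]
    simp
  rw [← this, ← zpow_natCast, ← zpow_add₀ ht0]
  congr 1
  omega

theorem fC_ne_zero (n j : ℕ) : fC t n j ≠ 0 := by
  have ht0 := NeZero.ne t
  refine mul_ne_zero (mul_ne_zero (by simp) (zpow_ne_zero _ ht0)) (div_ne_zero ?_ ?_)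
  · exact sub_ne_zero.2 (inv_pow_ne_one ht (by omega)).symm
  · exact sub_ne_zero.2 (inv_pow_ne_one ht (by omega)).symm

theorem a_pow_mul_c_pow_mul_s_pow_ne_zero (p m e : ℕ) :
    gen t a ^ p * gen t c ^ m * gen t s ^ e ≠ 0 := by
  intro h
  have h0 : rawM t p m 0 = 0 := by
    rw [rawM_zero]
    calc gen t a ^ p * gen t c ^ m
        = gen t a ^ p * gen t c ^ m * gen t s ^ e * gen t s ^ e := by
          rw [mul_assoc, s_mul_s_pow, mul_one]
      _ = 0 := by rw [h, zero_mul]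
  have hR := isRow_rawM 0 t (inv_pow_ne_one ht two_pos) p m
  -- the raising operator reaches the diagonal matrix element, whose counit is `1`
  have hj : ∀ j, rawM t p m j = 0 := by
    intro j
    induction j with
    | zero => exact h0
    | succ j ih =>
      have h1 := hR.F_apply j
      rw [ih, map_zero] at h1
      exact (smul_eq_zero.1 h1.symm).resolve_left (mul_ne_zero (by simp) (fC_ne_zero ht _ _))
  have h1 := counit_rawM_self t p m
  rw [hj, map_zero] at h1
  exact zero_ne_one h1

theorem linearIndependent_lowest : LinearIndependent ℂ fun β : Block =>
    gen t a ^ (β.1 - β.2.2) * gen t c ^ (β.2.2 : ℕ) * gen t s ^ (β.2.1 : ℕ) := by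
  refine Module.End.eigenvectors_linearIndependent' (dilation t).toLinearMap
    (fun β : Block => (2 ^ (β.1 - β.2.2) * 3 ^ (β.2.2 : ℕ) * (-1) ^ (β.2.1 : ℕ) : ℂ)) ?_ _ ?_
  · rintro ⟨n, e, i⟩ ⟨n', e', i'⟩ h
    obtain ⟨h1, h2, h3⟩ := eigenvalue_injective e.2 e'.2 h
    simp only at h1 h2 h3
    obtain rfl : n = n' := by omega
    rw [Fin.ext h2, Fin.ext h3]
  · intro β
    exact ⟨Module.End.mem_eigenspace_iff.2 (dilation_monomial t _ _ _),
      a_pow_mul_c_pow_mul_s_pow_ne_zero ht _ _ _⟩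

include hq

theorem linearIndependent_rawEl : LinearIndependent ℂ (rawEl t) := by
  have key := fun β : Block => pow_lowering (E q t)
    (fun j => rawM t (β.1 - β.2.2) β.2.2 j * gen t s ^ (β.2.1 : ℕ))
    (fun j => (-1) ^ (β.2.2 : ℕ) * eC q t (β.1 - β.2.2 + β.2.2) j)
    (by
      have hR := isRow_rawM q t (inv_pow_ne_one ht two_pos) (β.1 - β.2.2) β.2.2
      rw [E_mul_s_pow, hR.E_zero, zero_mul])
    (fun j => by
      have hR := isRow_rawM q t (inv_pow_ne_one ht two_pos) (β.1 - β.2.2) β.2.2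
      rw [E_mul_s_pow, hR.E_succ, smul_mul_assoc])
  refine linearIndependent_of_lowering (fun β : Block => β.1 + 1) (E q t) (rawEl t) _
    (linearIndependent_lowest ht) (fun x => ∏ j ∈ Finset.range x.2,
      ((-1) ^ (x.1.2.2 : ℕ) * eC q t (x.1.1 - x.1.2.2 + x.1.2.2) j))
    (fun x => ?_) (fun x => ?_) (fun x => (key x.1 x.2).2)
  rotate_left
  · rw [← rawM_zero]
    exact (key x.1 x.2).1
  · refine Finset.prod_ne_zero_iff.2 fun j hj => mul_ne_zero (by simp) (eC_ne_zero hq ht ?_)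
    have h1 := x.2.2
    have h2 := x.1.2.2.2
    have h3 := Finset.mem_range.1 hj
    omega

end generic

end independence

/-! ### Ordered monomials and the basis of matrix elements -/

/-- Two elements commute up to a scalar. -/
def QComm {t : ℂ} (x y : A t) : Prop := ∃ z : ℂ, x * y = z • (y * x)

namespace QComm
variable {t : ℂ} {x x' y y' : A t}

theorem mul_right (h : QComm x y) (h' : QComm x y') : QComm x (y * y') := by
  obtain ⟨z, hz⟩ := h
  obtain ⟨z', hz'⟩ := h'
  refine ⟨z * z', ?_⟩
  rw [← mul_assoc, hz, smul_mul_assoc, mul_assoc, hz', mul_smul_comm, smul_smul, mul_assoc]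

theorem mul_left (h : QComm x y) (h' : QComm x' y) : QComm (x * x') y := by
  obtain ⟨z, hz⟩ := h
  obtain ⟨z', hz'⟩ := h'
  refine ⟨z' * z, ?_⟩
  rw [mul_assoc, hz', mul_smul_comm, ← mul_assoc, hz, smul_mul_assoc, smul_smul, mul_assoc]

theorem pow_right (h : QComm x y) (n : ℕ) : QComm x (y ^ n) := by
  induction n with
  | zero => exact ⟨1, by simp⟩
  | succ n ih => rw [pow_succ]; exact ih.mul_right h

theorem mem (h : QComm x y) {P : Submodule ℂ (A t)} (u v : A t) (hP : u * (y * x) * v ∈ P) :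
    u * (x * y) * v ∈ P := by
  obtain ⟨z, hz⟩ := h
  rw [hz, mul_smul_comm, smul_mul_assoc]
  exact P.smul_mem z hP

end QComm

section qcomm
variable (t : ℂ)

theorem qcomm_a_b : QComm (gen t a) (gen t b) := ⟨t, rel_ab t⟩
theorem qcomm_a_c : QComm (gen t a) (gen t c) := ⟨t, rel_ac t⟩
theorem qcomm_c_b : QComm (gen t c) (gen t b) := ⟨-1, by rw [rel_bc]; simp⟩

variable [NeZero t]

theorem qcomm_b_a : QComm (gen t b) (gen t a) := ⟨t⁻¹, rel_ba t⟩
theorem qcomm_c_a : QComm (gen t c) (gen t a) := ⟨t⁻¹, rel_ca t⟩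
theorem qcomm_d_b : QComm (gen t d) (gen t b) := ⟨-t⁻¹, by rw [rel_db]; simp⟩
theorem qcomm_d_c : QComm (gen t d) (gen t c) := ⟨-t⁻¹, by rw [rel_dc]; simp⟩

theorem d_mul_a : gen t d * gen t a = gen t s - t⁻¹ • (gen t b * gen t c) := by
  rw [rel_da, ← rel_det]
  module

omit [NeZero t] in
theorem a_mul_d : gen t a * gen t d = gen t s - t • (gen t b * gen t c) := by
  rw [← rel_det]
  abel

theorem qcomm_s_a : QComm (gen t s) (gen t a) := by
  refine ⟨1, ?_⟩
  have h1 : gen t a * gen t d = gen t s - t • (gen t b * gen t c) := a_mul_d t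
  have h2 : gen t s = gen t d * gen t a + t⁻¹ • (gen t b * gen t c) := by rw [d_mul_a]; abel
  have h3 : gen t b * gen t c * gen t a = (t⁻¹ * t⁻¹) • (gen t a * (gen t b * gen t c)) := by
    rw [mul_assoc, rel_ca, mul_smul_comm, ← mul_assoc, rel_ba, smul_mul_assoc, smul_smul, mul_assoc]
  calc gen t s * gen t a
      = gen t a * gen t d * gen t a + t • (gen t b * gen t c * gen t a) := by
        rw [h1, sub_mul, smul_mul_assoc]; abel
    _ = gen t a * (gen t d * gen t a) + t⁻¹ • (gen t a * (gen t b * gen t c)) := by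
        rw [h3, mul_assoc, smul_smul, mul_inv_cancel_left₀ (NeZero.ne t)]
    _ = (1 : ℂ) • (gen t a * gen t s) := by rw [one_smul, h2, mul_add, mul_smul_comm]

theorem qcomm_s_d : QComm (gen t s) (gen t d) := by
  refine ⟨1, ?_⟩
  have h1 : gen t s = gen t a * gen t d + t • (gen t b * gen t c) := (rel_det t).symm
  have h2 : gen t s = gen t d * gen t a + t⁻¹ • (gen t b * gen t c) := by rw [d_mul_a]; abel
  have h3 : gen t b * gen t c * gen t d = (t * t) • (gen t d * (gen t b * gen t c)) := by
    rw [mul_assoc, rel_cd, mul_neg, mul_smul_comm, ← mul_assoc, rel_bd, neg_mul, smul_mul_assoc,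
      smul_neg, neg_neg, smul_smul, mul_assoc]
  calc gen t s * gen t d
      = gen t d * (gen t a * gen t d) + t⁻¹ • (gen t b * gen t c * gen t d) := by
        rw [h2, add_mul, smul_mul_assoc, mul_assoc]
    _ = gen t d * (gen t a * gen t d) + t • (gen t d * (gen t b * gen t c)) := by
        rw [h3, smul_smul, inv_mul_cancel_left₀ (NeZero.ne t)]
    _ = (1 : ℂ) • (gen t d * gen t s) := by rw [one_smul, h1, mul_add, mul_smul_comm]

theorem qcomm_s_b : QComm (gen t s) (gen t b) := by
  refine ⟨-1, ?_⟩
  rw [← rel_det, add_mul, mul_add, mul_assoc, rel_db, smul_mul_assoc, mul_assoc, rel_cb, mul_neg,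
    mul_neg, mul_smul_comm, mul_smul_comm, ← mul_assoc (gen t b) (gen t a), rel_ba, smul_mul_assoc,
    mul_assoc]
  module

theorem qcomm_s_c : QComm (gen t s) (gen t c) := by
  refine ⟨-1, ?_⟩
  rw [← rel_det, add_mul, mul_add, mul_assoc, rel_dc, smul_mul_assoc, mul_neg,
    mul_smul_comm, mul_smul_comm, ← mul_assoc (gen t c) (gen t a), rel_ca, smul_mul_assoc,
    mul_assoc (gen t a), ← mul_assoc (gen t c) (gen t b), rel_cb, neg_mul]
  module

end qcomm

/-- The monomial `a^i b^j c^k d^l σ^e`. -/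
def mon (t : ℂ) (i j k l e : ℕ) : A t :=
  gen t a ^ i * (gen t b ^ j * gen t c ^ k) * (gen t d ^ l * gen t s ^ e)

/-- The span of the ordered monomials `a^i b^j c^k σ^e` and `b^j c^k d^l σ^e` of degree at most `N`
in `a, b, c, d`. -/
def filt (t : ℂ) (N : ℕ) : Submodule ℂ (A t) :=
  Submodule.span ℂ {u | ∃ i j k l e : ℕ, (i = 0 ∨ l = 0) ∧ i + j + k + l ≤ N ∧ u = mon t i j k l e}

section filt
variable {t : ℂ}

theorem mon_mem {N i j k l : ℕ} (e : ℕ) (h : i = 0 ∨ l = 0) (hN : i + j + k + l ≤ N) :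
    mon t i j k l e ∈ filt t N :=
  Submodule.subset_span ⟨i, j, k, l, e, h, hN, rfl⟩

theorem filt_mono {M N : ℕ} (h : M ≤ N) : filt t M ≤ filt t N :=
  Submodule.span_mono fun _ ⟨i, j, k, l, e, h1, h2, h3⟩ => ⟨i, j, k, l, e, h1, h2.trans h, h3⟩

theorem one_mem_filt : (1 : A t) ∈ filt t 0 := by
  have := mon_mem (t := t) (N := 0) (i := 0) (j := 0) (k := 0) (l := 0) 0 (.inl rfl) le_rfl
  simpa [mon] using this

theorem mul_mem_filt_of_mon {x : A t} {M N : ℕ}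
    (h : ∀ i j k l e : ℕ, (i = 0 ∨ l = 0) → i + j + k + l ≤ N → x * mon t i j k l e ∈ filt t M)
    {u : A t} (hu : u ∈ filt t N) : x * u ∈ filt t M := by
  induction hu using Submodule.span_induction with
  | mem u hu =>
    obtain ⟨i, j, k, l, e, h1, h2, rfl⟩ := hu
    exact h i j k l e h1 h2
  | zero => simp
  | add u v _ _ hu hv => rw [mul_add]; exact add_mem hu hv
  | smul z u _ hu => rw [mul_smul_comm]; exact (filt t M).smul_mem z hu

theorem mul_s_pow_mem_filt {N : ℕ} (n : ℕ) {u : A t} (hu : u ∈ filt t N) :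
    u * gen t s ^ n ∈ filt t N := by
  induction hu using Submodule.span_induction with
  | mem u hu =>
    obtain ⟨i, j, k, l, e, h1, h2, rfl⟩ := hu
    have := mon_mem (t := t) (e + n) h1 h2
    simpa only [mon, mul_assoc, pow_add] using this
  | zero => simp
  | add u v _ _ hu hv => rw [add_mul]; exact add_mem hu hv
  | smul z u _ hu => rw [smul_mul_assoc]; exact (filt t N).smul_mem z hu

variable [NeZero t]

theorem b_mul_mem_filt {N : ℕ} {u : A t} (hu : u ∈ filt t N) : gen t b * u ∈ filt t (N + 1) := by
  refine mul_mem_filt_of_mon (fun i j k l e h hN => ?_) hu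
  have := ((qcomm_b_a t).pow_right i).mem (P := filt t (N + 1)) 1
    ((gen t b ^ j * gen t c ^ k) * (gen t d ^ l * gen t s ^ e)) (by
      have := mon_mem (t := t) (j := j + 1) (k := k) e h (show _ ≤ N + 1 by omega)
      simpa only [mon, mul_assoc, pow_succ', one_mul] using this)
  simpa only [mon, mul_assoc, one_mul] using this

theorem c_mul_mem_filt {N : ℕ} {u : A t} (hu : u ∈ filt t N) : gen t c * u ∈ filt t (N + 1) := by
  refine mul_mem_filt_of_mon (fun i j k l e h hN => ?_) hu
  have := (((qcomm_c_a t).pow_right i).mul_right ((qcomm_c_b t).pow_right j)).mem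
    (P := filt t (N + 1)) 1 (gen t c ^ k * (gen t d ^ l * gen t s ^ e)) (by
      have := mon_mem (t := t) (j := j) (k := k + 1) e h (show _ ≤ N + 1 by omega)
      simpa only [mon, mul_assoc, pow_succ', one_mul] using this)
  simpa only [mon, mul_assoc, one_mul] using this

theorem s_mul_mem_filt {N : ℕ} {u : A t} (hu : u ∈ filt t N) : gen t s * u ∈ filt t N := by
  refine mul_mem_filt_of_mon (fun i j k l e h hN => ?_) hu
  have := (((qcomm_s_a t).pow_right i).mul_right (((qcomm_s_b t).pow_right j).mul_right
    (((qcomm_s_c t).pow_right k).mul_right ((qcomm_s_d t).pow_right l)))).mem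
    (P := filt t N) 1 (gen t s ^ e) (by
      have := mon_mem (t := t) (e + 1) h hN
      simpa only [mon, mul_assoc, pow_succ', one_mul] using this)
  simpa only [mon, mul_assoc, one_mul] using this

theorem a_mul_mem_filt {N : ℕ} {u : A t} (hu : u ∈ filt t N) : gen t a * u ∈ filt t (N + 1) := by
  refine mul_mem_filt_of_mon (fun i j k l e h hN => ?_) hu
  obtain _ | l := l
  · have := mon_mem (t := t) (i := i + 1) (j := j) (k := k) e (.inr rfl)
      (show _ + 0 ≤ N + 1 by omega)
    simpa only [mon, mul_assoc, pow_succ'] using this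
  · obtain rfl : i = 0 := by omega
    have := (((qcomm_a_b t).pow_right j).mul_right ((qcomm_a_c t).pow_right k)).mem
      (P := filt t (N + 1)) 1 (gen t d ^ (l + 1) * gen t s ^ e) ?_
    · simpa only [mon, mul_assoc, one_mul, pow_zero] using this
    have e1 : 1 * (gen t b ^ j * gen t c ^ k * gen t a) * (gen t d ^ (l + 1) * gen t s ^ e) =
        gen t b ^ j * gen t c ^ k * (gen t s * gen t d ^ l) * gen t s ^ e -
          t • (gen t b ^ j * (gen t c ^ k * gen t b) * (gen t c * gen t d ^ l * gen t s ^ e)) := by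
      rw [pow_succ', one_mul, mul_assoc (gen t b ^ j * gen t c ^ k), mul_assoc (gen t d),
        ← mul_assoc (gen t a), a_mul_d, sub_mul, mul_sub, smul_mul_assoc, mul_smul_comm]
      simp only [mul_assoc]
    rw [e1]
    refine sub_mem (((qcomm_s_d t).pow_right l).mem _ _ ?_) (Submodule.smul_mem _ _ ?_)
    · have := mon_mem (t := t) (i := 0) (j := j) (k := k) (l := l) (e + 1) (.inl rfl)
        (show _ ≤ N + 1 by omega)
      simpa only [mon, mul_assoc, pow_succ', one_mul, pow_zero] using this
    · have hc : QComm (gen t c ^ k) (gen t b) := by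
        clear hN e1 hu
        induction k with
        | zero => exact ⟨1, by simp⟩
        | succ k ih => rw [pow_succ]; exact ih.mul_left (qcomm_c_b t)
      refine hc.mem _ _ ?_
      have := mon_mem (t := t) (i := 0) (j := j + 1) (k := k + 1) (l := l) e (.inl rfl)
        (show _ ≤ N + 1 by omega)
      simpa only [mon, mul_assoc, pow_succ, one_mul, pow_zero] using this

theorem d_mul_mem_filt {N : ℕ} {u : A t} (hu : u ∈ filt t N) : gen t d * u ∈ filt t (N + 1) := by
  refine mul_mem_filt_of_mon (fun i j k l e h hN => ?_) hu
  obtain _ | i := i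
  · have := (((qcomm_d_b t).pow_right j).mul_right ((qcomm_d_c t).pow_right k)).mem
      (P := filt t (N + 1)) 1 (gen t d ^ l * gen t s ^ e) (by
        have := mon_mem (t := t) (i := 0) (j := j) (k := k) (l := l + 1) e (.inl rfl)
          (show _ ≤ N + 1 by omega)
        simpa only [mon, mul_assoc, pow_succ', one_mul, pow_zero] using this)
    simpa only [mon, mul_assoc, one_mul, pow_zero] using this
  · obtain rfl : l = 0 := by omega
    have e1 : gen t d * mon t (i + 1) j k 0 e =
        1 * (gen t s * (gen t a ^ i * (gen t b ^ j * gen t c ^ k))) * gen t s ^ e -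
          t⁻¹ • (1 * ((gen t b * gen t c) * gen t a ^ i) *
            (gen t b ^ j * gen t c ^ k * gen t s ^ e)) := by
      rw [mon, pow_succ', one_mul, one_mul, mul_assoc (gen t a), mul_assoc (gen t a),
        ← mul_assoc (gen t d), d_mul_a, sub_mul, smul_mul_assoc, pow_zero, one_mul]
      simp only [mul_assoc]
    rw [e1]
    refine sub_mem (QComm.mem (((qcomm_s_a t).pow_right i).mul_right
      (((qcomm_s_b t).pow_right j).mul_right ((qcomm_s_c t).pow_right k))) _ _ ?_)
      (Submodule.smul_mem _ _ (QComm.mem (((qcomm_b_a t).pow_right i).mul_left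
        ((qcomm_c_a t).pow_right i)) _ _ ?_))
    · have := mon_mem (t := t) (i := i) (j := j) (k := k) (l := 0) (e + 1) (.inr rfl)
        (show _ ≤ N + 1 by omega)
      simpa only [mon, mul_assoc, pow_succ', one_mul, pow_zero] using this
    · have := ((qcomm_c_b t).pow_right j).mem (P := filt t (N + 1)) (gen t a ^ i * gen t b)
        (gen t c ^ k * gen t s ^ e) (by
          have := mon_mem (t := t) (i := i) (j := j + 1) (k := k + 1) (l := 0) e (.inr rfl)
            (show _ ≤ N + 1 by omega)
          simpa only [mon, mul_assoc, pow_succ', one_mul, pow_zero] using this)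
      simpa only [mul_assoc, one_mul] using this

theorem exists_mem_filt (x : A t) : ∃ N, x ∈ filt t N := by
  have key : ∀ x : A t, ∀ N, ∀ u ∈ filt t N, ∃ M, x * u ∈ filt t M := by
    intro x
    induction x using induct with
    | h0 z =>
      intro N u hu
      refine ⟨N, ?_⟩
      rw [← Algebra.smul_def]
      exact (filt t N).smul_mem z hu
    | h1 g =>
      intro N u hu
      cases g
      · exact ⟨_, a_mul_mem_filt hu⟩
      · exact ⟨_, b_mul_mem_filt hu⟩
      · exact ⟨_, c_mul_mem_filt hu⟩
      · exact ⟨_, d_mul_mem_filt hu⟩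
      · exact ⟨_, s_mul_mem_filt hu⟩
    | h2 x y hx hy =>
      intro N u hu
      obtain ⟨M, hM⟩ := hx N u hu
      obtain ⟨M', hM'⟩ := hy N u hu
      refine ⟨max M M', ?_⟩
      rw [add_mul]
      exact add_mem (filt_mono (le_max_left _ _) hM) (filt_mono (le_max_right _ _) hM')
    | h3 x y hx hy =>
      intro N u hu
      obtain ⟨M, hM⟩ := hy N u hu
      rw [mul_assoc]
      exact hx M _ hM
  simpa using key x 0 1 one_mem_filt

/-- The matrix elements of spin `n / 2` have degree at most `n`. -/
theorem rawM_mem_filt (ht : t⁻¹ ^ 2 ≠ 1) (p m j : ℕ) : rawM t p m j ∈ filt t (p + m) := by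
  have hθ : ∀ p m j N, rawM t p m j ∈ filt t N → theta t (rawM t p m j) ∈ filt t N := by
    intro p m j N h
    rw [(isRow_rawM 0 t ht p m).theta_apply]
    exact Submodule.smul_mem _ _ h
  induction p generalizing j with
  | zero =>
    induction m generalizing j with
    | zero =>
      obtain _ | j := j
      · simpa [rawM] using one_mem_filt
      · simp [rawM]
    | succ m ih =>
      obtain _ | j := j <;> rw [rawM]
      · exact c_mul_mem_filt (ih 0)
      · exact add_mem (c_mul_mem_filt (ih _))
          (Submodule.smul_mem _ _ (d_mul_mem_filt (hθ _ _ _ _ (ih j))))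
  | succ p ih =>
    rw [add_right_comm]
    obtain _ | j := j <;> rw [rawM]
    · exact a_mul_mem_filt (ih 0)
    · exact add_mem (a_mul_mem_filt (ih _))
        (Submodule.smul_mem _ _ (b_mul_mem_filt (hθ _ _ _ _ (ih j))))

/-- The ordered monomial of degree `n` with the same row and column weights as the matrix
element with the given label. -/
def monIdx (t : ℂ) (x : Idx) : A t :=
  mon t (x.1.2.2 + x.2 - x.1.1) (x.1.2.2 - (x.1.2.2 + x.2 - x.1.1))
    (x.2 - (x.1.2.2 + x.2 - x.1.1)) (x.1.1 - x.1.2.2 - x.2) x.1.2.1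

omit [NeZero t] in
theorem filt_le_span_monIdx (N : ℕ) :
    filt t N ≤ Submodule.span ℂ (Set.range fun x : {x : Idx // x.1.1 ≤ N} => monIdx t x) := by
  refine Submodule.span_le.2 ?_
  rintro _ ⟨i, j, k, l, e, h, hN, rfl⟩
  refine Submodule.subset_span ⟨⟨⟨⟨i + j + k + l, ⟨e % 2, Nat.mod_lt _ two_pos⟩,
    ⟨i + j, by omega⟩⟩, ⟨i + k, by simp only; omega⟩⟩, hN⟩, ?_⟩
  have he : gen t s ^ e = gen t s ^ (e % 2) := by
    conv_lhs => rw [← Nat.div_add_mod e 2, pow_add, pow_mul, pow_two, rel_sq, one_pow, one_mul]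
  simp only [monIdx, mon]
  rw [he]
  have h1 : i + j + (i + k) - (i + j + k + l) = i := by omega
  have h2 : i + j + k + l - (i + j) - (i + k) = l := by omega
  rw [h1, h2, Nat.add_sub_cancel_left, Nat.add_sub_cancel_left]

theorem finite_idx_le (N : ℕ) : Finite {x : Idx // x.1.1 ≤ N} := by
  refine Finite.of_injective (β := Fin (N + 1) × Fin 2 × Fin (N + 1) × Fin (N + 1))
    (fun x => (⟨x.1.1.1, by have := x.2; omega⟩, x.1.1.2.1,
      ⟨x.1.1.2.2, by have := x.2; have := x.1.1.2.2.2; omega⟩,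
      ⟨x.1.2, by have := x.2; have := x.1.2.2; omega⟩)) ?_
  rintro ⟨⟨⟨n, e, i⟩, j⟩, h⟩ ⟨⟨⟨n', e', i'⟩, j'⟩, h'⟩ H
  simp only [Prod.mk.injEq, Fin.mk.injEq] at H
  obtain ⟨rfl, rfl, h1, h2⟩ := H
  obtain rfl := Fin.ext h1
  obtain rfl := Fin.ext h2
  rfl

/-- The matrix elements span `𝒜`: in each degree they are as many as the ordered monomials, which
span, and they are linearly independent. -/
theorem span_rawEl {q : ℂ} (hq : q - q⁻¹ ≠ 0) (ht : ∀ n : ℕ, 0 < n → t ^ n ≠ 1) :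
    ⊤ ≤ Submodule.span ℂ (Set.range (rawEl t)) := by
  intro x _
  obtain ⟨N, hN⟩ := exists_mem_filt x
  have := finite_idx_le N
  have := Fintype.ofFinite {x : Idx // x.1.1 ≤ N}
  set S₁ := Submodule.span ℂ (Set.range fun x : {x : Idx // x.1.1 ≤ N} => rawEl t x) with hS₁
  set S₂ := Submodule.span ℂ (Set.range fun x : {x : Idx // x.1.1 ≤ N} => monIdx t x) with hS₂
  have h1 : S₁ ≤ filt t N := by
    refine Submodule.span_le.2 ?_
    rintro _ ⟨⟨⟨⟨n, e, i⟩, j⟩, hx⟩, rfl⟩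
    refine mul_s_pow_mem_filt _ (filt_mono ?_ (rawM_mem_filt (inv_pow_ne_one ht two_pos) _ _ _))
    have := i.2
    simp only at hx ⊢
    omega
  have h2 : filt t N ≤ S₂ := filt_le_span_monIdx N
  have h3 : Module.finrank ℂ S₁ = Fintype.card {x : Idx // x.1.1 ≤ N} :=
    finrank_span_eq_card
      ((linearIndependent_rawEl hq ht).comp _ Subtype.val_injective)
  have h4 : Module.finrank ℂ S₂ ≤ Fintype.card {x : Idx // x.1.1 ≤ N} :=
    finrank_range_le_card _
  have : FiniteDimensional ℂ S₂ := FiniteDimensional.span_of_finite ℂ (Set.finite_range _)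
  have h5 : S₁ = S₂ := Submodule.eq_of_le_of_finrank_le (h1.trans h2) (by rw [h3]; exact h4)
  have h6 : S₁ ≤ Submodule.span ℂ (Set.range (rawEl t)) := by
    refine Submodule.span_mono ?_
    rintro _ ⟨x, rfl⟩
    exact ⟨x, rfl⟩
  exact h6 (h5 ▸ h2 hN)

end filt

/-! ### Coordinates with respect to the normalized matrix elements -/

/-- The entries `(-1)^{ij} m_{ij} σ^s`, `0 ≤ j ≤ n`, of the row `(n, s, i)`; with this sign the
coefficients of `e` and `fk` do not depend on `i`. -/
def rowEl (t : ℂ) (r : ℕ → ℕ → ℂ) (β : Block) (j : ℕ) : A t :=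
  (-1 : ℂ) ^ ((β.2.2 : ℕ) * j) • (matElem t r β.1 β.2.2 j * gen t s ^ (β.2.1 : ℕ))

/-- The coefficient in `L_e(u_{j+1}) = eN n j u_j` on a normalized row. -/
def eN (q t : ℂ) (r : ℕ → ℕ → ℂ) (n j : ℕ) : ℂ := eC q t n j * (coef r n j / coef r n (j + 1))

/-- The coefficient in `L_{fk}(u_j) = fN n j u_{j+1}` on a normalized row. -/
def fN (t : ℂ) (r : ℕ → ℕ → ℂ) (n j : ℕ) : ℂ := fC t n j * (coef r n (j + 1) / coef r n j)

/-- The eigenvalue of `L_k` on the entry `u_j` of a row. -/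
def kN (t : ℂ) (n e j : ℕ) : ℂ := (-1) ^ (j + e) * t ^ (n - 2 * j : ℤ)

/-- The coordinates with respect to the basis of matrix elements, extended by zero to all `j`. -/
def rowCoord {t : ℂ} (b : Module.Basis Idx ℂ (A t)) (β : Block) (j : ℕ) : A t →ₗ[ℂ] ℂ :=
  if h : j < β.1 + 1 then b.coord ⟨β, ⟨j, h⟩⟩ else 0

section rows
variable {q t : ℂ} [NeZero t] {r : ℕ → ℕ → ℂ} (hr : ∀ n m, m ≤ n → r n m ≠ 0)
  (ht : ∀ n : ℕ, 0 < n → t ^ n ≠ 1)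

omit [NeZero t] in
theorem rowEl_eq (β : Block) (j : ℕ) : rowEl t r β j =
    ((-1) ^ ((β.2.2 : ℕ) * j) * (coef r β.1 β.2.2 / coef r β.1 j)) •
      (rawM t (β.1 - β.2.2) β.2.2 j * gen t s ^ (β.2.1 : ℕ)) := by
  rw [rowEl, matElem, smul_mul_assoc, smul_smul]

include hr in
theorem coef_ne_zero {n j : ℕ} (h : j ≤ n) : coef r n j ≠ 0 :=
  mul_ne_zero (pow_ne_zero _ Complex.I_ne_zero) (hr n j h)

include ht

theorem isRow_block (q : ℂ) (β : Block) :
    IsRow q t β.1 ((-1) ^ (β.2.2 : ℕ)) (rawM t (β.1 - β.2.2) β.2.2) := by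
  have := isRow_rawM q t (inv_pow_ne_one ht two_pos) (β.1 - β.2.2) β.2.2
  rwa [Nat.sub_add_cancel (Nat.lt_succ_iff.1 β.2.2.2)] at this

theorem K_rowEl (β : Block) (j : ℕ) : K t (rowEl t r β j) = kN t β.1 β.2.1 j • rowEl t r β j := by
  rw [rowEl_eq, map_smul, K_mul_s_pow, (isRow_block ht 0 β).K_apply, smul_mul_assoc, smul_smul,
    smul_smul, smul_smul, kN, pow_add]
  congr 1
  ring

theorem E_rowEl_zero (β : Block) : E q t (rowEl t r β 0) = 0 := by
  rw [rowEl_eq, map_smul, E_mul_s_pow, (isRow_block ht q β).E_zero, zero_mul, smul_zero]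

include hr

theorem E_rowEl_succ (β : Block) (j : ℕ) (hj : j ≤ β.1) :
    E q t (rowEl t r β (j + 1)) = eN q t r β.1 j • rowEl t r β j := by
  rw [rowEl_eq, rowEl_eq, map_smul, E_mul_s_pow, (isRow_block ht q β).E_succ, smul_mul_assoc,
    smul_smul, smul_smul, eN]
  congr 1
  have h1 := coef_ne_zero hr hj
  have h2 : ((-1 : ℂ) ^ (β.2.2 : ℕ)) * (-1) ^ (β.2.2 : ℕ) = 1 := by rw [← mul_pow]; simp
  have h3 : coef r β.1 j / coef r β.1 (j + 1) * (coef r β.1 β.2.2 / coef r β.1 j) =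
      coef r β.1 β.2.2 / coef r β.1 (j + 1) := by field_simp
  rw [mul_add, pow_add, mul_one]
  linear_combination ((-1) ^ (β.2.2 * j : ℕ) * (coef r β.1 β.2.2 / coef r β.1 (j + 1)) *
    eC q t β.1 j) * h2 - (eC q t β.1 j * (-1) ^ (β.2.2 * j : ℕ)) * h3

theorem F_rowEl (β : Block) (j : ℕ) (hj : j + 1 ≤ β.1) :
    F t (rowEl t r β j) = fN t r β.1 j • rowEl t r β (j + 1) := by
  rw [rowEl_eq, rowEl_eq, map_smul, F_mul_s_pow, (isRow_block ht 0 β).F_apply, smul_mul_assoc,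
    smul_smul, smul_smul, fN]
  congr 1
  have h1 := coef_ne_zero hr hj
  rw [mul_add, pow_add, mul_one]
  field_simp

omit hr in
theorem F_rowEl_last (β : Block) : F t (rowEl t r β β.1) = 0 := by
  rw [rowEl_eq, map_smul, F_mul_s_pow, (isRow_block ht 0 β).F_apply,
    (isRow_block ht 0 β).eq_zero _ (Nat.lt_succ_self _), smul_zero, zero_mul, smul_zero]

/-- The normalized matrix elements form a basis of `𝒜`. -/
theorem exists_basis (hq : q - q⁻¹ ≠ 0) :
    ∃ b : Module.Basis Idx ℂ (A t), ∀ x, b x = rowEl t r x.1 x.2 := by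
  refine ⟨(Module.Basis.mk (linearIndependent_rawEl hq ht) (span_rawEl hq ht)).isUnitSMul
    (w := fun x : Idx =>
      (-1) ^ ((x.1.2.2 : ℕ) * x.2) * (coef r x.1.1 x.1.2.2 / coef r x.1.1 x.2))
    (fun x => isUnit_iff_ne_zero.2 (mul_ne_zero (by simp) (div_ne_zero
      (coef_ne_zero hr (Nat.lt_succ_iff.1 x.1.2.2.2))
      (coef_ne_zero hr (Nat.lt_succ_iff.1 x.2.2))))), fun x => ?_⟩
  rw [Module.Basis.isUnitSMul_apply, Module.Basis.mk_apply, rowEl_eq, rawEl]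

end rows

section coordinates
variable {q t : ℂ} {r : ℕ → ℕ → ℂ} {b : Module.Basis Idx ℂ (A t)}
  (hb : ∀ x, b x = rowEl t r x.1 x.2)
include hb

theorem rowCoord_rowEl (β β' : Block) (k j : ℕ) (hj : j ≤ β'.1) :
    rowCoord b β k (rowEl t r β' j) = if β = β' ∧ k = j then 1 else 0 := by
  have h1 : rowEl t r β' j = b ⟨β', ⟨j, Nat.lt_succ_iff.2 hj⟩⟩ := (hb ⟨β', ⟨j, _⟩⟩).symm
  rw [rowCoord, h1]
  split_ifs with h2 h3 h3
  · obtain ⟨rfl, rfl⟩ := h3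
    simp
  · rw [Module.Basis.coord_apply, Module.Basis.repr_self, Finsupp.single_eq_of_ne]
    rintro h4
    apply h3
    cases h4
    exact ⟨rfl, rfl⟩
  · obtain ⟨rfl, rfl⟩ := h3
    omega
  · rfl

omit hb in
theorem rowCoord_ext {u : A t} (h : ∀ β : Block, ∀ k ≤ β.1, rowCoord b β k u = 0) : u = 0 := by
  refine b.repr.map_eq_zero_iff.1 (Finsupp.ext fun x => ?_)
  have := h x.1 x.2 (Nat.lt_succ_iff.1 x.2.2)
  rw [rowCoord, dif_pos x.2.2] at this
  exact this

/-- An element whose row components all lie in `P` lies in `P`. -/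
theorem mem_of_rows_mem {P : Submodule ℂ (A t)} {u : A t}
    (h : ∀ β : Block, ∑ j ∈ Finset.range (β.1 + 1), rowCoord b β j u • rowEl t r β j ∈ P) :
    u ∈ P := by
  rw [← b.linearCombination_repr u, Finsupp.linearCombination_apply, Finsupp.sigma_sum]
  refine Submodule.sum_mem _ fun β _ => ?_
  rw [Finsupp.sum_fintype _ _ fun j => zero_smul ℂ (b ⟨β, j⟩)]
  convert h β
  rw [Finset.sum_range]
  refine Finset.sum_congr rfl fun j _ => ?_
  rw [Finsupp.split_apply, hb, rowCoord, dif_pos j.2]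
  rfl

variable [NeZero t] (hr : ∀ n m, m ≤ n → r n m ≠ 0) (ht : ∀ n : ℕ, 0 < n → t ^ n ≠ 1)
include ht

theorem rowCoord_K (β : Block) (k : ℕ) (u : A t) :
    rowCoord b β k (K t u) = kN t β.1 β.2.1 k * rowCoord b β k u := by
  have : rowCoord b β k ∘ₗ (K t).toLinearMap = kN t β.1 β.2.1 k • rowCoord b β k := by
    refine b.ext fun ⟨β', j⟩ => ?_
    simp only [LinearMap.comp_apply, AlgHom.toLinearMap_apply, LinearMap.smul_apply, hb, K_rowEl ht,
      map_smul, rowCoord_rowEl hb _ _ _ _ (Nat.lt_succ_iff.1 j.2)]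
    split_ifs with h
    · rw [h.1, h.2]
    · simp
  exact LinearMap.congr_fun this u

include hr

theorem rowCoord_E (β : Block) (k : ℕ) (u : A t) :
    rowCoord b β k (E q t u) = eN q t r β.1 k * rowCoord b β (k + 1) u := by
  have : rowCoord b β k ∘ₗ E q t = eN q t r β.1 k • rowCoord b β (k + 1) := by
    refine b.ext fun ⟨β', j, hj⟩ => ?_
    obtain _ | j := j
    · simp [hb, E_rowEl_zero ht, rowCoord_rowEl hb]
    · simp only [LinearMap.comp_apply, LinearMap.smul_apply, hb,
        E_rowEl_succ hr ht β' j (by omega), map_smul, rowCoord_rowEl hb β β' k j (by omega),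
        rowCoord_rowEl hb _ _ _ _ (Nat.lt_succ_iff.1 hj), Nat.add_right_cancel_iff]
      split_ifs with h
      · rw [h.1, h.2]
      · simp
  exact LinearMap.congr_fun this u

theorem rowCoord_F_zero (β : Block) (u : A t) : rowCoord b β 0 (F t u) = 0 := by
  have : rowCoord b β 0 ∘ₗ F t = 0 := by
    refine b.ext fun ⟨β', j, hj⟩ => ?_
    rcases (Nat.lt_succ_iff.1 hj).lt_or_eq with h | rfl
    · simp [hb, F_rowEl hr ht β' j h, rowCoord_rowEl hb _ _ _ _ (show j + 1 ≤ β'.1 from h)]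
    · simp [hb, F_rowEl_last ht]
  exact LinearMap.congr_fun this u

theorem rowCoord_F_succ (β : Block) (k : ℕ) (hk : k + 1 ≤ β.1) (u : A t) :
    rowCoord b β (k + 1) (F t u) = fN t r β.1 k * rowCoord b β k u := by
  have : rowCoord b β (k + 1) ∘ₗ F t = fN t r β.1 k • rowCoord b β k := by
    refine b.ext fun ⟨β', j, hj⟩ => ?_
    rcases (Nat.lt_succ_iff.1 hj).lt_or_eq with h | rfl
    · simp only [LinearMap.comp_apply, LinearMap.smul_apply, hb,
        F_rowEl hr ht β' j h, map_smul, rowCoord_rowEl hb β β' _ _ (show j + 1 ≤ β'.1 from h),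
        rowCoord_rowEl hb _ _ _ _ (Nat.lt_succ_iff.1 hj), Nat.add_right_cancel_iff]
      split_ifs with h
      · rw [h.1, h.2]
      · simp
    · simp only [LinearMap.comp_apply, LinearMap.smul_apply, hb, F_rowEl_last ht, map_zero,
        rowCoord_rowEl hb _ _ _ _ le_rfl]
      rw [if_neg, smul_zero]
      rintro ⟨rfl, rfl⟩
      omega
  exact LinearMap.congr_fun this u

end coordinates

/-- The equations for the coordinates `y_0, …, y_n` of an element of the row `(n, s, i)` in the
kernel of `α e + β fk + γ (k - 1)`; here `e` is the exponent of `σ`. -/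
def Sys (q t : ℂ) (r : ℕ → ℕ → ℂ) (α β γ : ℂ) (n e : ℕ) (y : ℕ → ℂ) : Prop :=
  ∀ k ≤ n, α * (if k < n then eN q t r n k * y (k + 1) else 0) +
    β * (if 0 < k then fN t r n (k - 1) * y (k - 1) else 0) + γ * ((kN t n e k - 1) * y k) = 0

section invariants
variable {q t : ℂ} [NeZero t] {r : ℕ → ℕ → ℂ} {b : Module.Basis Idx ℂ (A t)}
  (hb : ∀ x, b x = rowEl t r x.1 x.2)
  (hr : ∀ n m, m ≤ n → r n m ≠ 0) (ht : ∀ n : ℕ, 0 < n → t ^ n ≠ 1) (α β γ : ℂ)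
include hb hr ht

/-- Left invariance is a system of linear equations for each row separately. -/
theorem mem_leftInvariants_iff_sys (u : A t) : u ∈ leftInvariants (xFun q t α β γ) ↔
    ∀ B : Block, Sys q t r α β γ B.1 B.2.1 (fun j => rowCoord b B j u) := by
  have key : ∀ (B : Block), ∀ k ≤ B.1, rowCoord b B k (α • E q t u + β • F t u + γ • (K t u - u)) =
      α * (if k < B.1 then eN q t r B.1 k * rowCoord b B (k + 1) u else 0) +
      β * (if 0 < k then fN t r B.1 (k - 1) * rowCoord b B (k - 1) u else 0) +
      γ * ((kN t B.1 B.2.1 k - 1) * rowCoord b B k u) := by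
    intro B k hk
    simp only [map_add, map_smul, map_sub, smul_eq_mul, rowCoord_K hb ht, rowCoord_E hb hr ht]
    have h1 : (if k < B.1 then eN q t r B.1 k * rowCoord b B (k + 1) u else 0) =
        eN q t r B.1 k * rowCoord b B (k + 1) u := by
      split_ifs with h
      · rfl
      · rw [rowCoord, dif_neg (by omega), LinearMap.zero_apply, mul_zero]
    have h2 : (if 0 < k then fN t r B.1 (k - 1) * rowCoord b B (k - 1) u else 0) =
        rowCoord b B k (F t u) := by
      obtain _ | k := k
      · rw [rowCoord_F_zero hb hr ht]; rfl
      · rw [rowCoord_F_succ hb hr ht _ _ hk]; rfl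
    rw [h1, h2]
    ring
  rw [mem_leftInvariants_xFun]
  constructor
  · intro h B k hk
    simp only
    rw [← key B k hk, h, map_zero]
  · intro h
    refine rowCoord_ext (b := b) fun B k hk => ?_
    rw [key B k hk]
    exact h B k hk

/-- A combination of the entries of a single row is left invariant as soon as its coefficients
solve the system of that row. -/
theorem row_mem_leftInvariants {B : Block} {y : ℕ → ℂ} (hy : Sys q t r α β γ B.1 B.2.1 y) :
    ∑ j ∈ Finset.range (B.1 + 1), y j • rowEl t r B j ∈ leftInvariants (xFun q t α β γ) := by
  have hc : ∀ (B' : Block), ∀ k ≤ B'.1, rowCoord b B' k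
      (∑ j ∈ Finset.range (B.1 + 1), y j • rowEl t r B j) = if B' = B then y k else 0 := by
    intro B' k hk
    rw [map_sum, Finset.sum_congr rfl fun j hj => by
      rw [map_smul, rowCoord_rowEl hb _ _ _ _ (Nat.lt_succ_iff.1 (Finset.mem_range.1 hj))]]
    split_ifs with h
    · subst h
      rw [Finset.sum_eq_single_of_mem k (Finset.mem_range.2 (Nat.lt_succ_iff.2 hk))]
      · simp
      · intro j _ hjk
        rw [if_neg (fun h => hjk h.2.symm), smul_zero]
    · exact Finset.sum_eq_zero fun j _ => by rw [if_neg (fun h' => h h'.1), smul_zero]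
  rw [mem_leftInvariants_iff_sys hb hr ht]
  intro B' k hk
  have h1 := hc B' k hk
  have h2 : k < B'.1 → _ := fun h => hc B' (k + 1) h
  have h3 := hc B' (k - 1) (by omega)
  by_cases hB : B' = B
  · subst hB
    simp only [if_true] at h1 h2 h3
    have := hy k hk
    simp only [h1, h3]
    by_cases hk' : k < B'.1
    · simpa only [if_pos hk', h2 hk'] using this
    · simpa only [if_neg hk'] using this
  · simp only [if_neg hB] at h1 h2 h3
    simp only [h1, h3]
    by_cases hk' : k < B'.1
    · simp [h2 hk']
    · simp [hk']

end invariants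

/-! ### The coefficients of the normalized basis -/

section coefficients
variable {q t : ℂ} {r : ℕ → ℕ → ℂ}

theorem qPoch_succ (u v : ℂ) (m : ℕ) : qPoch u v (m + 1) = qPoch u v m * (1 - u * v ^ m) :=
  Finset.prod_range_succ _ _

theorem qPoch_self_ne_zero {v : ℂ} (hv : ∀ n : ℕ, 0 < n → v ^ n ≠ 1) (m : ℕ) :
    qPoch v v m ≠ 0 := by
  refine Finset.prod_ne_zero_iff.2 fun k _ => sub_ne_zero.2 fun h => ?_
  rw [← pow_succ'] at h
  exact hv _ k.succ_pos h.symm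

theorem inv_sq_pow_ne_one (ht : ∀ n : ℕ, 0 < n → t ^ n ≠ 1) (n : ℕ) (hn : 0 < n) :
    (t⁻¹ ^ 2) ^ n ≠ 1 := by
  rw [← pow_mul]
  exact inv_pow_ne_one ht (by omega)

theorem root_ne_zero (ht : ∀ n : ℕ, 0 < n → t ^ n ≠ 1)
    (hr : ∀ n m : ℕ, m ≤ n → r n m ^ 2 = qBinom (t⁻¹ ^ 2) n m) (n m : ℕ) (h : m ≤ n) :
    r n m ≠ 0 := by
  intro h0
  have h1 := hr n m h
  have h2 := qPoch_self_ne_zero (inv_sq_pow_ne_one ht)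
  rw [h0, zero_pow two_ne_zero, qBinom, eq_comm] at h1
  exact div_ne_zero (h2 _) (mul_ne_zero (h2 _) (h2 _)) h1

/-- The quotient of two consecutive Gauss binomial coefficients. -/
theorem root_succ_sq (ht : ∀ n : ℕ, 0 < n → t ^ n ≠ 1)
    (hr : ∀ n m : ℕ, m ≤ n → r n m ^ 2 = qBinom (t⁻¹ ^ 2) n m) {n k d : ℕ} (h : k + 1 + d = n) :
    (1 - t⁻¹ ^ (2 * (k + 1))) * r n (k + 1) ^ 2 = (1 - t⁻¹ ^ (2 * (d + 1))) * r n k ^ 2 := by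
  have h2 := qPoch_self_ne_zero (inv_sq_pow_ne_one ht)
  rw [hr n _ (by omega), hr n _ (by omega), qBinom, qBinom, show n - (k + 1) = d by omega,
    show n - k = d + 1 by omega, pow_mul, pow_mul]
  generalize t⁻¹ ^ 2 = v at *
  have e1 := qPoch_succ v v k
  have e2 := qPoch_succ v v d
  rw [← pow_succ'] at e1 e2
  have h3 := h2 k
  have h4 := h2 d
  have h5 := h2 (k + 1)
  have h6 := h2 (d + 1)
  rw [mul_div_assoc', mul_div_assoc', div_eq_div_iff (mul_ne_zero h5 h4) (mul_ne_zero h3 h6), e1,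
    e2]
  ring

theorem aL_eq (ℓ e k : ℕ) : aL t ℓ e (k - ℓ) = kN t (2 * ℓ) e k - 1 := by
  rw [aL, kN]
  congr 2
  · rw [← zpow_natCast]
    congr 1
    push_cast
    ring
  · congr 1
    push_cast
    ring

theorem I_zpow_sub (i j : ℕ) :
    Complex.I ^ ((i : ℤ) - j) = Complex.I ^ i / Complex.I ^ j := by
  rw [zpow_sub₀ Complex.I_ne_zero, zpow_natCast, zpow_natCast]

variable [NeZero t] (ht : ∀ n : ℕ, 0 < n → t ^ n ≠ 1)
  (hr : ∀ n m : ℕ, m ≤ n → r n m ^ 2 = qBinom (t⁻¹ ^ 2) n m)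
include ht hr

/-- The two expressions contain `r_{k+1} / r_k` and its inverse; they agree since the quotient of
consecutive Gauss binomial coefficients is known. -/
theorem bL_eq {ℓ k : ℕ} (hk : k < 2 * ℓ) : bL q t r ℓ (k + 1 - ℓ) = eN q t r (2 * ℓ) k := by
  have ht0 := NeZero.ne t
  obtain ⟨d, hd⟩ : ∃ d, k + 1 + d = 2 * ℓ := ⟨2 * ℓ - (k + 1), by omega⟩
  have h1 : (ℓ : ℤ) - (k + 1 - ℓ) + 1 = (d + 1 : ℕ) := by push_cast; omega
  have h2 : (ℓ : ℤ) + (k + 1 - ℓ) - 1 = k := by ring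
  have h3 : (ℓ : ℤ) + (k + 1 - ℓ) = (k + 1 : ℕ) := by push_cast; ring
  have h4 : (k : ℤ) / 2 = (k / 2 : ℕ) := by norm_cast
  have h5 : ((k + 1 : ℕ) : ℤ) / 2 = ((k + 1) / 2 : ℕ) := by norm_cast
  have h6 : ((2 * ℓ : ℕ) : ℤ) - k = (d + 1 : ℕ) := by push_cast; omega
  have h7 : (k : ℤ) - (2 * ℓ : ℕ) = -(d + 1 : ℕ) := by push_cast; omega
  have h8 : t ^ (-2 * ((k + 1 : ℕ) : ℤ)) = t⁻¹ ^ (2 * (k + 1)) := by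
    rw [inv_pow, ← zpow_natCast, ← zpow_neg]; congr 1
  have h9 : (-1 : ℂ) ^ (d + 1) = (-1) ^ k := by
    rw [neg_one_pow_eq_pow_mod_two, neg_one_pow_eq_pow_mod_two (n := k)]
    congr 1
    omega
  have n0 := root_ne_zero ht hr (2 * ℓ) k (by omega)
  have n1 := root_ne_zero ht hr (2 * ℓ) (k + 1) (by omega)
  have key : (1 - t⁻¹ ^ (2 * (k + 1))) * (r (2 * ℓ) (k + 1) / r (2 * ℓ) k) =
      (1 - t⁻¹ ^ (2 * (d + 1))) * (r (2 * ℓ) k / r (2 * ℓ) (k + 1)) := by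
    rw [mul_div_assoc', mul_div_assoc', div_eq_div_iff n0 n1, mul_assoc, mul_assoc, ← pow_two,
      ← pow_two]
    exact root_succ_sq ht hr hd
  rw [bL, eN, eC, h1, h2, h3, h6, h7, Int.toNat_natCast, Int.toNat_natCast, h4, h5, I_zpow_sub, h8,
    key, coef, coef, zpow_natCast, zpow_natCast, zpow_neg, zpow_natCast, h9]
  have hI : Complex.I ^ ((k + 1) / 2) ≠ 0 := pow_ne_zero _ Complex.I_ne_zero
  have e1 : t ^ (d + 1) * (1 - t⁻¹ ^ (2 * (d + 1))) = t ^ (d + 1) - (t ^ (d + 1))⁻¹ := by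
    rw [mul_comm 2, pow_mul, inv_pow]
    have : t ^ (d + 1) ≠ 0 := pow_ne_zero _ ht0
    field_simp
  rw [← e1]
  field_simp

theorem cL_eq {ℓ k : ℕ} (hk : k < 2 * ℓ) : cL t r ℓ (k - ℓ) = fN t r (2 * ℓ) k := by
  have ht0 := NeZero.ne t
  obtain ⟨d, hd⟩ : ∃ d, k + 1 + d = 2 * ℓ := ⟨2 * ℓ - (k + 1), by omega⟩
  have h1 : (ℓ : ℤ) - (k - ℓ) = (d + 1 : ℕ) := by push_cast; omega
  have h2 : (ℓ : ℤ) + (k - ℓ) = k := by ring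
  have h3 : (k : ℤ) + 1 = (k + 1 : ℕ) := by push_cast; ring
  have h4 : (k : ℤ) / 2 = (k / 2 : ℕ) := by norm_cast
  have h5 : ((k + 1 : ℕ) : ℤ) / 2 = ((k + 1) / 2 : ℕ) := by norm_cast
  have h6 : ((2 * ℓ : ℕ) : ℤ) - k = (d + 1 : ℕ) := by push_cast; omega
  have h8 : t ^ (-2 * ((d + 1 : ℕ) : ℤ)) = t⁻¹ ^ (2 * (d + 1)) := by
    rw [inv_pow, ← zpow_natCast, ← zpow_neg]; congr 1
  have h9 : t ^ (-2 : ℤ) = t⁻¹ ^ 2 := by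
    rw [inv_pow, ← zpow_natCast, ← zpow_neg]; congr 1
  have n0 := root_ne_zero ht hr (2 * ℓ) k (by omega)
  have n1 := root_ne_zero ht hr (2 * ℓ) (k + 1) (by omega)
  have key : (1 - t⁻¹ ^ (2 * (d + 1))) * (r (2 * ℓ) k / r (2 * ℓ) (k + 1)) =
      (1 - t⁻¹ ^ (2 * (k + 1))) * (r (2 * ℓ) (k + 1) / r (2 * ℓ) k) := by
    rw [mul_div_assoc', mul_div_assoc', div_eq_div_iff n1 n0, mul_assoc, mul_assoc, ← pow_two,
      ← pow_two]
    exact (root_succ_sq ht hr hd).symm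
  rw [cL, fN, fC, h1, h2, h3, h6, Int.toNat_natCast, Int.toNat_natCast, h4, h5, I_zpow_sub, h8,
    key, coef, coef, zpow_natCast, zpow_natCast, h9]
  have hI : Complex.I ^ (k / 2) ≠ 0 := pow_ne_zero _ Complex.I_ne_zero
  field_simp

omit hr in
theorem eN_ne_zero (hq : q - q⁻¹ ≠ 0) (hr : ∀ n m, m ≤ n → r n m ≠ 0) {n k : ℕ} (h : k < n) :
    eN q t r n k ≠ 0 :=
  mul_ne_zero (eC_ne_zero hq ht h) (div_ne_zero (coef_ne_zero hr h.le) (coef_ne_zero hr h))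

omit hr in
theorem fN_ne_zero (hr : ∀ n m, m ≤ n → r n m ≠ 0) {n k : ℕ} (h : k < n) : fN t r n k ≠ 0 :=
  mul_ne_zero (fC_ne_zero ht n k) (div_ne_zero (coef_ne_zero hr h) (coef_ne_zero hr h.le))

omit hr in
theorem kN_eq_one {n e k : ℕ} (h : kN t n e k = 1) : n = 2 * k ∧ Even (k + e) := by
  have ht0 := NeZero.ne t
  have h1 : t ^ (2 * (n - 2 * k : ℤ)) = 1 := by
    have h2 : ((-1 : ℂ) ^ (k + e)) ^ 2 = 1 := by rw [← pow_mul, mul_comm, pow_mul]; simp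
    have := congrArg (· ^ 2) h
    simp only [kN, mul_pow, h2, one_mul, one_pow] at this
    rw [mul_comm, zpow_mul]
    exact_mod_cast this
  have h3 : (2 * (n - 2 * k : ℤ)).natAbs = 0 := by
    by_contra hne
    refine ht _ (Nat.pos_of_ne_zero hne) ?_
    rw [← zpow_natCast]
    rcases Int.natAbs_eq (2 * (n - 2 * k : ℤ)) with h4 | h4
    · rw [← h4, h1]
    · rw [← neg_eq_iff_eq_neg.2 h4, zpow_neg, h1, inv_one]
  have h5 : n = 2 * k := by omega
  refine ⟨h5, ?_⟩
  subst h5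
  rw [kN] at h
  by_contra hodd
  rw [Nat.not_even_iff_odd] at hodd
  rw [hodd.neg_one_pow] at h
  norm_num at h

end coefficients

/-! ### Solution of the systems of linear equations -/

section solve
variable {q t : ℂ} {r : ℕ → ℕ → ℂ} {α β γ : ℂ} {n e : ℕ}

theorem Sys.sub_smul {y w : ℕ → ℂ} (hy : Sys q t r α β γ n e y) (hw : Sys q t r α β γ n e w)
    (z : ℂ) : Sys q t r α β γ n e (fun k => y k - z * w k) := by
  intro k hk
  have h1 := hy k hk
  have h2 := hw k hk
  simp only at h1 h2 ⊢
  split_ifs at h1 h2 ⊢ <;> linear_combination h1 - z * h2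

variable [NeZero t] (ht : ∀ n : ℕ, 0 < n → t ^ n ≠ 1) (hr : ∀ n m, m ≤ n → r n m ≠ 0)
include ht hr

/-- For `γ = 0` the system couples coordinates of the same parity. The boundary equations force the
odd coordinates to vanish, and for odd `n` also the even ones. -/
theorem Sys.eq_zero_of_alpha_beta (hq : q - q⁻¹ ≠ 0) (hα : α ≠ 0) (hβ : β ≠ 0) {y : ℕ → ℂ}
    (hy : Sys q t r α β 0 n e y) (h0 : Even n → y 0 = 0) : ∀ k ≤ n, y k = 0 := by
  have up : ∀ k, k < n → (0 < k → y (k - 1) = 0) → y (k + 1) = 0 := by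
    intro k hk h
    have h1 := hy k hk.le
    rw [if_pos hk, zero_mul, add_zero] at h1
    have h2 : (if 0 < k then fN t r n (k - 1) * y (k - 1) else 0) = 0 := by
      split_ifs with h3
      · rw [h h3, mul_zero]
      · rfl
    rw [h2, mul_zero, add_zero] at h1
    exact ((mul_eq_zero.1 h1).resolve_left hα |> mul_eq_zero.1).resolve_left
      (eN_ne_zero ht hq hr hk)
  have down : ∀ k, 0 < k → k ≤ n → (k < n → y (k + 1) = 0) → y (k - 1) = 0 := by
    intro k hk hkn h
    have h1 := hy k hkn
    rw [if_pos hk, zero_mul, add_zero] at h1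
    have h2 : (if k < n then eN q t r n k * y (k + 1) else 0) = 0 := by
      split_ifs with h3
      · rw [h h3, mul_zero]
      · rfl
    rw [h2, mul_zero, zero_add] at h1
    exact ((mul_eq_zero.1 h1).resolve_left hβ |> mul_eq_zero.1).resolve_left
      (fN_ne_zero ht hr (by omega))
  -- the odd coordinates vanish from below
  have odd : ∀ k, 2 * k + 1 ≤ n → y (2 * k + 1) = 0 := by
    intro k
    induction k with
    | zero => exact fun hk => up 0 hk fun h => absurd h (lt_irrefl 0)
    | succ k ih => exact fun hk => up (2 * k + 2) hk fun _ => ih (by omega)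
  -- the even coordinates vanish from above if `n` is odd
  have y0 : y 0 = 0 := by
    rcases Nat.even_or_odd' n with ⟨m, rfl | rfl⟩
    · exact h0 (even_two_mul m)
    · have h1 : ∀ k ≤ m, y (2 * (m - k)) = 0 := by
        intro k
        induction k with
        | zero => exact fun _ => down (2 * m + 1) (by omega) le_rfl fun h => absurd h (lt_irrefl _)
        | succ k ih =>
          intro hk
          have := down (2 * (m - (k + 1)) + 1) (by omega) (by omega) fun _ => by
            have := ih (by omega)
            rwa [show 2 * (m - k) = 2 * (m - (k + 1)) + 1 + 1 by omega] at this
          exact this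
      have := h1 m le_rfl
      rwa [Nat.sub_self] at this
  have even : ∀ k, 2 * k ≤ n → y (2 * k) = 0 := by
    intro k
    induction k with
    | zero => exact fun _ => y0
    | succ k ih => exact fun hk => up (2 * k + 1) hk fun _ => ih (by omega)
  intro k hk
  rcases Nat.even_or_odd' k with ⟨m, rfl | rfl⟩
  · exact even m hk
  · exact odd m hk

omit [NeZero t] ht hr in
/-- For `α = 0` the system is triangular, solved from `k = 0` upwards. -/
theorem Sys.eq_zero_of_beta_gamma (hγ : γ ≠ 0) {y : ℕ → ℂ} (hy : Sys q t r 0 β γ n e y)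
    (h0 : ∀ k ≤ n, kN t n e k = 1 → y k = 0) : ∀ k ≤ n, y k = 0 := by
  intro k
  induction k with
  | zero =>
    intro hk
    by_cases h : kN t n e 0 = 1
    · exact h0 _ hk h
    · have h1 := hy 0 hk
      rw [zero_mul, zero_add, if_neg (lt_irrefl 0), mul_zero, zero_add] at h1
      exact ((mul_eq_zero.1 h1).resolve_left hγ |> mul_eq_zero.1).resolve_left (sub_ne_zero.2 h)
  | succ k ih =>
    intro hk
    by_cases h : kN t n e (k + 1) = 1
    · exact h0 _ hk h
    · have h1 := hy (k + 1) hk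
      rw [zero_mul, zero_add, if_pos k.succ_pos, Nat.add_sub_cancel, ih (by omega), mul_zero,
        mul_zero, zero_add] at h1
      exact ((mul_eq_zero.1 h1).resolve_left hγ |> mul_eq_zero.1).resolve_left (sub_ne_zero.2 h)

omit [NeZero t] ht hr in
/-- For `β = 0` the system is triangular, solved from `k = n` downwards. -/
theorem Sys.eq_zero_of_alpha_gamma (hγ : γ ≠ 0) {y : ℕ → ℂ} (hy : Sys q t r α 0 γ n e y)
    (h0 : ∀ k ≤ n, kN t n e k = 1 → y k = 0) : ∀ k ≤ n, y k = 0 := by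
  have key : ∀ d k, k + d = n → y k = 0 := by
    intro d
    induction d with
    | zero =>
      intro k hk
      by_cases h : kN t n e k = 1
      · exact h0 _ (by omega) h
      · have h1 := hy k (by omega)
        rw [zero_mul, add_zero, if_neg (by omega), mul_zero, zero_add] at h1
        exact ((mul_eq_zero.1 h1).resolve_left hγ |> mul_eq_zero.1).resolve_left (sub_ne_zero.2 h)
    | succ d ih =>
      intro k hk
      by_cases h : kN t n e k = 1
      · exact h0 _ (by omega) h
      · have h1 := hy k (by omega)
        rw [zero_mul, add_zero, if_pos (by omega), ih (k + 1) (by omega), mul_zero, mul_zero,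
          zero_add] at h1
        exact ((mul_eq_zero.1 h1).resolve_left hγ |> mul_eq_zero.1).resolve_left (sub_ne_zero.2 h)
  intro k hk
  exact key (n - k) k (by omega)

end solve

/-! ### The explicit solutions -/

section ratios
variable {q t : ℂ} [NeZero t] {r : ℕ → ℕ → ℂ} (ht : ∀ n : ℕ, 0 < n → t ^ n ≠ 1)
  (hr : ∀ n m : ℕ, m ≤ n → r n m ^ 2 = qBinom (t⁻¹ ^ 2) n m)
include ht hr

theorem bL_ne_zero (hq : q - q⁻¹ ≠ 0) {ℓ : ℕ} {j : ℤ} (h1 : -ℓ < j) (h2 : j ≤ ℓ) :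
    bL q t r ℓ j ≠ 0 := by
  have := bL_eq (q := q) ht hr (ℓ := ℓ) (k := (j + ℓ - 1).toNat) (by omega)
  rw [show (((j + ℓ - 1).toNat : ℕ) : ℤ) + 1 - ℓ = j by omega] at this
  rw [this]
  exact eN_ne_zero ht hq (root_ne_zero ht hr) (by omega)

omit hr in
theorem aL_ne_zero (ℓ s : ℕ) {j : ℤ} (h1 : j ≠ 0) (h2 : -ℓ ≤ j) : aL t ℓ s j ≠ 0 := by
  have := aL_eq (t := t) ℓ s (j + ℓ).toNat
  rw [show (((j + ℓ).toNat : ℕ) : ℤ) - ℓ = j by omega] at this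
  rw [this, sub_ne_zero]
  intro h
  have := (kN_eq_one ht h).1
  omega

theorem ratioAB_succ (hq : q - q⁻¹ ≠ 0) {ℓ k : ℕ} (hk : k + 1 ≤ ℓ) :
    ratioAB q t r ℓ (k + 1) * bL q t r ℓ (-ℓ + 2 * (k + 1)) =
      ratioAB q t r ℓ k * cL t r ℓ (-ℓ + 2 * k) := by
  have h0 : bL q t r ℓ (-ℓ + 2 * (k + 1)) ≠ 0 := bL_ne_zero ht hr hq (by omega) (by omega)
  rw [ratioAB, ratioAB, Finset.prod_range_succ, Finset.prod_Icc_succ_top (by omega)]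
  push_cast
  rw [div_mul_eq_mul_div, mul_div_mul_right _ _ h0]
  ring

omit hr in
theorem ratioBG_succ (ℓ s j : ℕ) : ratioBG t r ℓ s (j + 1) * aL t ℓ s (j + 1) =
    ratioBG t r ℓ s j * cL t r ℓ j := by
  have h0 : aL t ℓ s (j + 1) ≠ 0 := aL_ne_zero ht ℓ s (by omega) (by omega)
  rw [ratioBG, ratioBG, Finset.prod_range_succ, Finset.prod_Icc_succ_top (by omega)]
  push_cast
  rw [div_mul_eq_mul_div, mul_div_mul_right _ _ h0]
  ring

omit hr in
theorem ratioAG_succ {ℓ s n : ℕ} (hn : n + 1 ≤ ℓ) :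
    ratioAG q t r ℓ s (n + 1) * aL t ℓ s (-(n + 1)) = ratioAG q t r ℓ s n * bL q t r ℓ (-n) := by
  have h0 : aL t ℓ s (-(n + 1)) ≠ 0 := aL_ne_zero ht ℓ s (by omega) (by omega)
  rw [ratioAG, ratioAG, Finset.prod_range_succ, Finset.prod_Icc_succ_top (by omega)]
  push_cast
  rw [div_mul_eq_mul_div, mul_div_mul_right _ _ h0]
  ring

omit [NeZero t] ht hr in
theorem yAB_even (α β : ℂ) (ℓ k : ℕ) :
    yAB q t r α β ℓ ((2 * k : ℕ) - ℓ) = (-α⁻¹ * β) ^ k * ratioAB q t r ℓ k := by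
  rw [yAB, if_neg, show ((ℓ + ((2 * k : ℕ) - ℓ) : ℤ) / 2).toNat = k by omega]
  rw [add_sub_cancel, Int.not_odd_iff_even]
  exact ⟨k, by push_cast; ring⟩

omit [NeZero t] ht hr in
theorem yAB_odd (α β : ℂ) (ℓ k : ℕ) : yAB q t r α β ℓ ((2 * k + 1 : ℕ) - ℓ) = 0 := by
  rw [yAB, if_pos]
  rw [add_sub_cancel]
  exact ⟨k, by push_cast; ring⟩

theorem sys_yAB (hq : q - q⁻¹ ≠ 0) {α : ℂ} (hα : α ≠ 0) (β : ℂ) (ℓ e : ℕ) :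
    Sys q t r α β 0 (2 * ℓ) e (fun k => yAB q t r α β ℓ (k - ℓ)) := by
  intro k hk
  simp only
  rw [zero_mul, add_zero]
  rcases Nat.even_or_odd' k with ⟨m, rfl | rfl⟩
  · have h1 : yAB q t r α β ℓ ((2 * m + 1 : ℕ) - ℓ) = 0 := yAB_odd α β ℓ m
    have h2 : (if 0 < 2 * m then fN t r (2 * ℓ) (2 * m - 1) *
        yAB q t r α β ℓ ((2 * m - 1 : ℕ) - ℓ) else 0) = 0 := by
      split_ifs with h
      · rw [show 2 * m - 1 = 2 * (m - 1) + 1 by omega, yAB_odd, mul_zero]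
      · rfl
    rw [h1, h2]
    simp
  · rw [if_pos (by omega), if_pos (by omega), Nat.add_sub_cancel, yAB_even,
      show 2 * m + 1 + 1 = 2 * (m + 1) by ring, yAB_even, ← bL_eq ht hr (by omega),
      ← cL_eq ht hr (by omega)]
    have h1 := ratioAB_succ ht hr hq (show m + 1 ≤ ℓ by omega)
    rw [show ((2 * m + 1 : ℕ) : ℤ) + 1 - ℓ = -ℓ + 2 * (m + 1) by push_cast; ring,
      show ((2 * m : ℕ) : ℤ) - ℓ = -ℓ + 2 * m by push_cast; ring]
    have h2 : α * α⁻¹ = 1 := mul_inv_cancel₀ hα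
    rw [pow_succ]
    linear_combination (α * (-α⁻¹ * β) ^ m * (-α⁻¹ * β)) * h1 -
      (-α⁻¹ * β) ^ m * β * ratioAB q t r ℓ m * cL t r ℓ (-ℓ + 2 * m) * h2

omit [NeZero t] ht hr in
theorem yAB_pivot (α β : ℂ) (ℓ : ℕ) : yAB q t r α β ℓ ((0 : ℕ) - ℓ) = 1 := by
  have := yAB_even (q := q) (t := t) (r := r) α β ℓ 0
  simpa [ratioAB] using this

theorem sys_yBG (β : ℂ) {γ : ℂ} (hγ : γ ≠ 0) {ℓ e : ℕ} (he : Even (ℓ + e)) :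
    Sys q t r 0 β γ (2 * ℓ) e (fun k => yBG t r β γ ℓ e (k - ℓ)) := by
  have low : ∀ m : ℕ, m < ℓ → yBG t r β γ ℓ e (m - ℓ) = 0 := fun m hm => if_pos (by omega)
  intro k hk
  simp only
  rw [zero_mul, zero_add]
  rcases lt_trichotomy k ℓ with h | rfl | h
  · rw [low k h, low (k - 1) (by omega)]
    simp
  · have h1 : kN t (2 * k) e k = 1 := by simp [kN, he.neg_one_pow]
    have h2 : (if 0 < k then fN t r (2 * k) (k - 1) * yBG t r β γ k e ((k - 1 : ℕ) - k) else 0) =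
        0 := by
      split_ifs with h
      · rw [low (k - 1) (by omega), mul_zero]
      · rfl
    rw [h1, h2]
    simp
  · obtain ⟨j, rfl⟩ : ∃ j, k = ℓ + j + 1 := ⟨k - ℓ - 1, by omega⟩
    rw [if_pos (by omega), Nat.add_sub_cancel, yBG, yBG, if_neg (by omega), if_neg (by omega),
      ← cL_eq ht hr (by omega), ← aL_eq]
    rw [show ((ℓ + j + 1 : ℕ) : ℤ) - ℓ = (j + 1 : ℕ) by push_cast; ring,
      show ((ℓ + j : ℕ) : ℤ) - ℓ = j by push_cast; ring, Int.toNat_natCast, Int.toNat_natCast,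
      pow_succ]
    have h1 := ratioBG_succ (r := r) ht ℓ e j
    have h2 : γ * γ⁻¹ = 1 := mul_inv_cancel₀ hγ
    push_cast
    linear_combination (γ * (-β * γ⁻¹) ^ j * (-β * γ⁻¹)) * h1 -
      ((-β * γ⁻¹) ^ j * β * ratioBG t r ℓ e j * cL t r ℓ j) * h2

omit [NeZero t] ht hr in
theorem yBG_pivot (β γ : ℂ) (ℓ e : ℕ) : yBG t r β γ ℓ e (ℓ - ℓ) = 1 := by
  simp [yBG, ratioBG]

theorem sys_yAG (α : ℂ) {γ : ℂ} (hγ : γ ≠ 0) {ℓ e : ℕ} (he : Even (ℓ + e)) :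
    Sys q t r α 0 γ (2 * ℓ) e (fun k => yAG q t r α γ ℓ e (k - ℓ)) := by
  have high : ∀ m : ℕ, ℓ < m → yAG q t r α γ ℓ e (m - ℓ) = 0 := fun m hm => if_pos (by omega)
  intro k hk
  simp only
  rw [zero_mul, add_zero]
  rcases lt_trichotomy k ℓ with h | rfl | h
  · obtain ⟨n, hn⟩ : ∃ n, k + n + 1 = ℓ := ⟨ℓ - k - 1, by omega⟩
    rw [if_pos (by omega), yAG, yAG, if_neg (by omega), if_neg (by omega),
      ← bL_eq ht hr (by omega), ← aL_eq]
    rw [show -(((k + 1 : ℕ) : ℤ) - ℓ) = n by push_cast; omega,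
      show -((k : ℤ) - ℓ) = (n + 1 : ℕ) by push_cast; omega,
      show (k : ℤ) + 1 - ℓ = -n by omega, show (k : ℤ) - ℓ = -(n + 1) by omega,
      Int.toNat_natCast, Int.toNat_natCast, pow_succ]
    have h1 := ratioAG_succ (q := q) (r := r) (s := e) ht (show n + 1 ≤ ℓ by omega)
    have h2 : γ * γ⁻¹ = 1 := mul_inv_cancel₀ hγ
    linear_combination (γ * (-α * γ⁻¹) ^ n * (-α * γ⁻¹)) * h1 -
      ((-α * γ⁻¹) ^ n * α * ratioAG q t r ℓ e n * bL q t r ℓ (-n)) * h2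
  · have h1 : kN t (2 * k) e k = 1 := by simp [kN, he.neg_one_pow]
    rw [h1, high (k + 1) (by omega)]
    simp
  · rw [high k h, high (k + 1) (by omega)]
    simp

omit [NeZero t] ht hr in
theorem yAG_pivot (α γ : ℂ) (ℓ e : ℕ) : yAG q t r α γ ℓ e (ℓ - ℓ) = 1 := by
  simp [yAG, ratioAG]

end ratios

/-! ### Closed forms of the quotients of products -/

theorem exists_root {x p y : ℂ} (hp : p ≠ 0) (h : x ^ 2 = p ^ 2 * y) :
    ∃ ρ : ℂ, ρ ^ 2 = y ∧ x = p * ρ := by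
  refine ⟨x / p, ?_, by field_simp⟩
  rw [div_pow, h]
  field_simp

/-- The inductive step for a square `x ^ 2 = p ^ 2 * y` when `x`, `p`, `y` are multiplied by
`c / b`, `μ`, `ν`. -/
theorem sq_step {x x' b c p p' y y' : ℂ} (hb : b ≠ 0) (h : x' * b = x * c)
    (hx : x ^ 2 = p ^ 2 * y) {μ ν : ℂ} (hp : p' = p * μ) (hy : y' = y * ν)
    (hμν : μ ^ 2 * ν * b ^ 2 = c ^ 2) : x' ^ 2 = p' ^ 2 * y' := by
  refine mul_right_cancel₀ (pow_ne_zero 2 hb) ?_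
  rw [← mul_pow, h, mul_pow, hx, hp, hy, ← hμν]
  ring

section closed
variable {q t : ℂ} [NeZero t] {r : ℕ → ℕ → ℂ} (hqt : t ^ 2 = -q)
  (ht : ∀ n : ℕ, 0 < n → t ^ n ≠ 1)
  (hr : ∀ n m : ℕ, m ≤ n → r n m ^ 2 = qBinom (t⁻¹ ^ 2) n m)
include hqt ht hr

theorem cL_sq {ℓ k d : ℕ} (h : k + 1 + d = 2 * ℓ) : cL t r ℓ (k - ℓ) ^ 2 =
    (Complex.I ^ (((k + 1 : ℕ) : ℤ) / 2 - (k : ℤ) / 2)) ^ 2 *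
      (((-q) ^ (d + 1) - 1) * ((-q) ^ (k + 1) - 1) / ((-q) ^ (k + 1) * (1 + q⁻¹) ^ 2)) := by
  have h1 : (k : ℤ) / 2 = (k / 2 : ℕ) := by norm_cast
  have h2 : ((k + 1 : ℕ) : ℤ) / 2 = ((k + 1) / 2 : ℕ) := by norm_cast
  have h3 : ((2 * ℓ : ℕ) : ℤ) - k = (d + 1 : ℕ) := by push_cast; omega
  have n0 := root_ne_zero ht hr (2 * ℓ) k (by omega)
  have n1 := root_ne_zero ht hr (2 * ℓ) (k + 1) (by omega)
  have hI := pow_ne_zero (k / 2) Complex.I_ne_zero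
  have hsgn : ((-1 : ℂ) ^ (k + 1)) ^ 2 = 1 := by rw [← pow_mul, mul_comm, pow_mul]; simp
  have hv : ∀ m : ℕ, t⁻¹ ^ (2 * m) = ((-q) ^ m)⁻¹ := fun m => by rw [pow_mul, inv_pow, hqt, inv_pow]
  have hv1 : t⁻¹ ^ 2 = (-q)⁻¹ := by rw [inv_pow, hqt]
  have hu : ∀ m : ℕ, 0 < m → (-q) ^ m - 1 ≠ 0 := fun m hm => by
    rw [← hqt, ← pow_mul, sub_ne_zero]
    exact ht _ (by omega)
  have hq0 : -q ≠ 0 := hqt ▸ pow_ne_zero 2 (NeZero.ne t)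
  have hU := pow_ne_zero (k + 1) hq0
  have hV := pow_ne_zero (d + 1) hq0
  have key := root_succ_sq ht hr h
  rw [hv, hv] at key
  have hT : (t ^ (d + 1)) ^ 2 = (-q) ^ (d + 1) := by rw [← pow_mul, mul_comm, pow_mul, hqt]
  have hq1 : -q - 1 ≠ 0 := by simpa using hu 1 one_pos
  have hq2 : 1 + q⁻¹ ≠ 0 := by
    intro h0
    apply hq1
    have : q ≠ 0 := neg_ne_zero.1 hq0
    field_simp at h0
    linear_combination -h0
  rw [cL_eq ht hr (by omega), fN, fC, coef, coef, h1, h2, h3, I_zpow_sub, zpow_natCast, hv, hv1]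
  have e1 : (1 - (-q)⁻¹) = 1 + q⁻¹ := by rw [inv_neg]; ring
  rw [e1]
  have hu1 := hu (k + 1) k.succ_pos
  generalize (-q) ^ (k + 1) = U at *
  generalize (-q) ^ (d + 1) = V at *
  have e2 : r (2 * ℓ) (k + 1) ^ 2 = (V - 1) / V * (U / (U - 1)) * r (2 * ℓ) k ^ 2 := by
    field_simp
    field_simp at key
    linear_combination key
  simp only [mul_pow, div_pow, hsgn, hT, e2]
  field_simp

theorem bL_sq {ℓ k d : ℕ} (h : k + 1 + d = 2 * ℓ) (hq : q - q⁻¹ ≠ 0) :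
    bL q t r ℓ (k + 1 - ℓ) ^ 2 =
      (Complex.I ^ ((k : ℤ) / 2 - ((k + 1 : ℕ) : ℤ) / 2)) ^ 2 *
      (((-q) ^ (d + 1) - 1) * ((-q) ^ (k + 1) - 1) / ((-q) ^ (k + 1) * (q - q⁻¹) ^ 2)) := by
  have h1 : (k : ℤ) / 2 = (k / 2 : ℕ) := by norm_cast
  have h2 : ((k + 1 : ℕ) : ℤ) / 2 = ((k + 1) / 2 : ℕ) := by norm_cast
  have h3 : ((2 * ℓ : ℕ) : ℤ) - k = (d + 1 : ℕ) := by push_cast; omega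
  have h4 : (k : ℤ) - (2 * ℓ : ℕ) = -(d + 1 : ℕ) := by push_cast; omega
  have n0 := root_ne_zero ht hr (2 * ℓ) k (by omega)
  have n1 := root_ne_zero ht hr (2 * ℓ) (k + 1) (by omega)
  have hI := pow_ne_zero ((k + 1) / 2) Complex.I_ne_zero
  have hsgn : ((-1 : ℂ) ^ k) ^ 2 = 1 := by rw [← pow_mul, mul_comm, pow_mul]; simp
  have hv : ∀ m : ℕ, t⁻¹ ^ (2 * m) = ((-q) ^ m)⁻¹ := fun m => by rw [pow_mul, inv_pow, hqt, inv_pow]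
  have hu : ∀ m : ℕ, 0 < m → (-q) ^ m - 1 ≠ 0 := fun m hm => by
    rw [← hqt, ← pow_mul, sub_ne_zero]
    exact ht _ (by omega)
  have hq0 : -q ≠ 0 := hqt ▸ pow_ne_zero 2 (NeZero.ne t)
  have hU := pow_ne_zero (k + 1) hq0
  have hV := pow_ne_zero (d + 1) hq0
  have key := root_succ_sq ht hr h
  rw [hv, hv] at key
  have hT : (t ^ (d + 1)) ^ 2 = (-q) ^ (d + 1) := by rw [← pow_mul, mul_comm, pow_mul, hqt]
  rw [bL_eq ht hr (by omega), eN, eC, coef, coef, h1, h2, h3, h4, I_zpow_sub, zpow_neg,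
    zpow_natCast]
  have hu1 := hu (k + 1) k.succ_pos
  have hu2 := hu (d + 1) d.succ_pos
  have hT0 := pow_ne_zero (d + 1) (NeZero.ne t)
  generalize t ^ (d + 1) = T at *
  generalize (-q) ^ (k + 1) = U at *
  rw [← hT] at *
  clear hT
  have e2 : r (2 * ℓ) (k + 1) ^ 2 = (T ^ 2 - 1) / T ^ 2 * (U / (U - 1)) * r (2 * ℓ) k ^ 2 := by
    field_simp
    field_simp at key
    linear_combination key
  have e3 : T - T⁻¹ = (T ^ 2 - 1) / T := by field_simp
  simp only [mul_pow, div_pow, hsgn, e2, e3]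
  generalize q - q⁻¹ = p at *
  field_simp

omit [NeZero t] hqt ht hr in
theorem neg_q_pow_even (m : ℕ) : (-q) ^ (2 * m) = q ^ (2 * m) := (even_two_mul m).neg_pow q

theorem ratioAB_closed (hq : ∀ n : ℕ, 0 < n → q ^ n ≠ 1) (hqq : q - q⁻¹ ≠ 0) (ℓ k : ℕ)
    (hk : k ≤ ℓ) : ∃ ρ : ℂ,
      ρ ^ 2 = qPoch (q ^ (-2 * ℓ : ℤ)) (q ^ 2) k * qPoch (-q) (q ^ 2) k /
        (qPoch (-q ^ (-2 * ℓ + 1 : ℤ)) (q ^ 2) k * qPoch (q ^ 2) (q ^ 2) k) ∧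
      ratioAB q t r ℓ k = Complex.I ^ k * q ^ k * (1 - q) ^ k * ρ := by
  have hq0 : q ≠ 0 := neg_ne_zero.1 (hqt ▸ pow_ne_zero 2 (NeZero.ne t))
  have hq1 : 1 - q ≠ 0 := sub_ne_zero.2 (by simpa using (hq 1 one_pos).symm)
  have hq2 : q + 1 ≠ 0 := by
    intro h
    apply hq 2 two_pos
    linear_combination (q - 1) * h
  refine exists_root (by simp [hq0, hq1]) ?_
  induction k with
  | zero => simp [ratioAB, qPoch]
  | succ k ih =>
    obtain ⟨m, hm⟩ : ∃ m, k + 1 + m = ℓ := ⟨ℓ - (k + 1), by omega⟩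
    have hX : q ^ (-2 * ℓ : ℤ) * (q ^ 2) ^ k = (q ^ (2 * (m + 1)))⁻¹ := by
      rw [← pow_mul, ← zpow_natCast, ← zpow_natCast, ← zpow_neg, ← zpow_add₀ hq0]
      congr 1
      push_cast
      omega
    have hX' : -q ^ (-2 * ℓ + 1 : ℤ) * (q ^ 2) ^ k = -(q * (q ^ (2 * (m + 1)))⁻¹) := by
      rw [zpow_add_one₀ hq0, ← hX]
      ring
    refine sq_step (bL_ne_zero ht hr hqq (by omega) (by omega))
      (ratioAB_succ ht hr hqq hk) (ih (by omega)) (μ := Complex.I * q * (1 - q))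
      (ν := (1 - (q ^ (2 * (m + 1)))⁻¹) * (1 + q * q ^ (2 * k)) /
        ((1 + q * (q ^ (2 * (m + 1)))⁻¹) * (1 - q ^ 2 * q ^ (2 * k)))) (by ring) ?_ ?_
    · rw [qPoch_succ, qPoch_succ, qPoch_succ, qPoch_succ, hX, hX', ← pow_mul, div_mul_div_comm]
      congr 1 <;> ring
    · have hb := bL_sq hqt ht hr (ℓ := ℓ) (k := 2 * k + 1) (d := 2 * m) (by omega) hqq
      have hc := cL_sq hqt ht hr (ℓ := ℓ) (k := 2 * k) (d := 2 * m + 1) (by omega)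
      rw [show ((2 * k + 1 : ℕ) : ℤ) + 1 - ℓ = -ℓ + 2 * (k + 1) by push_cast; ring,
        show ((2 * k + 1 : ℕ) : ℤ) / 2 - ((2 * k + 1 + 1 : ℕ) : ℤ) / 2 = -1 by push_cast; omega,
        zpow_neg_one, inv_pow, Complex.I_sq, show 2 * k + 1 + 1 = 2 * (k + 1) by ring,
        neg_q_pow_even, pow_succ (-q) (2 * m), neg_q_pow_even] at hb
      rw [show ((2 * k : ℕ) : ℤ) - ℓ = -ℓ + 2 * k by push_cast; ring,
        show ((2 * k + 1 : ℕ) : ℤ) / 2 - ((2 * k : ℕ) : ℤ) / 2 = 0 by push_cast; omega,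
        zpow_zero, one_pow, one_mul, show 2 * m + 1 + 1 = 2 * (m + 1) by ring,
        neg_q_pow_even, pow_succ (-q) (2 * k), neg_q_pow_even] at hc
      rw [hb, hc]
      have hX0 : q ^ (2 * m) ≠ 0 := pow_ne_zero _ hq0
      have hY0 : q ^ (2 * k) ≠ 0 := pow_ne_zero _ hq0
      have e1 : q ^ (2 * (m + 1)) = q ^ (2 * m) * q ^ 2 := by ring
      have e2 : q ^ (2 * (k + 1)) = q ^ (2 * k) * q ^ 2 := by ring
      have n1 : 1 + q * q ^ (2 * m) ≠ 0 := by
        intro h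
        apply hq (2 * (2 * m + 1)) (by omega)
        rw [mul_comm 2, pow_mul, pow_succ q (2 * m)]
        linear_combination (q ^ (2 * m) * q - 1) * h
      have n2 : 1 - q ^ 2 * q ^ (2 * k) ≠ 0 := by
        rw [← pow_add]
        exact sub_ne_zero.2 (hq _ (by omega)).symm
      rw [e1, e2, mul_pow, mul_pow, Complex.I_sq]
      generalize q ^ (2 * m) = X at *
      generalize q ^ (2 * k) = Y at *
      have f1 : q - q⁻¹ = -((1 - q) * (q + 1) / q) := by field_simp; ring
      have f2 : 1 + q⁻¹ = (q + 1) / q := by field_simp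
      have f3 : 1 + q * (X * q ^ 2)⁻¹ = (1 + q * X) / (X * q) := by field_simp; ring
      have f4 : 1 - (X * q ^ 2)⁻¹ = (X * q ^ 2 - 1) / (X * q ^ 2) := by field_simp
      have f5 : Y * q ^ 2 - 1 = -(1 - q ^ 2 * Y) := by ring
      have f6 : X * -q - 1 = -(1 + q * X) := by ring
      rw [f1, f2, f3, f4, f5, f6]
      field_simp
      ring

theorem ratioBG_closed (hq : ∀ n : ℕ, 0 < n → q ^ n ≠ 1) (ℓ s j : ℕ) (he : Even (ℓ + s))
    (hj : j ≤ ℓ) : ∃ ρ : ℂ,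
      ρ ^ 2 = qPoch ((-q) ^ (-ℓ : ℤ)) (-q) j * qPoch ((-q) ^ (ℓ + 1)) (-q) j ∧
      ratioBG t r ℓ s j =
        (-1) ^ ((ℓ + 1) * j) * Complex.I ^ ((ℓ + j) / 2 - ℓ / 2 + j : ℤ) * q ^ j * ρ /
          ((t - t⁻¹) ^ j * qPoch q q j) := by
  have ht0 := NeZero.ne t
  have hq0 : q ≠ 0 := neg_ne_zero.1 (hqt ▸ pow_ne_zero 2 ht0)
  have hq2 : q + 1 ≠ 0 := by
    intro h
    apply hq 2 two_pos
    linear_combination (q - 1) * h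
  have htt : (t - t⁻¹) ^ 2 = -((q + 1) ^ 2 / q) := by
    have : (t - t⁻¹) ^ 2 = t ^ 2 - 2 + (t ^ 2)⁻¹ := by field_simp; ring
    rw [this, hqt]
    field_simp
    ring
  have htt0 : t - t⁻¹ ≠ 0 := by
    intro h
    rw [h] at htt
    have : -((q + 1) ^ 2 / q) ≠ 0 := neg_ne_zero.2 (div_ne_zero (pow_ne_zero 2 hq2) hq0)
    exact this (by rw [← htt]; simp)
  have hP := qPoch_self_ne_zero hq
  suffices h : ratioBG t r ℓ s j ^ 2 = ((-1) ^ ((ℓ + 1) * j) *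
      Complex.I ^ ((ℓ + j) / 2 - ℓ / 2 + j : ℤ) * q ^ j / ((t - t⁻¹) ^ j * qPoch q q j)) ^ 2 *
      (qPoch ((-q) ^ (-ℓ : ℤ)) (-q) j * qPoch ((-q) ^ (ℓ + 1)) (-q) j) by
    obtain ⟨ρ, h1, h2⟩ := exists_root (div_ne_zero (by simp [hq0, zpow_ne_zero, Complex.I_ne_zero])
      (mul_ne_zero (pow_ne_zero _ htt0) (hP j))) h
    exact ⟨ρ, h1, by rw [h2]; ring⟩
  induction j with
  | zero => simp [ratioBG, qPoch]
  | succ j ih =>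
    obtain ⟨d, hd⟩ : ∃ d, j + 1 + d = ℓ := ⟨ℓ - (j + 1), by omega⟩
    have hu0 : -q ≠ 0 := neg_ne_zero.2 hq0
    have hW : (-q) ^ (-ℓ : ℤ) * (-q) ^ j = ((-q) ^ (d + 1))⁻¹ := by
      rw [← zpow_natCast, ← zpow_natCast, ← zpow_neg, ← zpow_add₀ hu0]
      congr 1
      push_cast
      omega
    have hZ : (-q) ^ (ℓ + 1) * (-q) ^ j = (-q) ^ (ℓ + j + 1) := by
      rw [← pow_add]
      congr 1
      omega
    refine sq_step (aL_ne_zero ht ℓ s (by omega) (by omega)) (ratioBG_succ ht ℓ s j)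
      (ih (by omega)) (μ := (-1) ^ (ℓ + 1) *
        Complex.I ^ (((ℓ + j + 1 : ℕ) : ℤ) / 2 - ((ℓ + j : ℕ) : ℤ) / 2) * Complex.I * q /
        ((t - t⁻¹) * (1 - q * q ^ j)))
      (ν := (1 - ((-q) ^ (d + 1))⁻¹) * (1 - (-q) ^ (ℓ + j + 1))) ?_ ?_ ?_
    · rw [show ((ℓ : ℤ) + (j + 1 : ℕ)) / 2 - ℓ / 2 + (j + 1 : ℕ) =
        ((ℓ + j) / 2 - ℓ / 2 + j) + ((((ℓ + j + 1 : ℕ) : ℤ) / 2 - ((ℓ + j : ℕ) : ℤ) / 2) + 1) by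
          push_cast; ring_nf, zpow_add₀ Complex.I_ne_zero, zpow_add_one₀ Complex.I_ne_zero,
        qPoch_succ, div_mul_div_comm]
      congr 1 <;> ring
    · rw [qPoch_succ, qPoch_succ, hW, hZ]
      ring
    · have hc := cL_sq hqt ht hr (ℓ := ℓ) (k := ℓ + j) (d := d) (by omega)
      rw [show ((ℓ + j : ℕ) : ℤ) - ℓ = j by push_cast; ring] at hc
      have ha : aL t ℓ s (j + 1) = (q * q ^ j)⁻¹ - 1 := by
        rw [aL, show (ℓ : ℤ) + (j + 1) + s = ((ℓ + s : ℕ) : ℤ) + ((j + 1 : ℕ) : ℤ) by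
            push_cast; ring,
          zpow_add₀ (by norm_num), zpow_natCast, zpow_natCast, he.neg_one_pow, one_mul,
          show -2 * ((j : ℤ) + 1) = -((2 * (j + 1) : ℕ) : ℤ) by push_cast; ring, zpow_neg,
          zpow_natCast, pow_mul, hqt, neg_pow q, mul_inv, ← pow_succ', ← mul_assoc,
          mul_inv_cancel₀ (by simp), one_mul]
      have hs : ((-1 : ℂ) ^ (ℓ + 1)) ^ 2 = 1 := by rw [← pow_mul, mul_comm, pow_mul]; simp
      have hZW : (-q) ^ (ℓ + j + 1) = -((-q) ^ (d + 1) * q * (q ^ j) ^ 2) := by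
        rw [show ℓ + j + 1 = d + 1 + (2 * j + 1) by omega, pow_add, pow_succ (-q) (2 * j),
          neg_q_pow_even, ← pow_mul, mul_comm j 2]
        ring
      rw [hc, ha, hZW]
      have hn : 1 - q * q ^ j ≠ 0 := by
        rw [← pow_succ']
        exact sub_ne_zero.2 (hq _ (by omega)).symm
      have hQ0 : q ^ j ≠ 0 := pow_ne_zero _ hq0
      have hW0 : (-q) ^ (d + 1) ≠ 0 := pow_ne_zero _ hu0
      rw [div_pow, mul_pow, mul_pow, mul_pow, mul_pow, hs, htt, Complex.I_sq]
      generalize Complex.I ^ (((ℓ + j + 1 : ℕ) : ℤ) / 2 - ((ℓ + j : ℕ) : ℤ) / 2) = i at *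
      generalize (-q) ^ (d + 1) = W at *
      generalize q ^ j = Q at *
      have f1 : (q * Q)⁻¹ - 1 = (1 - q * Q) / (q * Q) := by field_simp
      have f2 : 1 + q⁻¹ = (q + 1) / q := by field_simp
      rw [f1, f2]
      field_simp
      ring

theorem ratioAG_closed (hq : ∀ n : ℕ, 0 < n → q ^ n ≠ 1) (hqq : q - q⁻¹ ≠ 0) (ℓ s n : ℕ)
    (he : Even (ℓ + s)) (hn : n ≤ ℓ) : ∃ ρ : ℂ,
      ρ ^ 2 = qPoch ((-q) ^ (-ℓ : ℤ)) (-q) n * qPoch ((-q) ^ (ℓ + 1)) (-q) n ∧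
      ratioAG q t r ℓ s n =
        (-1) ^ (n * ℓ) * Complex.I ^ ((ℓ - n) / 2 - ℓ / 2 + n ^ 2 : ℤ) * ρ /
          ((q - q⁻¹) ^ n * qPoch q q n) := by
  have ht0 := NeZero.ne t
  have hq0 : q ≠ 0 := neg_ne_zero.1 (hqt ▸ pow_ne_zero 2 ht0)
  have hP := qPoch_self_ne_zero hq
  suffices h : ratioAG q t r ℓ s n ^ 2 = ((-1) ^ (n * ℓ) *
      Complex.I ^ ((ℓ - n) / 2 - ℓ / 2 + n ^ 2 : ℤ) / ((q - q⁻¹) ^ n * qPoch q q n)) ^ 2 *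
      (qPoch ((-q) ^ (-ℓ : ℤ)) (-q) n * qPoch ((-q) ^ (ℓ + 1)) (-q) n) by
    obtain ⟨ρ, h1, h2⟩ := exists_root (div_ne_zero (by simp [zpow_ne_zero, Complex.I_ne_zero])
      (mul_ne_zero (pow_ne_zero _ hqq) (hP n))) h
    exact ⟨ρ, h1, by rw [h2]; ring⟩
  induction n with
  | zero => simp [ratioAG, qPoch]
  | succ n ih =>
    obtain ⟨d, hd⟩ : ∃ d, n + 1 + d = ℓ := ⟨ℓ - (n + 1), by omega⟩
    have hu0 : -q ≠ 0 := neg_ne_zero.2 hq0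
    have hW : (-q) ^ (-ℓ : ℤ) * (-q) ^ n = ((-q) ^ (d + 1))⁻¹ := by
      rw [← zpow_natCast, ← zpow_natCast, ← zpow_neg, ← zpow_add₀ hu0]
      congr 1
      push_cast
      omega
    have hZ : (-q) ^ (ℓ + 1) * (-q) ^ n = (-q) ^ (ℓ + n + 1) := by
      rw [← pow_add]
      congr 1
      omega
    refine sq_step (aL_ne_zero ht ℓ s (by omega) (by omega)) (ratioAG_succ ht hn)
      (ih (by omega)) (μ := (-1) ^ ℓ *
        Complex.I ^ ((d : ℤ) / 2 - ((d + 1 : ℕ) : ℤ) / 2) * (Complex.I * Complex.I ^ (2 * n)) /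
        ((q - q⁻¹) * (1 - q * q ^ n)))
      (ν := (1 - ((-q) ^ (d + 1))⁻¹) * (1 - (-q) ^ (ℓ + n + 1))) ?_ ?_ ?_
    · have hexp : ((ℓ : ℤ) - (n + 1 : ℕ)) / 2 - ℓ / 2 + (n + 1 : ℕ) ^ 2 =
          ((ℓ - n) / 2 - ℓ / 2 + n ^ 2) + (((d : ℤ) / 2 - ((d + 1 : ℕ) : ℤ) / 2) +
            ((2 * n + 1 : ℕ) : ℤ)) := by
        rw [show (ℓ : ℤ) - (n + 1 : ℕ) = d by omega, show (ℓ : ℤ) - n = (d + 1 : ℕ) by omega]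
        push_cast
        ring
      rw [hexp, zpow_add₀ Complex.I_ne_zero ((ℓ - n) / 2 - ℓ / 2 + n ^ 2 : ℤ),
        zpow_add₀ Complex.I_ne_zero ((d : ℤ) / 2 - ((d + 1 : ℕ) : ℤ) / 2), zpow_natCast,
        qPoch_succ, div_mul_div_comm]
      congr 1 <;> ring
    · rw [qPoch_succ, qPoch_succ, hW, hZ]
      ring
    · have hb := bL_sq hqt ht hr (ℓ := ℓ) (k := d) (d := ℓ + n) (by omega) hqq
      rw [show (d : ℤ) + 1 - ℓ = -n by omega] at hb
      have ha : aL t ℓ s (-(n + 1)) = q * q ^ n - 1 := by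
        rw [aL, show (ℓ : ℤ) + -(n + 1) + s = ((ℓ + s : ℕ) : ℤ) - ((n + 1 : ℕ) : ℤ) by
            push_cast; ring,
          zpow_sub₀ (by norm_num), zpow_natCast, zpow_natCast, he.neg_one_pow,
          show -2 * -((n : ℤ) + 1) = ((2 * (n + 1) : ℕ) : ℤ) by push_cast; ring,
          zpow_natCast, pow_mul, hqt, neg_pow q, ← pow_succ', ← mul_assoc, one_div,
          inv_mul_cancel₀ (by simp), one_mul]
      have hs : ((-1 : ℂ) ^ ℓ) ^ 2 = 1 := by rw [← pow_mul, mul_comm, pow_mul]; simp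
      have hI : (Complex.I * Complex.I ^ (2 * n)) ^ 2 = -1 := by
        rw [mul_pow, Complex.I_sq, pow_mul, Complex.I_sq, ← pow_mul, mul_comm n, pow_mul]
        simp
      rw [hb, ha]
      have hn : 1 - q * q ^ n ≠ 0 := by
        rw [← pow_succ']
        exact sub_ne_zero.2 (hq _ (by omega)).symm
      have hW0 : (-q) ^ (d + 1) ≠ 0 := pow_ne_zero _ hu0
      rw [div_pow, mul_pow, mul_pow, hs, hI]
      generalize Complex.I ^ ((d : ℤ) / 2 - ((d + 1 : ℕ) : ℤ) / 2) = i at *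
      generalize (-q) ^ (d + 1) = W at *
      generalize (-q) ^ (ℓ + n + 1) = Z at *
      generalize q ^ n = Q at *
      generalize q - q⁻¹ = p at *
      have f1 : (q * Q - 1) ^ 2 = (1 - q * Q) ^ 2 := by ring
      rw [f1]
      field_simp
      ring

end closed

/-! ### The spaces of left invariants -/

/-- The label of the row `(m_{ij} σ^e)_j` for an integer `ℓ` and `i ∈ I_ℓ`. -/
def blockOf (ℓ e : ℕ) (i : ℤ) (he : e < 2) (hi : i ∈ idx ℓ) : Block :=
  ⟨2 * ℓ, ⟨e, he⟩, ⟨(ℓ + i).toNat, by rw [idx, Finset.mem_Icc] at hi; omega⟩⟩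

theorem exists_blockOf (ℓ : ℕ) (e : Fin 2) (i : Fin (2 * ℓ + 1)) :
    ∃ (j : ℤ) (hj : j ∈ idx ℓ), blockOf ℓ e j e.2 hj = ⟨2 * ℓ, e, i⟩ := by
  refine ⟨i - ℓ, by rw [idx, Finset.mem_Icc]; omega, ?_⟩
  have h : ((ℓ : ℤ) + (i - ℓ)).toNat = (i : ℕ) := by omega
  simp only [blockOf, h]

theorem sum_idx {M : Type*} [AddCommMonoid M] (ℓ : ℕ) (f : ℤ → M) :
    ∑ j ∈ idx ℓ, f j = ∑ k ∈ Finset.range (2 * ℓ + 1), f (k - ℓ) := by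
  refine Finset.sum_nbij' (fun j => (j + ℓ).toNat) (fun k => (k : ℤ) - ℓ) ?_ ?_ ?_ ?_ ?_
  · intro j hj
    rw [idx, Finset.mem_Icc] at hj
    rw [Finset.mem_range]
    omega
  · intro k hk
    rw [Finset.mem_range] at hk
    rw [idx, Finset.mem_Icc]
    omega
  · intro j hj
    rw [idx, Finset.mem_Icc] at hj
    omega
  · intro k _
    simp
  · intro j hj
    rw [idx, Finset.mem_Icc] at hj
    congr 1
    omega

section sums
variable {t : ℂ} {r : ℕ → ℕ → ℂ} {ℓ e : ℕ} {i : ℤ} (he : e < 2) (hi : i ∈ idx ℓ)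

theorem matEl_mul_s_pow (k : ℕ) : matEl t r ℓ i (k - ℓ) * gen t s ^ e =
    (-1 : ℂ) ^ ((ℓ + i).toNat * k) • rowEl t r (blockOf ℓ e i he hi) k := by
  have h : ((ℓ : ℤ) + (k - ℓ)).toNat = k := by omega
  rw [rowEl, smul_smul, matEl, h, blockOf, ← mul_pow]
  simp

theorem sum_even_row {y : ℤ → ℂ} (hy : ∀ k : ℕ, Odd k → y (k - ℓ) = 0) :
    ∑ j ∈ idx ℓ, y j • (matEl t r ℓ i j * gen t s ^ e) =
      ∑ k ∈ Finset.range (2 * ℓ + 1), y (k - ℓ) • rowEl t r (blockOf ℓ e i he hi) k := by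
  rw [sum_idx]
  refine Finset.sum_congr rfl fun k _ => ?_
  rcases Nat.even_or_odd k with hk | hk
  · rw [matEl_mul_s_pow he hi, (hk.mul_left _).neg_one_pow, one_smul]
  · rw [hy k hk, zero_smul, zero_smul]

theorem sum_signed_row (y : ℤ → ℂ) :
    ∑ j ∈ idx ℓ, ((-1) ^ ((ℓ + i) * j) * y j) • (matEl t r ℓ i j * gen t s ^ e) =
      (-1 : ℂ) ^ ((ℓ + i).toNat * ℓ) •
        ∑ k ∈ Finset.range (2 * ℓ + 1), y (k - ℓ) • rowEl t r (blockOf ℓ e i he hi) k := by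
  have hI : (ℓ : ℤ) + i = ((ℓ + i).toNat : ℕ) := by rw [idx, Finset.mem_Icc] at hi; omega
  rw [sum_idx, Finset.smul_sum]
  refine Finset.sum_congr rfl fun k _ => ?_
  have h1 : (-1 : ℂ) ^ (((ℓ : ℤ) + i) * (k - ℓ)) =
      (-1) ^ ((ℓ + i).toNat * k) * (-1) ^ ((ℓ + i).toNat * ℓ) := by
    have h2 : ((-1 : ℂ) ^ ((ℓ + i).toNat * ℓ))⁻¹ = (-1) ^ ((ℓ + i).toNat * ℓ) := by
      rw [← inv_pow, inv_neg, inv_one]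
    rw [mul_sub, zpow_sub₀ (by norm_num), div_eq_mul_inv, hI]
    norm_cast
    push_cast
    rw [h2]
  have h3 : (-1 : ℂ) ^ ((ℓ + i).toNat * k) * (-1) ^ ((ℓ + i).toNat * k) = 1 := by
    rw [← mul_pow]; simp
  rw [matEl_mul_s_pow he hi, smul_smul, smul_smul, h1]
  congr 1
  linear_combination ((-1) ^ ((ℓ + i).toNat * ℓ) * y (k - ℓ)) * h3

end sums

section invariants
variable {q t : ℂ} [NeZero t] {r : ℕ → ℕ → ℂ} {α β γ : ℂ}

/-- The left invariants are the span of a set `G` if the elements of `G` are multiples of solutions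
of the systems of the single rows, and if `G` spans the solutions of each row. -/
theorem leftInvariants_eq_span {b : Module.Basis Idx ℂ (A t)}
    (hb : ∀ x, b x = rowEl t r x.1 x.2) (hr : ∀ n m, m ≤ n → r n m ≠ 0)
    (ht : ∀ n : ℕ, 0 < n → t ^ n ≠ 1) {G : Set (A t)}
    (h1 : ∀ u ∈ G, ∃ B : Block, ∃ y, Sys q t r α β γ B.1 B.2.1 y ∧
      ∃ z : ℂ, u = z • ∑ k ∈ Finset.range (B.1 + 1), y k • rowEl t r B k)
    (h2 : ∀ (B : Block) (y : ℕ → ℂ), Sys q t r α β γ B.1 B.2.1 y →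
      ∑ k ∈ Finset.range (B.1 + 1), y k • rowEl t r B k ∈ Submodule.span ℂ G) :
    leftInvariants (xFun q t α β γ) = Submodule.span ℂ G := by
  refine le_antisymm (fun u hu => ?_) (Submodule.span_le.2 fun u hu => ?_)
  · rw [mem_leftInvariants_iff_sys hb hr ht] at hu
    exact mem_of_rows_mem hb fun B => h2 B _ (hu B)
  · obtain ⟨B, y, hy, z, rfl⟩ := h1 u hu
    exact Submodule.smul_mem _ _ (row_mem_leftInvariants hb hr ht _ _ _ hy)

omit [NeZero t] in
theorem sum_mem_of_sub_eq_zero {B : Block} {y w : ℕ → ℂ} {z : ℂ} {P : Submodule ℂ (A t)}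
    (h : ∀ k ≤ B.1, y k - z * w k = 0)
    (hw : ∑ k ∈ Finset.range (B.1 + 1), w k • rowEl t r B k ∈ P) :
    ∑ k ∈ Finset.range (B.1 + 1), y k • rowEl t r B k ∈ P := by
  have : ∑ k ∈ Finset.range (B.1 + 1), y k • rowEl t r B k =
      z • ∑ k ∈ Finset.range (B.1 + 1), w k • rowEl t r B k := by
    rw [Finset.smul_sum]
    refine Finset.sum_congr rfl fun k hk => ?_
    rw [smul_smul, ← sub_eq_zero.1 (h k (Nat.lt_succ_iff.1 (Finset.mem_range.1 hk)))]
  rw [this]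
  exact P.smul_mem z hw

omit [NeZero t] in
theorem sum_mem_of_eq_zero {B : Block} {y : ℕ → ℂ} {P : Submodule ℂ (A t)}
    (h : ∀ k ≤ B.1, y k = 0) :
    ∑ k ∈ Finset.range (B.1 + 1), y k • rowEl t r B k ∈ P := by
  rw [Finset.sum_eq_zero fun k hk => by
    rw [h k (Nat.lt_succ_iff.1 (Finset.mem_range.1 hk)), zero_smul]]
  exact P.zero_mem

/-- The left action is by twisted derivations, so its kernel is closed under multiplication. -/
theorem subalgebra_of_invariants :
    ∃ B : Subalgebra ℂ (A t), Subalgebra.toSubmodule B = leftInvariants (xFun q t α β 0) := by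
  have h1 : (1 : A t) ∈ leftInvariants (xFun q t α β 0) := by
    rw [mem_leftInvariants_xFun, E_one, F_one]
    simp
  refine ⟨(leftInvariants (xFun q t α β 0)).toSubalgebra h1 fun u v hu hv => ?_,
    Submodule.toSubalgebra_toSubmodule _ _ _⟩
  rw [mem_leftInvariants_xFun, zero_smul, add_zero] at *
  rw [E_mul, F_mul]
  calc _ = (α • E q t u + β • F t u) * v +
        theta t (K t u) * (α • E q t v + β • F t v) := by
        simp only [add_mul, mul_add, smul_add, smul_mul_assoc, mul_smul_comm]
        abel
    _ = 0 := by rw [hu, hv, zero_mul, mul_zero, add_zero]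

variable (ht : ∀ n : ℕ, 0 < n → t ^ n ≠ 1)
  (hr : ∀ n m : ℕ, m ≤ n → r n m ^ 2 = qBinom (t⁻¹ ^ 2) n m) (hq : q - q⁻¹ ≠ 0)
include ht hr hq

theorem leftInvariants_alpha_beta (hα : α ≠ 0) (hβ : β ≠ 0) :
    leftInvariants (xFun q t α β 0) =
      Submodule.span ℂ {u | ∃ ℓ e : ℕ, e < 2 ∧ ∃ i ∈ idx ℓ,
        u = ∑ j ∈ idx ℓ, yAB q t r α β ℓ j • (matEl t r ℓ i j * gen t s ^ e)} := by
  have hr0 := root_ne_zero ht hr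
  obtain ⟨b, hb⟩ := exists_basis hr0 ht hq
  have hodd : ∀ ℓ k : ℕ, Odd k → yAB q t r α β ℓ (k - ℓ) = 0 := by
    rintro ℓ _ ⟨m, rfl⟩
    exact yAB_odd α β ℓ m
  refine leftInvariants_eq_span hb hr0 ht ?_ ?_
  · rintro _ ⟨ℓ, e, he, i, hi, rfl⟩
    exact ⟨blockOf ℓ e i he hi, _, sys_yAB ht hr hq hα β ℓ e, 1, by
      rw [sum_even_row he hi (hodd ℓ), one_smul]; rfl⟩
  · rintro ⟨n, e, i⟩ y hy
    rcases Nat.even_or_odd' n with ⟨ℓ, rfl | rfl⟩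
    · have h1 := (hy.sub_smul (sys_yAB ht hr hq hα β ℓ e) (y 0)).eq_zero_of_alpha_beta
        ht hr0 hq hα hβ fun _ => by rw [yAB_pivot]; ring
      refine sum_mem_of_sub_eq_zero h1 (Submodule.subset_span ?_)
      obtain ⟨j, hj, hB⟩ := exists_blockOf ℓ e i
      refine ⟨ℓ, e, e.2, j, hj, ?_⟩
      rw [sum_even_row e.2 hj (hodd ℓ), hB]
    · exact sum_mem_of_eq_zero (hy.eq_zero_of_alpha_beta ht hr0 hq hα hβ fun h =>
        absurd h (by simp))

theorem leftInvariants_beta_gamma (hγ : γ ≠ 0) :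
    leftInvariants (xFun q t 0 β γ) =
      Submodule.span ℂ {u | ∃ ℓ e : ℕ, e < 2 ∧ Even (ℓ + e) ∧ ∃ i ∈ idx ℓ,
        u = ∑ j ∈ idx ℓ, ((-1) ^ ((ℓ + i) * j) * yBG t r β γ ℓ e j) •
          (matEl t r ℓ i j * gen t s ^ e)} := by
  have hr0 := root_ne_zero ht hr
  obtain ⟨b, hb⟩ := exists_basis hr0 ht hq
  refine leftInvariants_eq_span hb hr0 ht ?_ ?_
  · rintro _ ⟨ℓ, e, he, hev, i, hi, rfl⟩
    exact ⟨blockOf ℓ e i he hi, _, sys_yBG ht hr β hγ hev, _, sum_signed_row he hi _⟩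
  · rintro ⟨n, e, i⟩ y hy
    by_cases hgood : ∃ ℓ : ℕ, n = 2 * ℓ ∧ Even (ℓ + e)
    · obtain ⟨ℓ, rfl, hev⟩ := hgood
      have h1 := (hy.sub_smul (sys_yBG ht hr β hγ hev) (y ℓ)).eq_zero_of_beta_gamma hγ
        fun k _ hk => by
          obtain rfl : ℓ = k := by have := (kN_eq_one ht hk).1; simp only at this; omega
          rw [yBG_pivot]
          ring
      refine sum_mem_of_sub_eq_zero h1 ?_
      obtain ⟨j, hj, hB⟩ := exists_blockOf ℓ e i
      have h2 := sum_signed_row (t := t) (r := r) e.2 hj (yBG t r β γ ℓ e)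
      rw [hB] at h2
      refine (Submodule.smul_mem_iff _ (pow_ne_zero ((ℓ + j).toNat * ℓ)
        (neg_ne_zero.2 (one_ne_zero (α := ℂ))))).1 (Submodule.subset_span ?_)
      exact ⟨ℓ, e, e.2, hev, j, hj, h2.symm⟩
    · exact sum_mem_of_eq_zero (hy.eq_zero_of_beta_gamma hγ fun k _ hk =>
        absurd ⟨k, kN_eq_one ht hk⟩ hgood)

theorem leftInvariants_alpha_gamma (hγ : γ ≠ 0) :
    leftInvariants (xFun q t α 0 γ) =
      Submodule.span ℂ {u | ∃ ℓ e : ℕ, e < 2 ∧ Even (ℓ + e) ∧ ∃ i ∈ idx ℓ,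
        u = ∑ j ∈ idx ℓ, ((-1) ^ ((ℓ + i) * j) * yAG q t r α γ ℓ e j) •
          (matEl t r ℓ i j * gen t s ^ e)} := by
  have hr0 := root_ne_zero ht hr
  obtain ⟨b, hb⟩ := exists_basis hr0 ht hq
  refine leftInvariants_eq_span hb hr0 ht ?_ ?_
  · rintro _ ⟨ℓ, e, he, hev, i, hi, rfl⟩
    exact ⟨blockOf ℓ e i he hi, _, sys_yAG ht hr α hγ hev, _, sum_signed_row he hi _⟩
  · rintro ⟨n, e, i⟩ y hy
    by_cases hgood : ∃ ℓ : ℕ, n = 2 * ℓ ∧ Even (ℓ + e)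
    · obtain ⟨ℓ, rfl, hev⟩ := hgood
      have h1 := (hy.sub_smul (sys_yAG ht hr α hγ hev) (y ℓ)).eq_zero_of_alpha_gamma hγ
        fun k _ hk => by
          obtain rfl : ℓ = k := by have := (kN_eq_one ht hk).1; simp only at this; omega
          rw [yAG_pivot]
          ring
      refine sum_mem_of_sub_eq_zero h1 ?_
      obtain ⟨j, hj, hB⟩ := exists_blockOf ℓ e i
      have h2 := sum_signed_row (t := t) (r := r) e.2 hj (yAG q t r α γ ℓ e)
      rw [hB] at h2
      refine (Submodule.smul_mem_iff _ (pow_ne_zero ((ℓ + j).toNat * ℓ)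
        (neg_ne_zero.2 (one_ne_zero (α := ℂ))))).1 (Submodule.subset_span ?_)
      exact ⟨ℓ, e, e.2, hev, j, hj, h2.symm⟩
    · exact sum_mem_of_eq_zero (hy.eq_zero_of_alpha_gamma hγ fun k _ hk =>
        absurd ⟨k, kN_eq_one ht hk⟩ hgood)

end invariants

end OSpQ

end

/-- The left invariants of `x_{αβ}`, `x_{βγ}` and `x_{αγ}` in `ℂ_q[osp(1,2)]`. -/
theorem theorem3p7 (q : ℂ) (hq0 : q ≠ 0) (hq : ∀ n : ℕ, 0 < n → q ^ n ≠ 1)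
    (t : ℂ) [NeZero t] (ht : t ^ 2 = -q)
    (r : ℕ → ℕ → ℂ) (hr : ∀ n m : ℕ, m ≤ n → r n m ^ 2 = OSpQ.qBinom (t⁻¹ ^ 2) n m)
    (α β γ : ℂ) (hα : α ≠ 0) (hβ : β ≠ 0) (hγ : γ ≠ 0) :
    -- the left invariants of `x_{αβ}`, which form a subalgebra
    (OSpQ.leftInvariants (OSpQ.xFun q t α β 0) =
        Submodule.span ℂ {u | ∃ ℓ s : ℕ, s < 2 ∧ ∃ i ∈ OSpQ.idx ℓ,
          u = ∑ j ∈ OSpQ.idx ℓ, OSpQ.yAB q t r α β ℓ j •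
            (OSpQ.matEl t r ℓ i j * OSpQ.gen t OSpQ.Gen.s ^ s)} ∧
      ∃ B : Subalgebra ℂ (OSpQ.A t),
        Subalgebra.toSubmodule B = OSpQ.leftInvariants (OSpQ.xFun q t α β 0)) ∧
    -- the left invariants of `x_{βγ}`
    OSpQ.leftInvariants (OSpQ.xFun q t 0 β γ) =
      Submodule.span ℂ {u | ∃ ℓ s : ℕ, s < 2 ∧ Even (ℓ + s) ∧ ∃ i ∈ OSpQ.idx ℓ,
        u = ∑ j ∈ OSpQ.idx ℓ, ((-1) ^ ((ℓ + i) * j) * OSpQ.yBG t r β γ ℓ s j) •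
          (OSpQ.matEl t r ℓ i j * OSpQ.gen t OSpQ.Gen.s ^ s)} ∧
    -- the left invariants of `x_{αγ}`
    OSpQ.leftInvariants (OSpQ.xFun q t α 0 γ) =
      Submodule.span ℂ {u | ∃ ℓ s : ℕ, s < 2 ∧ Even (ℓ + s) ∧ ∃ i ∈ OSpQ.idx ℓ,
        u = ∑ j ∈ OSpQ.idx ℓ, ((-1) ^ ((ℓ + i) * j) * OSpQ.yAG q t r α γ ℓ s j) •
          (OSpQ.matEl t r ℓ i j * OSpQ.gen t OSpQ.Gen.s ^ s)} ∧
    -- closed forms of the quotients of products in the coefficients `y_j`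
    (∀ ℓ k : ℕ, k ≤ ℓ → ∃ ρ : ℂ,
      ρ ^ 2 = OSpQ.qPoch (q ^ (-2 * ℓ : ℤ)) (q ^ 2) k * OSpQ.qPoch (-q) (q ^ 2) k /
        (OSpQ.qPoch (-q ^ (-2 * ℓ + 1 : ℤ)) (q ^ 2) k * OSpQ.qPoch (q ^ 2) (q ^ 2) k) ∧
      OSpQ.ratioAB q t r ℓ k = Complex.I ^ k * q ^ k * (1 - q) ^ k * ρ) ∧
    (∀ ℓ s j : ℕ, s < 2 → Even (ℓ + s) → j ≤ ℓ → ∃ ρ : ℂ,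
      ρ ^ 2 = OSpQ.qPoch ((-q) ^ (-ℓ : ℤ)) (-q) j * OSpQ.qPoch ((-q) ^ (ℓ + 1)) (-q) j ∧
      OSpQ.ratioBG t r ℓ s j =
        (-1) ^ ((ℓ + 1) * j) * Complex.I ^ ((ℓ + j) / 2 - ℓ / 2 + j : ℤ) * q ^ j * ρ /
          ((t - t⁻¹) ^ j * OSpQ.qPoch q q j)) ∧
    (∀ ℓ s n : ℕ, s < 2 → Even (ℓ + s) → n ≤ ℓ → ∃ ρ : ℂ,
      ρ ^ 2 = OSpQ.qPoch ((-q) ^ (-ℓ : ℤ)) (-q) n * OSpQ.qPoch ((-q) ^ (ℓ + 1)) (-q) n ∧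
      OSpQ.ratioAG q t r ℓ s n =
        (-1) ^ (n * ℓ) * Complex.I ^ ((ℓ - n) / 2 - ℓ / 2 + n ^ 2 : ℤ) * ρ /
          ((q - q⁻¹) ^ n * OSpQ.qPoch q q n)) := by
  have htn : ∀ n : ℕ, 0 < n → t ^ n ≠ 1 := by
    intro n hn h
    -- since `t ^ 4 = q ^ 2`, if `t` is a root of unity, then so is `q`
    apply hq (2 * n) (by omega)
    have h1 : t ^ (4 * n) = q ^ (2 * n) := by
      rw [show 4 * n = 2 * (2 * n) by ring, pow_mul, ht, (even_two_mul n).neg_pow]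
    rw [← h1, mul_comm, pow_mul, h, one_pow]
  have hqq : q - q⁻¹ ≠ 0 := by
    intro h
    apply hq 2 two_pos
    rw [pow_two]
    nth_rw 2 [sub_eq_zero.1 h]
    exact mul_inv_cancel₀ hq0
  exact ⟨⟨OSpQ.leftInvariants_alpha_beta htn hr hqq hα hβ, OSpQ.subalgebra_of_invariants⟩,
    OSpQ.leftInvariants_beta_gamma htn hr hqq hγ, OSpQ.leftInvariants_alpha_gamma htn hr hqq hγ,
    fun ℓ k hk => OSpQ.ratioAB_closed ht htn hr hq hqq ℓ k hk,
    fun ℓ e j _ he hj => OSpQ.ratioBG_closed ht htn hr hq ℓ e j he hj,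
    fun ℓ e n _ he hn => OSpQ.ratioAG_closed ht htn hr hq hqq ℓ e n he hn⟩
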